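/- **Theorem 3.1 (inversion as a Givental transformation).** Let $n\ge 2$, let $\eta_{\alpha\beta}=\delta_{\alpha+\beta,n+1}$ ($1\le\alpha,\beta\le n$), $\eta^{\alpha\beta}=\eta_{\alpha\beta}$, $t_\sigma t^\sigma=\sum_{\alpha,\beta}\eta_{\alpha\beta}t^\alpha t^\beta$, and let $F$ be a (real or complex) smooth function on an open set $U$ of $n$-space with $(0,\dots,0,1)\in U$ that is the potential of a Frobenius manifold in flat coordinates $t^1,\dots,t^n$ with metric $\eta$ and unit $\partial_1$: $$\partial_1\partial_\alpha\partial_\beta F=\eta_{\alpha\beta},\qquad \partial_\alpha\partial_\beta\partial_\mu F\,\eta^{\mu\nu}\,\partial_\nu\partial_\gamma\partial_\delta F=\partial_\alpha\partial_\gamma\partial_\mu F\,\eta^{\mu\nu}\,\partial_\nu\partial_\beta\partial_\delta F .$$ No semisimplicity and no Euler field is assumed. Let $F$ be normalized in the usual way by $\partial_1F=\tfrac12 t_\sigma t^\sigma$, i.e. locally $F=\tfrac12t^1\,t_\sigma t^\sigma-\tfrac12(t^1)^2t^n+H(t^2,\dots,t^n)$. The inversion transformation of $F$ is $$\hat F(\hat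 t)=(\hat t^n)^2F(t)+\tfrac12\hat t^1\,\hat t_\sigma\hat t^\sigma,\qquad t^1=\frac{\hat t_\sigma\hat t^\sigma}{2\hat t^n},\quad t^\alpha=-\frac{\hat t^\alpha}{\hat t^n}\ (\alpha\ne1,n),\quad t^n=-\frac1{\hat t^n}.$$ There is a unique formal power series $\mathcal F_0$ in variables $t^{d,\mu}$ ($d\ge0$, $1\le\mu\le n$), without terms of degree less than three, whose restriction to $t^{d,\mu}=0$ $(d>0)$, $t^{0,\mu}=t^\mu$, is the Taylor series of $F$ at $(0,\dots,0,1)$ up to terms of degree at most two, and which satisfies the genus zero topological recursion relation $$\partial_{d+1,\alpha}\partial_{a,\beta}\partial_{b,\gamma}\mathcal F_0=\sum_{\lambda,\sigma}\partial_{d,\alpha}\partial_{0,\lambda}\mathcal F_0\;\eta^{\lambda\sigma}\;\partial_{0,\sigma}\partial_{a,\beta}\partial_{b,\gamma}\mathcal F_0 ,\qquad \partial_{d,\mu}=\frac{\partial}{\partial t^{d,\mu}}$$ (the genus zero potential of the cohomological field theory determined by the local expansion of $F$). Let $\mathcal F_g$, $g\ge1$, be arbitrary formal power series in the $t^{d,\mu}$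 with $\mathcal F_1(0)=0$, and let $Z=\exp\big(\sum_{g\ge0}\hbar^{g-1}\mathcal F_g\big)$. Let $r_1$ be the matrix unit whose only non-zero entry is $(r_1)^1_n=1$, and $r_k=0$ for $k>1$. Let $\hat R=\exp\big(\sum_{l\ge1}(r_lz^l)\hat{\ }\big)$, where $$(r_lz^l)\hat{\ }=-(r_l)_1^\mu\partial_{l+1,\mu}+\sum_{d\ge0}t^{d,\nu}(r_l)^\mu_\nu\,\partial_{d+l,\mu}+\frac\hbar2\sum_{i=0}^{l-1}(-1)^{i+1}(r_l)^{\mu\nu}\,\partial_{i,\mu}\partial_{l-1-i,\nu},\qquad (r_l)^{\mu\nu}=(r_l)^\mu_\rho\,\eta^{\rho\nu}.$$ Then the exponential series that define $Z$ and $\hat RZ$ converge coefficientwise (each coefficient is eventually constant), and there are unique formal power series $\mathcal G_g$, $g\ge0$, in the $t^{d,\mu}$, where $\mathcal G_0$ has no terms of degree less than three and $\mathcal G_1(0)=0$, such that $$\hat RZ=\exp\Big(\sum_{g\ge0}\hbar^{g-1}\mathcal G_g\Big).$$ The genus zero part without descendants, $\mathcal G_0|_{t^{d,\mu}=0\text{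 for }d>0}$, equals the Taylor series of $\hat F$ at $(0,\dots,0,-1)$ (in the variables $\hat t^1,\dots,\hat t^{n-1},\hat t^n+1$), up to terms of degree at most two. -/

import Mathlib

/-!
Dimension of the Frobenius manifold: `n + 2`, with `n : ℕ`. The indices `1, …, n + 2` are the
elements of `Fin (n + 2)`: the first index (the unit direction) is `0`, the last one is
`Fin.last (n + 1)`, and the dual index of `α` is `Fin.rev α`.
-/

noncomputable section

namespace Givental

open Filter

/-! ### Flat metric, Frobenius potentials, Taylor expansions -/

section Frobenius

variable {𝕜 : Type*} [RCLike 𝕜] {n : ℕ}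

/-- The constant metric in flat coordinates: `η_{αβ} = 1` if `α` and `β` are dual indices, and
`0` otherwise. -/
def eta (𝕜 : Type*) [RCLike 𝕜] (n : ℕ) : Matrix (Fin (n + 2)) (Fin (n + 2)) 𝕜 :=
  Matrix.of fun α β => if β = α.rev then 1 else 0

/-- The matrix `η` is its own inverse, so that `η^{αβ} = η_{αβ}`. -/
theorem eta_mul_eta : eta 𝕜 n * eta 𝕜 n = 1 := by
  ext α β
  simp only [eta, Matrix.mul_apply, Matrix.of_apply, Matrix.one_apply]
  rw [Finset.sum_eq_single α.rev]
  · simp [Fin.rev_rev, eq_comm]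
  · intro x _ hx
    simp [hx]
  · simp

/-- `t_σ t^σ = ∑ η_{αβ} t^α t^β`. -/
def etaSq (t : Fin (n + 2) → 𝕜) : 𝕜 := ∑ α, ∑ β, eta 𝕜 n α β * t α * t β

/-- The partial derivative `∂f/∂t^α`. -/
def partialD (α : Fin (n + 2)) (f : (Fin (n + 2) → 𝕜) → 𝕜) : (Fin (n + 2) → 𝕜) → 𝕜 :=
  fun t => fderiv 𝕜 f t (Pi.single α 1)

/-- The iterated partial derivative of multi-order `m`. -/
def iteratedPartialD (m : Fin (n + 2) →₀ ℕ) (f : (Fin (n + 2) → 𝕜) → 𝕜) :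
    (Fin (n + 2) → 𝕜) → 𝕜 :=
  (List.finRange (n + 2)).foldr (fun α g => (partialD α)^[m α] g) f

/-- The local expansion of `f` at `p`: the formal Taylor series in the variables `t^α - p^α`. -/
def localExpansion (f : (Fin (n + 2) → 𝕜) → 𝕜) (p : Fin (n + 2) → 𝕜) :
    MvPowerSeries (Fin (n + 2)) 𝕜 :=
  fun m => (∏ α, ((m α).factorial : 𝕜))⁻¹ * iteratedPartialD m f p

/-- `F` is the potential of a Frobenius manifold structure on the domain `U` of flat
coordinates, with metric `η` and unit `∂/∂t^1`. No Euler field and no semisimplicity. -/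
structure IsFrobeniusPotential (U : Set (Fin (n + 2) → 𝕜)) (F : (Fin (n + 2) → 𝕜) → 𝕜) :
    Prop where
  /-- smoothness -/
  smooth : ContDiffOn 𝕜 ((⊤ : ℕ∞) : WithTop ℕ∞) F U
  /-- `∂_1 ∂_α ∂_β F = η_{αβ}` -/
  unit : ∀ t ∈ U, ∀ α β, partialD 0 (partialD α (partialD β F)) t = eta 𝕜 n α β
  /-- the associativity (WDVV) equations -/
  wdvv : ∀ t ∈ U, ∀ α β γ δ,
    ∑ μ, ∑ ν, partialD α (partialD β (partialD μ F)) t * eta 𝕜 n μ ν *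
        partialD ν (partialD γ (partialD δ F)) t =
    ∑ μ, ∑ ν, partialD α (partialD γ (partialD μ F)) t * eta 𝕜 n μ ν *
        partialD ν (partialD β (partialD δ F)) t

/-! ### The inversion transformation -/

/-- The change of coordinates `t ↦ t̂`. -/
def inversion (t : Fin (n + 2) → 𝕜) : Fin (n + 2) → 𝕜 := fun α =>
  if α = 0 then 1 / 2 * (etaSq t / t (Fin.last (n + 1)))
  else if α = Fin.last (n + 1) then -1 / t (Fin.last (n + 1))
  else t α / t (Fin.last (n + 1))

/-- The inverse change of coordinates `t̂ ↦ t`. -/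
def inversionInv (s : Fin (n + 2) → 𝕜) : Fin (n + 2) → 𝕜 := fun α =>
  if α = 0 then 1 / 2 * (etaSq s / s (Fin.last (n + 1)))
  else if α = Fin.last (n + 1) then -1 / s (Fin.last (n + 1))
  else -(s α / s (Fin.last (n + 1)))

/-- The inversion-transformed potential
`F̂(t̂) = (t̂^n)² F(t) + ½ t̂^1 t̂_σ t̂^σ`, where `t` is the point with coordinates `t̂`. -/
def invertedPotential (F : (Fin (n + 2) → 𝕜) → 𝕜) : (Fin (n + 2) → 𝕜) → 𝕜 := fun s =>
  (s (Fin.last (n + 1))) ^ 2 * F (inversionInv s) + 1 / 2 * s 0 * etaSq s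

theorem etaSq_eq (t : Fin (n + 2) → 𝕜) :
    etaSq t = 2 * t 0 * t (Fin.last (n + 1)) +
      ∑ i : Fin n, t i.succ.castSucc * t i.succ.castSucc.rev := by
  have h : etaSq t = ∑ α, t α * t α.rev := by
    simp [etaSq, eta]
  rw [h, Fin.sum_univ_castSucc, Fin.sum_univ_succ]
  simp only [Fin.castSucc_zero, Fin.rev_zero, Fin.rev_last]
  ring

theorem etaSq_inversion (t : Fin (n + 2) → 𝕜) (ht : t (Fin.last (n + 1)) ≠ 0) :
    etaSq (inversion t) = -2 * t 0 / t (Fin.last (n + 1)) := by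
  have h1 : ∀ i : Fin n, i.succ.castSucc ≠ (0 : Fin (n + 2)) := by
    intro i h; simp [Fin.ext_iff] at h
  have h2 : ∀ i : Fin n, i.succ.castSucc ≠ Fin.last (n + 1) := by
    intro i h; simp [Fin.ext_iff] at h; omega
  have h3 : ∀ i : Fin n, i.succ.castSucc.rev ≠ (0 : Fin (n + 2)) := by
    intro i h; simp [Fin.ext_iff, Fin.val_rev] at h; omega
  have h4 : ∀ i : Fin n, i.succ.castSucc.rev ≠ Fin.last (n + 1) := by
    intro i h; simp [Fin.ext_iff, Fin.val_rev] at h; omega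
  have h5 : Fin.last (n + 1) ≠ 0 := by simp [Fin.ext_iff]
  have hs : ∑ i : Fin n, inversion t i.succ.castSucc * inversion t i.succ.castSucc.rev =
      (∑ i : Fin n, t i.succ.castSucc * t i.succ.castSucc.rev) /
        (t (Fin.last (n + 1))) ^ 2 := by
    rw [Finset.sum_div]
    refine Finset.sum_congr rfl fun i _ => ?_
    simp only [inversion, h1 i, h2 i, h3 i, h4 i, if_false]
    field_simp
  rw [etaSq_eq, hs]
  simp only [inversion, h5, if_true, if_false]
  rw [etaSq_eq t]
  field_simp
  ring

/-- The two changes of coordinates are inverse to each other. -/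
theorem inversionInv_inversion (t : Fin (n + 2) → 𝕜) (ht : t (Fin.last (n + 1)) ≠ 0) :
    inversionInv (inversion t) = t := by
  have h5 : Fin.last (n + 1) ≠ 0 := by simp [Fin.ext_iff]
  have hl : inversion t (Fin.last (n + 1)) = -1 / t (Fin.last (n + 1)) := by
    simp [inversion, h5]
  funext α
  by_cases h0 : α = 0
  · subst h0
    simp only [inversionInv, if_true, hl, etaSq_inversion t ht]
    field_simp
  · by_cases h1 : α = Fin.last (n + 1)
    · subst h1
      simp only [inversionInv, h5, if_true, if_false, hl]
      field_simp
    · simp only [inversionInv, h0, h1, if_false, hl]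
      simp only [inversion, h0, h1, if_false]
      field_simp

/-- The equivalent form `F̂(t̂) = (t^n)⁻² (F(t) - ½ t^1 t_σ t^σ)`. -/
theorem invertedPotential_inversion (F : (Fin (n + 2) → 𝕜) → 𝕜) (t : Fin (n + 2) → 𝕜)
    (ht : t (Fin.last (n + 1)) ≠ 0) :
    invertedPotential F (inversion t) =
      ((t (Fin.last (n + 1))) ^ 2)⁻¹ * (F t - 1 / 2 * t 0 * etaSq t) := by
  have h5 : Fin.last (n + 1) ≠ 0 := by simp [Fin.ext_iff]
  have hl : inversion t (Fin.last (n + 1)) = -1 / t (Fin.last (n + 1)) := by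
    simp [inversion, h5]
  have h0 : inversion t 0 = 1 / 2 * (etaSq t / t (Fin.last (n + 1))) := by
    simp [inversion]
  rw [invertedPotential, inversionInv_inversion t ht, etaSq_inversion t ht, hl, h0]
  field_simp
  ring

end Frobenius

/-! ### Descendant potentials -/

section Descendants

variable {𝕜 : Type*} [RCLike 𝕜] {n : ℕ}

/-- The labels `(d, μ)` of the variables `t^{d,μ}`, `d ≥ 0`. -/
abbrev Label (n : ℕ) : Type := ℕ × Fin (n + 2)

/-- A monomial in the variables `t^μ`, read as a monomial in the variables `t^{0,μ}`. -/
def primary (m : Fin (n + 2) →₀ ℕ) : Label n →₀ ℕ := m.mapDomain fun μ => ((0 : ℕ), μ)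

/-- `F₀` is the genus zero descendant potential of the cohomological field theory whose genus
zero part without descendants is `f`: all correlators have at least three insertions, the
restriction to `t^{d,μ} = 0` for `d > 0` is `f` up to terms of order at most two, and the
topological recursion relation
`⟪τ_{d+1}(α) τ_a(β) τ_b(γ)⟫ = ∑ ⟪τ_d(α) τ_0(λ)⟫ η^{λσ} ⟪τ_0(σ) τ_a(β) τ_b(γ)⟫` holds. -/
structure IsDescendantPotential (f : MvPowerSeries (Fin (n + 2)) 𝕜)
    (F₀ : MvPowerSeries (Label n) 𝕜) : Prop where
  stable : ∀ m : Label n →₀ ℕ, m.degree < 3 → MvPowerSeries.coeff m F₀ = 0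
  restrict : ∀ m : Fin (n + 2) →₀ ℕ, 3 ≤ m.degree →
    MvPowerSeries.coeff (primary m) F₀ = MvPowerSeries.coeff m f
  trr : ∀ (d : ℕ) (α : Fin (n + 2)) (v w : Label n),
    MvPowerSeries.pderiv 𝕜 (d + 1, α) (MvPowerSeries.pderiv 𝕜 v
        (MvPowerSeries.pderiv 𝕜 w F₀)) =
    ∑ l, ∑ s, eta 𝕜 n l s •
      (MvPowerSeries.pderiv 𝕜 (d, α) (MvPowerSeries.pderiv 𝕜 ((0 : ℕ), l) F₀) *
        MvPowerSeries.pderiv 𝕜 ((0 : ℕ), s) (MvPowerSeries.pderiv 𝕜 v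
          (MvPowerSeries.pderiv 𝕜 w F₀)))

/-- Correlators exist in the stable range `2 g - 2 + k > 0` only. -/
def IsStable (F : ℕ → MvPowerSeries (Label n) 𝕜) : Prop :=
  ∀ (g : ℕ) (m : Label n →₀ ℕ), 2 * g + m.degree ≤ 2 → MvPowerSeries.coeff m (F g) = 0

/-! ### Partition functions and the Givental action -/

/-- The total potential `∑_g ħ^{g-1} F_g`, a power series in the `t^{d,μ}` whose coefficients
are Laurent series in `ħ`. -/
def totalPotential (F : ℕ → MvPowerSeries (Label n) 𝕜) :
    MvPowerSeries (Label n) (LaurentSeries 𝕜) := fun m =>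
  HahnSeries.single (-1 : ℤ) (1 : 𝕜) *
    HahnSeries.ofPowerSeries ℤ 𝕜 (PowerSeries.mk fun g => MvPowerSeries.coeff m (F g))

/-- Formal series in `t^{d,μ}` and `ħ^{±1}`, given by their coefficients: `Z m j` is the
coefficient of `t^m ħ^j`. -/
abbrev CoeffFamily (𝕜 : Type*) (n : ℕ) : Type _ := (Label n →₀ ℕ) → ℤ → 𝕜

/-- `Z = exp (∑_g ħ^{g-1} F_g)`: the exponential series converges to `Z`, each coefficient
being eventually constant. -/
def IsPartitionFunction (F : ℕ → MvPowerSeries (Label n) 𝕜) (Z : CoeffFamily 𝕜 n) : Prop :=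
  ∀ (m : Label n →₀ ℕ) (j : ℤ), ∀ᶠ N : ℕ in atTop,
    ∑ k ∈ Finset.range N, ((k.factorial : 𝕜))⁻¹ *
      (MvPowerSeries.coeff m (totalPotential F ^ k)).coeff j = Z m j

/-- The operator `∂/∂t^v`. -/
def deriv (v : Label n) (Z : CoeffFamily 𝕜 n) : CoeffFamily 𝕜 n := fun m j =>
  ((m v : 𝕜) + 1) * Z (m + Finsupp.single v 1) j

/-- Multiplication by `t^v`. -/
def mulVar (v : Label n) (Z : CoeffFamily 𝕜 n) : CoeffFamily 𝕜 n := fun m j =>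
  if m v = 0 then 0 else Z (m - Finsupp.single v 1) j

/-- Multiplication by `ħ`. -/
def mulHbar (Z : CoeffFamily 𝕜 n) : CoeffFamily 𝕜 n := fun m j => Z m (j - 1)

/-- The differential operator `(A z^l)^`,
`- A_1^μ ∂_{l+1,μ} + ∑_d t^{d,ν} A_ν^μ ∂_{d+l,μ}
  + (ħ/2) ∑_{i<l} (-1)^{i+1} A^{μν} ∂_{i,μ} ∂_{l-1-i,ν}`,
with `A_ν^μ = A μ ν` (row `μ`, column `ν`) and `A^{μν} = A^μ_ρ η^{ρν}`. In a coefficient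
of the monomial `t^m` of the second term only the variables `t^{d,ν}` that divide `t^m`
contribute, so that the sum over all `(d, ν)` is the sum over the support of `m`. -/
def quantize (l : ℕ) (A : Matrix (Fin (n + 2)) (Fin (n + 2)) 𝕜) (Z : CoeffFamily 𝕜 n) :
    CoeffFamily 𝕜 n := fun m j =>
  -(∑ μ, A μ 0 * deriv (l + 1, μ) Z m j)
  + ∑ v ∈ m.support, ∑ μ, A μ v.2 * mulVar v (deriv (v.1 + l, μ) Z) m j
  + 1 / 2 * ∑ i ∈ Finset.range l, ∑ μ, ∑ ν, (-1) ^ (i + 1) * (A * eta 𝕜 n) μ ν *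
      mulHbar (deriv (i, μ) (deriv (l - 1 - i, ν) Z)) m j

/-- The operator `∑_{l ≥ 1} (r_l z^l)^`, coefficientwise. -/
def quantizeSeries (r : ℕ → Matrix (Fin (n + 2)) (Fin (n + 2)) 𝕜) (Z : CoeffFamily 𝕜 n) :
    CoeffFamily 𝕜 n := fun m j =>
  ∑ᶠ l : ℕ, quantize (l + 1) (r (l + 1)) Z m j

/-- `Z' = R̂ Z` with `R̂ = exp (∑_{l ≥ 1} (r_l z^l)^)`: the exponential series converges to
`Z'`, each coefficient being eventually constant. -/
def IsGiventalTransform (r : ℕ → Matrix (Fin (n + 2)) (Fin (n + 2)) 𝕜)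
    (Z Z' : CoeffFamily 𝕜 n) : Prop :=
  ∀ (m : Label n →₀ ℕ) (j : ℤ), ∀ᶠ N : ℕ in atTop,
    ∑ k ∈ Finset.range N, ((k.factorial : 𝕜))⁻¹ * (quantizeSeries r)^[k] Z m j = Z' m j

/-- The sequence `r_1 = ` matrix unit with `(r_1)^1_n = 1`, and `r_k = 0` for `k > 1`. -/
def inversionR (𝕜 : Type*) [RCLike 𝕜] (n : ℕ) :
    ℕ → Matrix (Fin (n + 2)) (Fin (n + 2)) 𝕜 := fun k =>
  if k = 1 then Matrix.single 0 (Fin.last (n + 1)) 1 else 0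

/-- `r_1` is symmetric with respect to `η`, as required; in fact `(r_1)^{11} = 1` and all other
`(r_1)^{μν}` vanish. -/
theorem inversionR_mul_eta :
    inversionR 𝕜 n 1 * eta 𝕜 n = Matrix.single 0 0 1 := by
  ext μ ν
  by_cases h : μ = 0
  · subst h
    by_cases h' : ν = 0 <;> simp [inversionR, eta, Matrix.single_apply, h', eq_comm]
  · simp [inversionR, eta, Matrix.single_apply, h, Ne.symm h]

end Descendants

end Givental

end

/-!
The operator `(r_1 z)^` is a vector field plus a heat operator: it is `A - (ħ/2) ∂²` with
`A = ∑_d t^{d,n} ∂_{d+1,1}` and `∂ = ∂_{0,1}`. The dilaton shift does not contribute, because the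
first and the last index differ. The total potential is moved by the flow of this operator from
time `0` to time `1`, and its genus zero part without descendants moves by a first order
differential equation that can be solved explicitly.

*Absorbing `ħ`.* In the stable range the substitution `ħ = q²`, `t ↦ q t` turns `∑ ħ^{g-1} F_g`
into a power series in `q` without constant term (`regraded`), so that its exponential makes
sense, and a potential is determined by its partition function (`eq_of_isPartitionFunction`).
The operator becomes `generator = A - ½ ∂²`, acting on each coefficient of `q` separately. `A`
removes a factor `t^{d,n}`, `∂²` lowers the degree in `t`, and the coefficient of `q^w` has degree
at most `3 w`; hence all exponential series are finite sums, coefficient by coefficient, and the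
orbit depends polynomially on the time `s`. Its logarithm `W` satisfies
`∂_s W = A W - ½ (∂² W + (∂ W)²)` (`exists_potential_flow`). The monomials that do not occur in a
genus expansion evolve by themselves, so they stay absent (`coeff_eq_zero_of_flow`); this
produces the series `G_g`. Since `∂² W` has genus at least one, the genus zero part satisfies
`∂_s W₀ = A W₀ - ½ (∂ W₀)²` (`timeDerivation_genusZero`). Uniqueness for these flows is the
statement that a family of polynomials in `s` that vanishes at `s = 0`, and whose derivatives are
divisible by every power of `s` that divides the whole family, is zero (`eq_zero_of_evolution`).

*The descendant potential.* The topological recursion relation expresses a correlator with a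
descendant insertion by correlators of lower level `∑ d`. The relation can be used for any
descendant insertion, and for any choice of the two spectator insertions; that the results agree
is equivalent to the WDVV equations on the big phase space, and these follow from the equations on
the small phase space by the recursion itself (`wdvvUpTo_of_trrUpTo`, `correlator_trrSum_eq`).
So the potential can be constructed level by level (`existsUnique_isDescendantPotential`). It
satisfies the dilaton equation `∂_{1,1} F₀ = (E - 2) F₀` with `E = ∑ t^{d,μ} ∂_{d,μ}`, which the
unit axiom gives on the small phase space and the recursion extends (`dilaton_of_isPotential`).

*The equation on the small phase space.* The dilaton equation is preserved by the genus zero flow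
(`dilaton_of_flow`). After restriction to `t^{d,μ} = 0`, `d > 0`, the vector field `A` is
`t^{0,n} ∂_{1,1}`, and the dilaton equation turns it into `y (E - 2)`, where `x` and `y` denote the
first and the last variable. The flow closes up to `∂_s u = y (E - 2) u - ½ (∂_x u)²`
(`isSmallFlow_restrictPrimary`). Up to terms of degree at most two,
`F = ½ x² y + ½ x Q + h`, with the quadratic form `Q` in the
other variables and with `h` independent of `x`. The flow of `y (E - k)` is
`h ↦ (1 - s y)^k h(· / (1 - s y))` (`stretch`), and the solution with initial value `F` is
`½ x² y + ½ x Q + (1 - s y)² h(· / (1 - s y)) - s Q² / (8 (1 - s y))`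
(`isSmallFlow_invertedSeries`).

*Comparison with the inversion.* At `s = 1`, with `y = t̂^n + 1`, one has `1 - y = -t̂^n`, so this
is the potential `F̂` written in the coordinates `t̂`, up to terms of degree at most two. On Taylor
series, `stretch` at `s = 1` is the pullback of a function independent of `t^1` under the inversion, multiplied by
`(-t̂^n)^k`: the derivatives of both sides are of the same form again, and the constant terms agree
(`localExpansion_pullback`). This gives `coeff_localExpansion_invertedPotential`.
-/

noncomputable section

namespace Givental

open Filter


/-! ### Exponentials and logarithms of power series -/

/-- An additive self-map of a commutative ring that satisfies the Leibniz rule. Unlike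
`Derivation ℤ S S`, this does not depend on a choice of the `ℤ`-algebra structure of `S`. -/
structure AddDerivation (S : Type*) [CommRing S] extends S →+ S where
  /-- the Leibniz rule -/
  leibniz' : ∀ f g, toFun (f * g) = f * toFun g + g * toFun f

namespace AddDerivation

variable {S : Type*} [CommRing S]

instance : FunLike (AddDerivation S) S S where
  coe δ := δ.toFun
  coe_injective δ ε h := by
    cases δ; cases ε; congr; exact DFunLike.coe_injective h

instance : AddMonoidHomClass (AddDerivation S) S S where
  map_add δ := δ.map_add'
  map_zero δ := δ.map_zero'

theorem leibniz (δ : AddDerivation S) (f g : S) : δ (f * g) = f * δ g + g * δ f :=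
  δ.leibniz' f g

theorem map_one (δ : AddDerivation S) : δ 1 = 0 := by
  simpa using δ.leibniz 1 1

theorem leibniz_pow (δ : AddDerivation S) (f : S) (k : ℕ) :
    δ (f ^ (k + 1)) = (k + 1 : ℕ) • (f ^ k * δ f) := by
  induction k with
  | zero => simp
  | succ k ih =>
    rw [pow_succ, leibniz, ih]
    simp only [nsmul_eq_mul]
    push_cast
    ring

end AddDerivation

section Exp

open PowerSeries

variable {S : Type*} [CommRing S]

theorem coeff_pow_eq_zero_of_lt {a : S⟦X⟧} (ha : constantCoeff a = 0) {w k : ℕ} (h : w < k) :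
    coeff w (a ^ k) = 0 :=
  (X_pow_dvd_iff.1 (pow_dvd_pow_of_dvd (X_dvd_iff.2 ha) k)) w h

variable [Algebra ℚ S]

/-- The exponential `∑ a ^ k / k!` of a power series `a` without constant term, in an outer
variable `q`. Only the terms with `k ≤ w` contribute to the coefficient of `q ^ w`. -/
def expSeries (a : S⟦X⟧) : S⟦X⟧ :=
  PowerSeries.mk fun w => coeff w (∑ k ∈ Finset.range (w + 1), ((k.factorial : ℚ)⁻¹) • a ^ k)

theorem coeff_expSeries {a : S⟦X⟧} (ha : constantCoeff a = 0) {w N : ℕ} (h : w < N) :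
    coeff w (expSeries a) =
      coeff w (∑ k ∈ Finset.range N, ((k.factorial : ℚ)⁻¹) • a ^ k) := by
  rw [expSeries, coeff_mk, map_sum, map_sum]
  refine Finset.sum_subset (fun x hx => ?_) fun x _ hx => ?_
  · simp only [Finset.mem_range] at hx ⊢; omega
  · simp only [Finset.mem_range] at hx
    rw [coeff_smul, coeff_pow_eq_zero_of_lt ha (by omega), smul_zero]

theorem constantCoeff_expSeries (a : S⟦X⟧) : constantCoeff (expSeries a) = 1 := by
  rw [← coeff_zero_eq_constantCoeff_apply, expSeries, coeff_mk]
  simp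

/-- The chain rule `δ (exp a) = δ a * exp a`, for every derivation `δ` for which the coefficients
of `δ f` up to order `w` depend only on the coefficients of `f` up to order `w + 1`. -/
theorem derivation_expSeries (δ : AddDerivation S⟦X⟧)
    (hδ : ∀ (w : ℕ) (f g : S⟦X⟧), (∀ i ≤ w + 1, coeff i f = coeff i g) →
      coeff w (δ f) = coeff w (δ g))
    {a : S⟦X⟧} (ha : constantCoeff a = 0) : δ (expSeries a) = δ a * expSeries a := by
  have hlin : ∀ (c : ℚ) (f : S⟦X⟧), δ (c • f) = c • δ f := fun c f =>
    map_rat_smul δ c f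
  ext w
  rw [hδ w _ (∑ k ∈ Finset.range (w + 2), ((k.factorial : ℚ)⁻¹) • a ^ k)
    fun i hi => coeff_expSeries ha (by omega)]
  rw [map_sum, Finset.sum_range_succ', map_add]
  have h0 : δ (((Nat.factorial 0 : ℚ)⁻¹) • a ^ 0) = 0 := by
    rw [hlin, pow_zero, δ.map_one, smul_zero]
  rw [h0, map_zero, add_zero]
  have h1 : ∀ k : ℕ, δ ((((k + 1).factorial : ℚ)⁻¹) • a ^ (k + 1)) =
      δ a * (((k.factorial : ℚ)⁻¹) • a ^ k) := by
    intro k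
    rw [hlin, δ.leibniz_pow, mul_smul_comm, ← Nat.cast_smul_eq_nsmul ℚ, smul_smul, mul_comm (δ a)]
    congr 1
    rw [Nat.factorial_succ]
    have : (k.factorial : ℚ) ≠ 0 := by exact_mod_cast k.factorial_ne_zero
    have : ((k : ℚ) + 1) ≠ 0 := by positivity
    push_cast
    field_simp
  rw [Finset.sum_congr rfl fun k _ => h1 k, ← Finset.mul_sum, coeff_mul, coeff_mul]
  refine Finset.sum_congr rfl fun p hp => ?_
  rw [coeff_expSeries ha (N := w + 1)]
  have := Finset.HasAntidiagonal.mem_antidiagonal.1 hp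
  omega

theorem derivative_expSeries {a : S⟦X⟧} (ha : constantCoeff a = 0) :
    derivative S (expSeries a) = derivative S a * expSeries a := by
  refine derivation_expSeries ⟨(derivative S).toLinearMap.toAddMonoidHom,
    fun f g => (derivative S).leibniz f g⟩ (fun w f g h => ?_) ha
  change coeff w (derivative S f) = coeff w (derivative S g)
  rw [coeff_derivative, coeff_derivative, h _ le_rfl]

theorem isUnit_expSeries (a : S⟦X⟧) : IsUnit (expSeries a) := by
  rw [isUnit_iff_constantCoeff, constantCoeff_expSeries]
  exact isUnit_one

theorem isAddTorsionFree_of_rat (S : Type*) [CommRing S] [Algebra ℚ S] : IsAddTorsionFree S := by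
  refine ⟨fun k hk x y h => ?_⟩
  have h' : (k : ℚ) • x = (k : ℚ) • y := by simpa [Nat.cast_smul_eq_nsmul] using h
  have hk' : (k : ℚ) ≠ 0 := by exact_mod_cast hk
  simpa [smul_smul, inv_mul_cancel₀ hk'] using congrArg (fun z => (k : ℚ)⁻¹ • z) h'

/-- A power series with constant term `1` is determined by its logarithmic derivative. -/
theorem eq_of_logDerivative {f g b : S⟦X⟧} (hf : derivative S f = b * f)
    (hg : derivative S g = b * g) (hu : IsUnit g) (h0 : constantCoeff f = constantCoeff g) :
    f = g := by
  have := isAddTorsionFree_of_rat S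
  obtain ⟨u, rfl⟩ := hu
  suffices h : f * ((u⁻¹ : (S⟦X⟧)ˣ) : S⟦X⟧) = 1 by
    rw [Units.mul_inv_eq_one] at h
    exact h
  refine derivative.ext ?_ ?_
  · rw [Derivation.leibniz, derivative_inv, hf, hg, Derivation.map_one_eq_zero]
    simp only [smul_eq_mul]
    have := u.inv_mul
    linear_combination (-(b * f * ((u⁻¹ : (S⟦X⟧)ˣ) : S⟦X⟧))) * this
  · rw [map_mul, h0, ← map_mul, Units.mul_inv]

theorem exists_expSeries_eq {f : S⟦X⟧} (hf : constantCoeff f = 1) :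
    ∃ a : S⟦X⟧, constantCoeff a = 0 ∧ expSeries a = f := by
  have hu : IsUnit f := by rw [isUnit_iff_constantCoeff, hf]; exact isUnit_one
  obtain ⟨u, rfl⟩ := hu
  set b : S⟦X⟧ := derivative S (u : S⟦X⟧) * ((u⁻¹ : (S⟦X⟧)ˣ) : S⟦X⟧) with hb
  refine ⟨PowerSeries.mk fun w => if w = 0 then 0 else ((w : ℚ)⁻¹) • coeff (w - 1) b, ?_, ?_⟩
  · rw [← coeff_zero_eq_constantCoeff_apply, coeff_mk, if_pos rfl]
  · set a : S⟦X⟧ := PowerSeries.mk fun w => if w = 0 then 0 else ((w : ℚ)⁻¹) • coeff (w - 1) b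
      with ha
    have ha0 : constantCoeff a = 0 := by
      rw [← coeff_zero_eq_constantCoeff_apply, coeff_mk, if_pos rfl]
    have hd : derivative S a = b := by
      ext w
      rw [coeff_derivative, ha, coeff_mk, if_neg (by omega), Nat.add_sub_cancel]
      have : ((w : ℚ) + 1) ≠ 0 := by positivity
      have h2 : ((w : S) + 1) = algebraMap ℚ S ((w : ℚ) + 1) := by simp
      rw [h2, mul_comm, ← Algebra.smul_def, smul_smul]
      push_cast
      rw [mul_inv_cancel₀ this, one_smul]
    refine eq_of_logDerivative (b := b) ?_ ?_ u.isUnit ?_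
    · rw [derivative_expSeries ha0, hd]
    · rw [hb, mul_assoc, Units.inv_mul, mul_one]
    · rw [constantCoeff_expSeries, hf]

theorem expSeries_injective {a b : S⟦X⟧} (ha : constantCoeff a = 0) (hb : constantCoeff b = 0)
    (h : expSeries a = expSeries b) : a = b := by
  have := isAddTorsionFree_of_rat S
  refine derivative.ext ?_ (ha.trans hb.symm)
  have h1 := derivative_expSeries ha
  rw [h, derivative_expSeries hb] at h1
  exact ((isUnit_expSeries b).mul_right_cancel h1).symm

theorem map_expSeries {S' : Type*} [CommRing S'] [Algebra ℚ S'] (φ : S →+* S') (a : S⟦X⟧) :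
    PowerSeries.map φ (expSeries a) = expSeries (PowerSeries.map φ a) := by
  ext w
  rw [coeff_map, expSeries, expSeries, coeff_mk, coeff_mk, ← coeff_map, map_sum]
  congr 1
  refine Finset.sum_congr rfl fun k _ => ?_
  rw [map_rat_smul (PowerSeries.map φ), map_pow]

end Exp


/-! ### The infinitesimal generator -/

section Coefficientwise

open MvPowerSeries

variable {σ : Type*} {K K' : Type*} [CommRing K] [CommRing K']

/-- Apply an additive map to all coefficients of a power series. -/
def mapCoeff (φ : K →+ K') (f : MvPowerSeries σ K) : MvPowerSeries σ K' := fun m => φ (coeff m f)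

theorem coeff_mapCoeff (φ : K →+ K') (f : MvPowerSeries σ K) (m : σ →₀ ℕ) :
    coeff m (mapCoeff φ f) = φ (coeff m f) := rfl

theorem map_mul_natCast_add_one (φ : K →+ K') (x : K) (c : ℕ) :
    φ (x * ((c : K) + 1)) = φ x * ((c : K') + 1) := by
  have h1 : x * ((c : K) + 1) = (c + 1) • x := by
    rw [nsmul_eq_mul, mul_comm]; push_cast; rfl
  have h2 : φ x * ((c : K') + 1) = (c + 1) • φ x := by
    rw [nsmul_eq_mul, mul_comm]; push_cast; rfl
  rw [h1, h2, map_nsmul]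

theorem pderiv_mapCoeff (φ : K →+ K') (v : σ) (f : MvPowerSeries σ K) :
    pderiv K' v (mapCoeff φ f) = mapCoeff φ (pderiv K v f) := by
  ext m
  rw [coeff_pderiv, coeff_mapCoeff, coeff_mapCoeff, coeff_pderiv, map_mul_natCast_add_one]

theorem pderiv_comm (v w : σ) (f : MvPowerSeries σ K) :
    pderiv K v (pderiv K w f) = pderiv K w (pderiv K v f) := by
  classical
  ext m
  simp only [coeff_pderiv, Finsupp.add_apply]
  by_cases h : v = w
  · subst h; rfl
  · rw [Finsupp.single_eq_of_ne (Ne.symm h), Finsupp.single_eq_of_ne h, add_right_comm]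
    exact mul_right_comm _ _ _

/-- The coefficientwise extension of a derivation of the coefficient ring. -/
def liftMvDerivation (δ : AddDerivation K) :
    AddDerivation (MvPowerSeries σ K) :=
  AddDerivation.mk (AddMonoidHom.mk' (fun f m => δ (coeff m f)) fun f g => by
      funext m; exact map_add δ _ _)
    (by
      classical
      intro f g
      ext m
      change δ (coeff m (f * g)) = _
      rw [map_add, mul_comm g, coeff_mul, coeff_mul, coeff_mul, map_sum,
        ← Finset.sum_add_distrib]
      refine Finset.sum_congr rfl fun p _ => ?_
      rw [δ.leibniz, mul_comm (coeff p.2 g)]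
      rfl)

/-- The coefficientwise extension of a derivation to power series in an outer variable. -/
def liftDerivation (δ : AddDerivation K) : AddDerivation (PowerSeries K) :=
  liftMvDerivation δ

theorem coeff_liftDerivation (δ : AddDerivation K) (f : PowerSeries K) (w : ℕ) :
    PowerSeries.coeff w (liftDerivation δ f) = δ (PowerSeries.coeff w f) := rfl

theorem liftDerivation_expSeries [Algebra ℚ K] (δ : AddDerivation K) {a : PowerSeries K}
    (ha : PowerSeries.constantCoeff a = 0) :
    liftDerivation δ (expSeries a) = liftDerivation δ a * expSeries a := by
  refine derivation_expSeries _ (fun w f g h => ?_) ha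
  rw [coeff_liftDerivation, coeff_liftDerivation, h w (by omega)]

end Coefficientwise

section Shift

open MvPowerSeries

variable {K K' : Type*} [CommRing K] [CommRing K'] {n : ℕ}

/-- The labels `(d, n)` whose variables divide the monomial `t^m`. -/
def lastLabels (m : Label n →₀ ℕ) : Finset (Label n) :=
  m.support.filter fun v => v.2 = Fin.last (n + 1)

theorem mem_lastLabels {m : Label n →₀ ℕ} {v : Label n} :
    v ∈ lastLabels m ↔ m v ≠ 0 ∧ v.2 = Fin.last (n + 1) := by
  simp [lastLabels]

/-- The exponent of `t^m` after a factor `t^{d,n}` has been replaced by `t^{d+1,1}`. -/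
def shiftLabel (m : Label n →₀ ℕ) (v : Label n) : Label n →₀ ℕ :=
  m - Finsupp.single v 1 + Finsupp.single (v.1 + 1, 0) 1

theorem sub_single_add {σ : Type*} {m : σ →₀ ℕ} {v : σ} (h : m v ≠ 0) :
    m - Finsupp.single v 1 + Finsupp.single v 1 = m := by
  refine tsub_add_cancel_of_le ?_
  rw [Finsupp.single_le_iff]
  omega

theorem coeff_X_mul_of_ne_zero {σ : Type*} {v : σ} {m : σ →₀ ℕ} (h : m v ≠ 0)
    (f : MvPowerSeries σ K) :
    coeff m (X v * f) = coeff (m - Finsupp.single v 1) f := by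
  conv_lhs => rw [← sub_single_add h, add_comm]
  exact (coeff_add_monomial_mul _ _ f 1).trans (one_mul _)

theorem coeff_X_mul_of_eq_zero {σ : Type*} {v : σ} {m : σ →₀ ℕ} (h : m v = 0)
    (f : MvPowerSeries σ K) : coeff m (X v * f) = 0 :=
  X_dvd_iff.1 (dvd_mul_right _ _) m h

/-- The vector field `∑_d t^{d,n} ∂_{d+1,1}` on power series, as a function. -/
def shiftFun (f : MvPowerSeries (Label n) K) : MvPowerSeries (Label n) K := fun m =>
  ∑ v ∈ lastLabels m, coeff m (X v * pderiv K (v.1 + 1, 0) f)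

theorem coeff_shiftFun (f : MvPowerSeries (Label n) K) (m : Label n →₀ ℕ)
    {V : Finset (Label n)} (hV : lastLabels m ⊆ V) (hL : ∀ v ∈ V, v.2 = Fin.last (n + 1)) :
    coeff m (shiftFun f) = ∑ v ∈ V, coeff m (X v * pderiv K (v.1 + 1, 0) f) := by
  refine Finset.sum_subset hV fun v hv hv' => coeff_X_mul_of_eq_zero ?_ _
  by_contra h
  exact hv' (mem_lastLabels.2 ⟨h, hL v hv⟩)

theorem lastLabels_mono {m m' : Label n →₀ ℕ} (h : m' ≤ m) : lastLabels m' ⊆ lastLabels m := by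
  intro v hv
  rw [mem_lastLabels] at hv ⊢
  exact ⟨fun h0 => hv.1 (Nat.le_zero.1 (h0 ▸ h v)), hv.2⟩

/-- The derivation `∑_d t^{d,n} ∂_{d+1,1}` of the ring of power series. The sum is infinite, but
only finitely many terms contribute to each coefficient. -/
def shiftDerivation (K : Type*) [CommRing K] (n : ℕ) :
    AddDerivation (MvPowerSeries (Label n) K) :=
  AddDerivation.mk
    (AddMonoidHom.mk' shiftFun fun f g => by
      ext m
      rw [map_add, coeff_shiftFun _ _ subset_rfl (fun v hv => (mem_lastLabels.1 hv).2),
        coeff_shiftFun _ _ subset_rfl (fun v hv => (mem_lastLabels.1 hv).2),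
        coeff_shiftFun _ _ subset_rfl (fun v hv => (mem_lastLabels.1 hv).2),
        ← Finset.sum_add_distrib]
      refine Finset.sum_congr rfl fun v _ => ?_
      rw [map_add, mul_add, map_add])
    (by
      classical
      intro f g
      ext m
      change coeff m (shiftFun (f * g)) = coeff m (f * shiftFun g + g * shiftFun f)
      have key : ∀ a b : MvPowerSeries (Label n) K, coeff m (a * shiftFun b) =
          ∑ v ∈ lastLabels m, coeff m (a * (X v * pderiv K (v.1 + 1, 0) b)) := by
        intro a b
        rw [coeff_mul, Finset.sum_congr rfl fun v _ => coeff_mul _ _ _, Finset.sum_comm]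
        refine Finset.sum_congr rfl fun p hp => ?_
        rw [coeff_shiftFun b p.2 (lastLabels_mono (m := m) ?_) fun v hv =>
          (mem_lastLabels.1 hv).2, Finset.mul_sum]
        rw [← Finset.HasAntidiagonal.mem_antidiagonal.1 hp]
        exact le_add_self
      rw [map_add, key, key, ← Finset.sum_add_distrib]
      refine Finset.sum_congr rfl fun v _ => ?_
      rw [Derivation.leibniz, ← map_add]
      simp only [smul_eq_mul]
      rw [mul_add, mul_left_comm, mul_left_comm (X v)])

theorem coeff_shiftDerivation (f : MvPowerSeries (Label n) K) (m : Label n →₀ ℕ) :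
    coeff m (shiftDerivation K n f) = ∑ v ∈ lastLabels m,
      coeff (shiftLabel m v) f *
        ((((m - Finsupp.single v 1 : Label n →₀ ℕ) (v.1 + 1, 0) : ℕ) : K) + 1) := by
  change ∑ v ∈ lastLabels m, _ = _
  refine Finset.sum_congr rfl fun v hv => ?_
  rw [coeff_X_mul_of_ne_zero (mem_lastLabels.1 hv).1, coeff_pderiv]
  rfl

theorem shiftDerivation_mapCoeff (φ : K →+ K') (f : MvPowerSeries (Label n) K) :
    shiftDerivation K' n (mapCoeff φ f) = mapCoeff φ (shiftDerivation K n f) := by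
  ext m
  rw [coeff_mapCoeff, coeff_shiftDerivation, coeff_shiftDerivation, map_sum]
  refine Finset.sum_congr rfl fun v _ => ?_
  rw [map_mul_natCast_add_one, coeff_mapCoeff]

theorem dvd_coeff_shiftDerivation {f : MvPowerSeries (Label n) K} {m : Label n →₀ ℕ} {a : K}
    (h : ∀ v ∈ lastLabels m, a ∣ coeff (shiftLabel m v) f) :
    a ∣ coeff m (shiftDerivation K n f) := by
  rw [coeff_shiftDerivation]
  exact Finset.dvd_sum fun v hv => Dvd.dvd.mul_right (h v hv) _

theorem degree_shiftLabel {m : Label n →₀ ℕ} {v : Label n} (hv : v ∈ lastLabels m) :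
    (shiftLabel m v).degree = m.degree := by
  conv_rhs => rw [← sub_single_add (mem_lastLabels.1 hv).1]
  simp [shiftLabel]

/-- The number of factors `t^{d,n}`, `d ≥ 0`, of the monomial `t^m`. -/
def lastCount : (Label n →₀ ℕ) →+ ℕ :=
  Finsupp.weight fun v : Label n => if v.2 = Fin.last (n + 1) then 1 else 0

theorem lastCount_shiftLabel {m : Label n →₀ ℕ} {v : Label n} (hv : v ∈ lastLabels m) :
    lastCount (shiftLabel m v) + 1 = lastCount m := by
  obtain ⟨h, hL⟩ := mem_lastLabels.1 hv
  have h0 : (0 : Fin (n + 2)) ≠ Fin.last (n + 1) := by simp [Fin.ext_iff]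
  conv_rhs => rw [← sub_single_add h]
  simp [shiftLabel, lastCount, Finsupp.weight_single, hL, h0]

end Shift

section Generator

open MvPowerSeries

variable {K K' : Type*} [CommRing K] [CommRing K'] {n : ℕ}

/-- The derivation `∂_{0,1}`. -/
def unitDerivation (K : Type*) [CommRing K] (n : ℕ) :
    AddDerivation (MvPowerSeries (Label n) K) :=
  AddDerivation.mk (pderiv K ((0 : ℕ), (0 : Fin (n + 2)))).toLinearMap.toAddMonoidHom
    fun f g => (pderiv K ((0 : ℕ), (0 : Fin (n + 2)))).leibniz f g

theorem coeff_unitDerivation (f : MvPowerSeries (Label n) K) (m : Label n →₀ ℕ) :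
    coeff m (unitDerivation K n f) =
      coeff (m + Finsupp.single (0, 0) 1) f * ((m (0, 0) : ℕ) + 1) :=
  coeff_pderiv f m

theorem unitDerivation_mapCoeff (φ : K →+ K') (f : MvPowerSeries (Label n) K) :
    unitDerivation K' n (mapCoeff φ f) = mapCoeff φ (unitDerivation K n f) :=
  pderiv_mapCoeff φ _ f

variable [Algebra ℚ K] [Algebra ℚ K']

/-- The operator `∑_d t^{d,n} ∂_{d+1,1} - ½ ∂_{0,1}²`, the quantization of `r_1 z` in the
grading in which `ħ` has been absorbed. -/
def generator (f : MvPowerSeries (Label n) K) : MvPowerSeries (Label n) K :=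
  shiftDerivation K n f - (1 / 2 : ℚ) • unitDerivation K n (unitDerivation K n f)

theorem generator_mapCoeff (φ : K →+ K') (f : MvPowerSeries (Label n) K) :
    generator (mapCoeff φ f) = mapCoeff φ (generator f) := by
  rw [generator, generator, shiftDerivation_mapCoeff, unitDerivation_mapCoeff,
    unitDerivation_mapCoeff]
  ext m
  rw [coeff_mapCoeff, map_sub, map_sub, map_sub, map_rat_smul (coeff m), map_rat_smul (coeff m),
    map_rat_smul φ]
  rfl

theorem generator_one : generator (1 : MvPowerSeries (Label n) K) = 0 := by
  simp [generator, AddDerivation.map_one]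

theorem generator_zero : generator (0 : MvPowerSeries (Label n) K) = 0 := by
  simp [generator]

/-- The generator lowers a grading, and is therefore locally nilpotent: each application either
replaces a factor `t^{d,n}` or lowers the degree by two. -/
theorem coeff_generator_iterate_eq_zero {f : MvPowerSeries (Label n) K} {w : ℕ}
    (hf : ∀ m : Label n →₀ ℕ, w < m.degree → coeff m f = 0) (k : ℕ) (m : Label n →₀ ℕ)
    (h : w + 2 * lastCount m < 2 * k + m.degree) : coeff m (generator^[k] f) = 0 := by
  induction k generalizing m with
  | zero => exact hf m (by omega)
  | succ k ih =>
    rw [Function.iterate_succ_apply', generator, map_sub, map_rat_smul (coeff m),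
      coeff_unitDerivation,
      coeff_unitDerivation, ih]
    · rw [zero_mul, zero_mul, smul_zero, sub_zero]
      refine zero_dvd_iff.1 (dvd_coeff_shiftDerivation fun v hv => zero_dvd_iff.2 (ih _ ?_))
      have h1 := degree_shiftLabel hv
      have h2 := lastCount_shiftLabel hv
      omega
    · have h0 : (0 : Fin (n + 2)) ≠ Fin.last (n + 1) := by simp [Fin.ext_iff]
      simp only [map_add, Finsupp.degree_single, lastCount, Finsupp.weight_single, h0, if_false,
        smul_zero, add_zero] at h ⊢
      omega

end Generator


/-! ### Absorbing `ħ` into the grading -/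

section Regrading

open MvPowerSeries

variable {𝕜 : Type*} [RCLike 𝕜] {n : ℕ}

/-- The multivariate power series with given coefficients. -/
def ofCoeff {σ K : Type*} (c : (σ →₀ ℕ) → K) : MvPowerSeries σ K := c

theorem coeff_ofCoeff {σ K : Type*} [Semiring K] (c : (σ →₀ ℕ) → K) (m : σ →₀ ℕ) :
    coeff m (ofCoeff c) = c m := rfl

/-- Interchange of an outer variable with the variables of a multivariate power series. -/
def swapHom (σ K : Type*) [CommRing K] :
    PowerSeries (MvPowerSeries σ K) →+* MvPowerSeries σ (PowerSeries K) where
  toFun f := ofCoeff fun m => PowerSeries.mk fun w => coeff m (PowerSeries.coeff w f)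
  map_zero' := by
    ext m w
    rw [coeff_ofCoeff, PowerSeries.coeff_mk]
    simp
  map_one' := by
    classical
    ext m w
    rw [coeff_ofCoeff, PowerSeries.coeff_mk, PowerSeries.coeff_one, coeff_one]
    split_ifs <;> simp_all [coeff_one, PowerSeries.coeff_one]
  map_add' f g := by
    ext m w
    simp only [map_add, coeff_ofCoeff, PowerSeries.coeff_mk]
  map_mul' f g := by
    classical
    ext m w
    rw [coeff_mul, map_sum, coeff_ofCoeff, PowerSeries.coeff_mk, PowerSeries.coeff_mul, map_sum,
      Finset.sum_congr rfl fun p _ => coeff_mul _ _ _, Finset.sum_comm]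
    refine Finset.sum_congr rfl fun p _ => ?_
    rw [PowerSeries.coeff_mul]
    refine Finset.sum_congr rfl fun q _ => ?_
    rw [coeff_ofCoeff, coeff_ofCoeff, PowerSeries.coeff_mk, PowerSeries.coeff_mk]

theorem coeff_swapHom {σ K : Type*} [CommRing K] (f : PowerSeries (MvPowerSeries σ K))
    (m : σ →₀ ℕ) (w : ℕ) :
    PowerSeries.coeff w (coeff m (swapHom σ K f)) = coeff m (PowerSeries.coeff w f) := by
  change PowerSeries.coeff w (PowerSeries.mk fun w => coeff m (PowerSeries.coeff w f)) = _
  rw [PowerSeries.coeff_mk]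

/-- The total potential `∑_g ħ^{g-1} F_g` in the grading by `w = 2 (g - 1) + |m|`, that is, after
the substitution `ħ = q²`, `t ↦ q t`. In the stable range all exponents of `q` are positive. -/
def regraded (F : ℕ → MvPowerSeries (Label n) 𝕜) : PowerSeries (MvPowerSeries (Label n) 𝕜) :=
  PowerSeries.mk fun w => ofCoeff fun m =>
    if m.degree ≤ w + 2 ∧ Even (w + 2 - m.degree) then
      coeff m (F ((w + 2 - m.degree) / 2)) else 0

theorem coeff_regraded (F : ℕ → MvPowerSeries (Label n) 𝕜) {w g : ℕ} {m : Label n →₀ ℕ}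
    (h : w + 2 = m.degree + 2 * g) :
    coeff m (PowerSeries.coeff w (regraded F)) = coeff m (F g) := by
  rw [regraded, PowerSeries.coeff_mk, coeff_ofCoeff]
  have h1 : w + 2 - m.degree = 2 * g := by omega
  rw [if_pos ⟨by omega, by rw [h1]; exact even_two_mul g⟩, h1, Nat.mul_div_cancel_left _ two_pos]

theorem coeff_regraded_eq_zero (F : ℕ → MvPowerSeries (Label n) 𝕜) {w : ℕ} {m : Label n →₀ ℕ}
    (h : ∀ g, w + 2 ≠ m.degree + 2 * g) :
    coeff m (PowerSeries.coeff w (regraded F)) = 0 := by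
  rw [regraded, PowerSeries.coeff_mk, coeff_ofCoeff]
  rw [if_neg]
  rintro ⟨h1, g, hg⟩
  exact h g (by omega)

theorem constantCoeff_regraded {F : ℕ → MvPowerSeries (Label n) 𝕜} (hF : IsStable F) :
    PowerSeries.constantCoeff (regraded F) = 0 := by
  rw [← PowerSeries.coeff_zero_eq_constantCoeff_apply]
  ext m
  by_cases h : ∃ g, 0 + 2 = m.degree + 2 * g
  · obtain ⟨g, hg⟩ := h
    rw [coeff_regraded F hg, hF g m (by omega)]
    rfl
  · push Not at h
    rw [coeff_regraded_eq_zero F h]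
    rfl

/-- The substitution `ħ ↦ q²` in Laurent series. -/
def doubleExponent (𝕜 : Type*) [RCLike 𝕜] : LaurentSeries 𝕜 →+* LaurentSeries 𝕜 :=
  HahnSeries.embDomainRingHom (AddMonoidHom.mulLeft (2 : ℤ))
    (fun a b h => by simpa using h) (fun a b => by simp)

theorem coeff_doubleExponent (x : LaurentSeries 𝕜) (j : ℤ) :
    (doubleExponent 𝕜 x).coeff (2 * j) = x.coeff j :=
  HahnSeries.embDomain_coeff (f := ⟨⟨AddMonoidHom.mulLeft (2 : ℤ), _⟩, _⟩)

theorem coeff_doubleExponent_of_odd (x : LaurentSeries 𝕜) {i : ℤ} (hi : ∀ j, i ≠ 2 * j) :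
    (doubleExponent 𝕜 x).coeff i = 0 := by
  refine HahnSeries.embDomain_of_notMem_range ?_
  rintro ⟨j, hj⟩
  exact hi j hj.symm

/-- The substitution `ħ = q²`, `t ↦ q t`. -/
def regradeHom (𝕜 : Type*) [RCLike 𝕜] (n : ℕ) :
    MvPowerSeries (Label n) (LaurentSeries 𝕜) →+* MvPowerSeries (Label n) (LaurentSeries 𝕜) :=
  (MvPowerSeries.rescale fun _ => HahnSeries.single (1 : ℤ) (1 : 𝕜)).comp
    (MvPowerSeries.map (doubleExponent 𝕜))

theorem coeff_regradeHom (T : MvPowerSeries (Label n) (LaurentSeries 𝕜)) (m : Label n →₀ ℕ)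
    (i : ℤ) :
    (coeff m (regradeHom 𝕜 n T)).coeff i = (doubleExponent 𝕜 (coeff m T)).coeff (i - m.degree) := by
  have h : (m.prod fun _ c => (HahnSeries.single (1 : ℤ) (1 : 𝕜) : LaurentSeries 𝕜) ^ c) =
      HahnSeries.single (m.degree : ℤ) 1 := by
    rw [Finsupp.prod, Finset.prod_pow_eq_pow_sum, ← Finsupp.degree_apply, HahnSeries.single_pow]
    simp
  rw [regradeHom, RingHom.comp_apply, coeff_rescale, h, coeff_map, HahnSeries.coeff_single_mul,
    one_mul]

theorem coeff_totalPotential (F : ℕ → MvPowerSeries (Label n) 𝕜) (m : Label n →₀ ℕ) (g : ℕ) :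
    (coeff m (totalPotential F)).coeff ((g : ℤ) - 1) = coeff m (F g) := by
  change (HahnSeries.single (-1 : ℤ) (1 : 𝕜) * HahnSeries.ofPowerSeries ℤ 𝕜 _).coeff _ = _
  rw [HahnSeries.coeff_single_mul, one_mul, sub_neg_eq_add, sub_add_cancel,
    HahnSeries.ofPowerSeries_apply_coeff, PowerSeries.coeff_mk]

theorem coeff_totalPotential_of_lt (F : ℕ → MvPowerSeries (Label n) 𝕜) (m : Label n →₀ ℕ) {j : ℤ}
    (hj : j < -1) : (coeff m (totalPotential F)).coeff j = 0 := by
  change (HahnSeries.single (-1 : ℤ) (1 : 𝕜) * HahnSeries.ofPowerSeries ℤ 𝕜 _).coeff _ = _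
  rw [HahnSeries.coeff_single_mul, one_mul]
  exact (PowerSeries.coeff_coe _ _).trans (if_pos (by omega))

/-- The regraded total potential contains no negative powers of `q`. -/
theorem regradeHom_totalPotential {F : ℕ → MvPowerSeries (Label n) 𝕜} (hF : IsStable F) :
    regradeHom 𝕜 n (totalPotential F) =
      MvPowerSeries.map (HahnSeries.ofPowerSeries ℤ 𝕜) (swapHom (Label n) 𝕜 (regraded F)) := by
  ext m i
  rw [coeff_regradeHom, coeff_map]
  refine Eq.trans ?_ (PowerSeries.coeff_coe _ _).symm
  by_cases hi : ∃ j, i - m.degree = 2 * j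
  · obtain ⟨j, hj⟩ := hi
    rw [hj, coeff_doubleExponent, coeff_swapHom]
    by_cases hj1 : j < -1
    · rw [coeff_totalPotential_of_lt F m hj1]
      split_ifs with h0
      · rfl
      · rw [coeff_regraded_eq_zero]
        intro g hg
        omega
    · obtain ⟨g, rfl⟩ : ∃ g : ℕ, j = (g : ℤ) - 1 := ⟨(j + 1).toNat, by omega⟩
      rw [coeff_totalPotential]
      split_ifs with h0
      · exact hF g m (by omega)
      · rw [coeff_regraded F (g := g)]
        omega
  · push Not at hi
    rw [coeff_doubleExponent_of_odd _ hi, coeff_swapHom]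
    split_ifs with h0
    · rfl
    · rw [coeff_regraded_eq_zero]
      intro g hg
      exact hi ((g : ℤ) - 1) (by omega)

/-- The family of coefficients of `t^m ħ^j` of a series in the grading `w = 2 j + |m|`. -/
def toFamily (z : PowerSeries (MvPowerSeries (Label n) 𝕜)) : CoeffFamily 𝕜 n := fun m j =>
  if 0 ≤ 2 * j + m.degree then coeff m (PowerSeries.coeff (2 * j + m.degree).toNat z) else 0

theorem toFamily_natCast (z : PowerSeries (MvPowerSeries (Label n) 𝕜)) {m : Label n →₀ ℕ} {j : ℤ}
    {w : ℕ} (h : 2 * j + m.degree = w) :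
    toFamily z m j = coeff m (PowerSeries.coeff w z) := by
  rw [toFamily, if_pos (by omega), h, Int.toNat_natCast]

theorem toFamily_of_neg (z : PowerSeries (MvPowerSeries (Label n) 𝕜)) {m : Label n →₀ ℕ} {j : ℤ}
    (h : 2 * j + m.degree < 0) : toFamily z m j = 0 := by
  rw [toFamily, if_neg (by omega)]

theorem map_pow_eq_regradeHom {F : ℕ → MvPowerSeries (Label n) 𝕜} (hF : IsStable F) (k : ℕ) :
    regradeHom 𝕜 n (totalPotential F ^ k) =
      MvPowerSeries.map (HahnSeries.ofPowerSeries ℤ 𝕜) (swapHom (Label n) 𝕜 (regraded F ^ k)) := by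
  rw [map_pow, map_pow, map_pow, regradeHom_totalPotential hF]

theorem coeff_totalPotential_pow {F : ℕ → MvPowerSeries (Label n) 𝕜} (hF : IsStable F) (k : ℕ)
    (m : Label n →₀ ℕ) (j : ℤ) :
    (coeff m (totalPotential F ^ k)).coeff j = toFamily (regraded F ^ k) m j := by
  have h := congrArg (fun T => (coeff m T).coeff (2 * j + m.degree)) (map_pow_eq_regradeHom hF k)
  simp only [coeff_regradeHom, add_sub_cancel_right, coeff_doubleExponent, coeff_map] at h
  rw [h]
  refine (PowerSeries.coeff_coe _ _).trans ?_
  rw [coeff_swapHom]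
  split_ifs with h0
  · rw [toFamily_of_neg _ h0]
  · rw [toFamily_natCast _ (Int.natAbs_of_nonneg (not_lt.1 h0)).symm]

/-- Only exponents of `q` of the same parity as the degree in the `t^{d,μ}` occur. -/
theorem coeff_regraded_pow_of_parity {F : ℕ → MvPowerSeries (Label n) 𝕜} (hF : IsStable F) (k : ℕ)
    {m : Label n →₀ ℕ} {w : ℕ} (h : ∀ j : ℤ, (w : ℤ) - m.degree ≠ 2 * j) :
    coeff m (PowerSeries.coeff w (regraded F ^ k)) = 0 := by
  have h1 := congrArg (fun T => (coeff m T).coeff (w : ℤ)) (map_pow_eq_regradeHom hF k)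
  simp only [coeff_regradeHom, coeff_map, coeff_doubleExponent_of_odd _ h] at h1
  rw [← coeff_swapHom, ← HahnSeries.ofPowerSeries_apply_coeff (Γ := ℤ)]
  exact h1.symm

theorem sum_inv_factorial_mul_toFamily (f : ℕ → PowerSeries (MvPowerSeries (Label n) 𝕜)) (N : ℕ)
    (m : Label n →₀ ℕ) (j : ℤ) :
    ∑ k ∈ Finset.range N, ((k.factorial : 𝕜))⁻¹ * toFamily (f k) m j =
      toFamily (∑ k ∈ Finset.range N, ((k.factorial : ℚ)⁻¹) • f k) m j := by
  by_cases h : 0 ≤ 2 * j + m.degree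
  · obtain ⟨w, hw⟩ := Int.eq_ofNat_of_zero_le h
    rw [toFamily_natCast _ hw, map_sum, map_sum]
    refine Finset.sum_congr rfl fun k _ => ?_
    rw [toFamily_natCast _ hw, map_rat_smul (PowerSeries.coeff w), map_rat_smul (coeff m),
      Rat.smul_def]
    simp
  · rw [toFamily_of_neg _ (not_le.1 h), Finset.sum_eq_zero]
    intro k _
    rw [toFamily_of_neg _ (not_le.1 h), mul_zero]

/-- The exponential of the total potential, computed in the grading in which it is an exponential
of a power series without constant term. -/
theorem isPartitionFunction_iff {F : ℕ → MvPowerSeries (Label n) 𝕜} (hF : IsStable F)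
    (Z : CoeffFamily 𝕜 n) :
    IsPartitionFunction F Z ↔ Z = toFamily (expSeries (regraded F)) := by
  have key : ∀ (m : Label n →₀ ℕ) (j : ℤ), ∀ᶠ N : ℕ in atTop,
      ∑ k ∈ Finset.range N, ((k.factorial : 𝕜))⁻¹ *
        (MvPowerSeries.coeff m (totalPotential F ^ k)).coeff j =
          toFamily (expSeries (regraded F)) m j := by
    intro m j
    filter_upwards [eventually_gt_atTop (2 * j + m.degree).toNat] with N hN
    have h1 : ∀ k ∈ Finset.range N, ((k.factorial : 𝕜))⁻¹ *
        (MvPowerSeries.coeff m (totalPotential F ^ k)).coeff j =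
          ((k.factorial : 𝕜))⁻¹ * toFamily (regraded F ^ k) m j := fun k _ => by
      rw [coeff_totalPotential_pow hF]
    rw [Finset.sum_congr rfl h1, sum_inv_factorial_mul_toFamily]
    by_cases h : 0 ≤ 2 * j + m.degree
    · obtain ⟨w, hw⟩ := Int.eq_ofNat_of_zero_le h
      have hwN : w < N := by omega
      have h2 := coeff_expSeries (a := regraded F) (constantCoeff_regraded hF) hwN
      rw [toFamily_natCast _ hw, toFamily_natCast _ hw]
      exact congrArg (coeff m) h2.symm
    · rw [toFamily_of_neg _ (not_le.1 h), toFamily_of_neg _ (not_le.1 h)]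
  constructor
  · intro h
    funext m j
    obtain ⟨N, h1, h2⟩ := ((h m j).and (key m j)).exists
    exact h1.symm.trans h2
  · rintro rfl
    exact key

theorem coeff_expSeries_regraded_of_parity {F : ℕ → MvPowerSeries (Label n) 𝕜} (hF : IsStable F)
    {m : Label n →₀ ℕ} {w : ℕ} (h : ∀ j : ℤ, (w : ℤ) - m.degree ≠ 2 * j) :
    coeff m (PowerSeries.coeff w (expSeries (regraded F))) = 0 := by
  rw [expSeries, PowerSeries.coeff_mk, map_sum, map_sum]
  refine Finset.sum_eq_zero fun k _ => ?_
  rw [map_rat_smul (PowerSeries.coeff w), map_rat_smul (coeff m),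
    coeff_regraded_pow_of_parity hF k h, smul_zero]

/-- The partition function determines the potentials in the stable range. -/
theorem eq_of_isPartitionFunction {F G : ℕ → MvPowerSeries (Label n) 𝕜} (hF : IsStable F)
    (hG : IsStable G) {Z : CoeffFamily 𝕜 n} (h1 : IsPartitionFunction F Z)
    (h2 : IsPartitionFunction G Z) : F = G := by
  rw [isPartitionFunction_iff hF] at h1
  rw [isPartitionFunction_iff hG] at h2
  have h3 : regraded F = regraded G := by
    refine expSeries_injective (a := regraded F) (b := regraded G) (constantCoeff_regraded hF)
      (constantCoeff_regraded hG) ?_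
    ext w m
    by_cases h : ∃ j : ℤ, (w : ℤ) - m.degree = 2 * j
    · obtain ⟨j, hj⟩ := h
      have hw : 2 * j + (m.degree : ℤ) = w := by omega
      rw [← toFamily_natCast _ hw, ← toFamily_natCast _ hw, ← h1, ← h2]
    · push Not at h
      rw [coeff_expSeries_regraded_of_parity hF h, coeff_expSeries_regraded_of_parity hG h]
  funext g
  ext m
  by_cases h : 2 * g + m.degree ≤ 2
  · rw [hF g m h, hG g m h]
  · have hw : (2 * g + m.degree - 2) + 2 = m.degree + 2 * g := by omega
    rw [← coeff_regraded F hw, ← coeff_regraded G hw, h3]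

end Regrading

section Quantization

open MvPowerSeries

variable {𝕜 : Type*} [RCLike 𝕜] {n : ℕ}

/-- For the matrix unit `r_1` the dilaton shift term drops out, since the first and the last index
are different, and the quadratic term is `-(ħ/2) ∂_{0,1}²`. -/
theorem quantizeSeries_inversionR (Z : CoeffFamily 𝕜 n) (m : Label n →₀ ℕ) (j : ℤ) :
    quantizeSeries (inversionR 𝕜 n) Z m j =
      ∑ v ∈ lastLabels m, Z (shiftLabel m v) j *
        ((((m - Finsupp.single v 1 : Label n →₀ ℕ) (v.1 + 1, 0) : ℕ) : 𝕜) + 1) -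
      1 / 2 * ((m (0, 0) + 1) * (m (0, 0) + 1 + 1) *
        Z (m + Finsupp.single (0, 0) 1 + Finsupp.single (0, 0) 1) (j - 1)) := by
  have h0 : Fin.last (n + 1) ≠ (0 : Fin (n + 2)) := by simp [Fin.ext_iff]
  rw [quantizeSeries, finsum_eq_single _ 0]
  · rw [quantize, zero_add, inversionR_mul_eta, Finset.sum_range_one]
    have h1 : ∑ μ, inversionR 𝕜 n 1 μ 0 * deriv (1 + 1, μ) Z m j = 0 := by
      refine Finset.sum_eq_zero fun μ _ => ?_
      simp [inversionR, h0]
    have h2 : ∑ μ, ∑ ν, (-1 : 𝕜) ^ (0 + 1) * (Matrix.single 0 0 1 : Matrix (Fin (n + 2))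
        (Fin (n + 2)) 𝕜) μ ν * mulHbar (deriv (0, μ) (deriv (1 - 1 - 0, ν) Z)) m j =
        -((m (0, 0) + 1) * (m (0, 0) + 1 + 1) *
          Z (m + Finsupp.single (0, 0) 1 + Finsupp.single (0, 0) 1) (j - 1)) := by
      rw [Finset.sum_eq_single 0, Finset.sum_eq_single 0]
      · simp [mulHbar, deriv, mul_assoc]
      · intro b _ hb
        simp [hb.symm]
      · simp
      · intro b _ hb
        simp [hb.symm]
      · simp
    have h3 : ∑ v ∈ m.support, ∑ μ, inversionR 𝕜 n 1 μ v.2 * mulVar v (deriv (v.1 + 1, μ) Z) m j =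
        ∑ v ∈ lastLabels m, Z (shiftLabel m v) j *
        ((((m - Finsupp.single v 1 : Label n →₀ ℕ) (v.1 + 1, 0) : ℕ) : 𝕜) + 1) := by
      rw [lastLabels, Finset.sum_filter]
      refine Finset.sum_congr rfl fun v hv => ?_
      split_ifs with hL
      · rw [Finset.sum_eq_single 0]
        · rw [mulVar, if_neg (Finsupp.mem_support_iff.1 hv)]
          simp [inversionR, hL, deriv, shiftLabel, mul_comm]
        · intro b _ hb
          simp [inversionR, hb.symm]
        · simp
      · refine Finset.sum_eq_zero fun μ _ => ?_
        simp [inversionR, Ne.symm hL]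
    rw [h1, h2, h3]
    ring
  · intro l hl
    have : inversionR 𝕜 n (l + 1) = 0 := by
      rw [inversionR, if_neg (by omega)]
    simp [quantize, this]

/-- The quantization of `r_1 z` is the operator `generator`, coefficientwise in `q`. -/
theorem quantizeSeries_toFamily (z : PowerSeries (MvPowerSeries (Label n) 𝕜)) :
    quantizeSeries (inversionR 𝕜 n) (toFamily z) =
      toFamily (PowerSeries.mk fun w => generator (PowerSeries.coeff w z)) := by
  funext m j
  rw [quantizeSeries_inversionR]
  by_cases h : 0 ≤ 2 * j + m.degree
  · obtain ⟨w, hw⟩ := Int.eq_ofNat_of_zero_le h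
    rw [toFamily_natCast _ hw, PowerSeries.coeff_mk, generator, map_sub, map_rat_smul (coeff m),
      coeff_shiftDerivation, coeff_unitDerivation, coeff_unitDerivation]
    congr 1
    · refine Finset.sum_congr rfl fun v hv => ?_
      rw [toFamily_natCast _ (w := w)]
      rw [degree_shiftLabel hv, hw]
    · rw [toFamily_natCast _ (w := w), Rat.smul_def, Finsupp.add_apply, Finsupp.single_eq_same]
      · push_cast
        ring
      · simp only [map_add, Finsupp.degree_single]
        push_cast
        omega
  · rw [toFamily_of_neg _ (not_le.1 h), toFamily_of_neg, mul_zero, mul_zero, sub_zero]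
    · refine Finset.sum_eq_zero fun v hv => ?_
      rw [toFamily_of_neg, zero_mul]
      rw [degree_shiftLabel hv]
      exact not_le.1 h
    · simp only [map_add, Finsupp.degree_single]
      push_cast
      omega

theorem quantizeSeries_iterate_toFamily (z : PowerSeries (MvPowerSeries (Label n) 𝕜)) (k : ℕ) :
    (quantizeSeries (inversionR 𝕜 n))^[k] (toFamily z) =
      toFamily (PowerSeries.mk fun w => generator^[k] (PowerSeries.coeff w z)) := by
  induction k with
  | zero =>
    simp only [Function.iterate_zero, id]
    congr 1
    ext w
    rw [PowerSeries.coeff_mk]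
  | succ k ih =>
    rw [Function.iterate_succ_apply', ih, quantizeSeries_toFamily]
    congr 1
    ext w
    rw [PowerSeries.coeff_mk, PowerSeries.coeff_mk, PowerSeries.coeff_mk,
      Function.iterate_succ_apply']

end Quantization


/-! ### The flow of the generator -/

section Flow

open MvPowerSeries

variable {𝕜 : Type*} [RCLike 𝕜] {n : ℕ}

/-- The derivative `∂/∂s` of power series whose coefficients are polynomials in `s`. -/
def timeDerivation (𝕜 : Type*) [RCLike 𝕜] (n : ℕ) :
    AddDerivation (MvPowerSeries (Label n) (Polynomial 𝕜)) :=
  liftMvDerivation (AddDerivation.mk (Polynomial.derivative (R := 𝕜)).toAddMonoidHom fun f g => by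
    simp [mul_comm, add_comm])

theorem coeff_timeDerivation (f : MvPowerSeries (Label n) (Polynomial 𝕜)) (m : Label n →₀ ℕ) :
    coeff m (timeDerivation 𝕜 n f) = Polynomial.derivative (coeff m f) := rfl

/-- Evaluation of the time `s` in the coefficients. -/
def evalTime (n : ℕ) (s : 𝕜) :
    MvPowerSeries (Label n) (Polynomial 𝕜) →+* MvPowerSeries (Label n) 𝕜 :=
  MvPowerSeries.map (Polynomial.evalRingHom s)

theorem coeff_evalTime (s : 𝕜) (f : MvPowerSeries (Label n) (Polynomial 𝕜)) (m : Label n →₀ ℕ) :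
    coeff m (evalTime n s f) = (coeff m f).eval s := rfl

/-- The bound `|m| ≤ 3 w` on the monomials `q^w t^m` is preserved by products. -/
theorem coeff_pow_of_degree_bound {K : Type*} [CommRing K]
    {T : PowerSeries (MvPowerSeries (Label n) K)}
    (hT : ∀ (w : ℕ) (m : Label n →₀ ℕ), 3 * w < m.degree → coeff m (PowerSeries.coeff w T) = 0)
    (k : ℕ) (w : ℕ) (m : Label n →₀ ℕ) (h : 3 * w < m.degree) :
    coeff m (PowerSeries.coeff w (T ^ k)) = 0 := by
  classical
  induction k generalizing w m with
  | zero =>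
    rw [pow_zero, PowerSeries.coeff_one]
    split_ifs with hw
    · rw [coeff_one, if_neg]
      rintro rfl
      simp at h
    · rw [map_zero]
  | succ k ih =>
    rw [pow_succ, PowerSeries.coeff_mul, map_sum]
    refine Finset.sum_eq_zero fun p hp => ?_
    rw [coeff_mul]
    refine Finset.sum_eq_zero fun q hq => ?_
    have hp' := Finset.HasAntidiagonal.mem_antidiagonal.1 hp
    have hq' := congrArg Finsupp.degree (Finset.HasAntidiagonal.mem_antidiagonal.1 hq)
    rw [map_add] at hq'
    by_cases h1 : 3 * p.1 < q.1.degree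
    · rw [ih _ _ h1, zero_mul]
    · rw [hT _ _ (by omega), mul_zero]

theorem coeff_expSeries_of_degree_bound {K : Type*} [CommRing K] [Algebra ℚ K]
    {T : PowerSeries (MvPowerSeries (Label n) K)}
    (hT : ∀ (w : ℕ) (m : Label n →₀ ℕ), 3 * w < m.degree → coeff m (PowerSeries.coeff w T) = 0)
    (w : ℕ) (m : Label n →₀ ℕ) (h : 3 * w < m.degree) :
    coeff m (PowerSeries.coeff w (expSeries T)) = 0 := by
  rw [expSeries, PowerSeries.coeff_mk, map_sum, map_sum]
  refine Finset.sum_eq_zero fun k _ => ?_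
  rw [map_rat_smul (PowerSeries.coeff w), map_rat_smul (coeff m),
    coeff_pow_of_degree_bound hT k w m h, smul_zero]

theorem generator_rat_smul {K : Type*} [CommRing K] [Algebra ℚ K] (c : ℚ)
    (f : MvPowerSeries (Label n) K) : generator (c • f) = c • generator f := by
  rw [generator, generator, map_rat_smul (shiftDerivation K n), map_rat_smul (unitDerivation K n),
    map_rat_smul (unitDerivation K n), smul_sub, smul_comm]

/-- The orbit `exp (s D) z` of a series `z` under the generator `D`, for `z` with the bound
`|m| ≤ 3 w` on its monomials `q^w t^m`: then all coefficients are polynomials in the time `s`. -/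
def orbit (z : PowerSeries (MvPowerSeries (Label n) 𝕜)) :
    PowerSeries (MvPowerSeries (Label n) (Polynomial 𝕜)) :=
  PowerSeries.mk fun w => ofCoeff fun m =>
    ∑ k ∈ Finset.range (3 * w + 2 * lastCount m + 1),
      Polynomial.monomial k
        (((k.factorial : ℚ)⁻¹) • coeff m (generator^[k] (PowerSeries.coeff w z)))

section Orbit

variable {z : PowerSeries (MvPowerSeries (Label n) 𝕜)}
  (hz : ∀ (w : ℕ) (m : Label n →₀ ℕ), 3 * w < m.degree → coeff m (PowerSeries.coeff w z) = 0)

include hz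

theorem coeff_generator_iterate_of_le (w : ℕ) (m : Label n →₀ ℕ) {k : ℕ}
    (hk : 3 * w + 2 * lastCount m + 1 ≤ k) :
    coeff m (generator^[k] (PowerSeries.coeff w z)) = 0 :=
  coeff_generator_iterate_eq_zero (hz w) k m (by omega)

theorem coeff_orbit (w : ℕ) (m : Label n →₀ ℕ) (k : ℕ) :
    (coeff m (PowerSeries.coeff w (orbit z))).coeff k =
      ((k.factorial : ℚ)⁻¹) • coeff m (generator^[k] (PowerSeries.coeff w z)) := by
  rw [orbit, PowerSeries.coeff_mk, coeff_ofCoeff, Polynomial.finsetSum_coeff]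
  simp only [Polynomial.coeff_monomial]
  rw [Finset.sum_ite_eq']
  split_ifs with h
  · rfl
  · rw [coeff_generator_iterate_of_le hz w m (by simpa using h), smul_zero]

theorem mapCoeff_orbit (w : ℕ) (k : ℕ) :
    mapCoeff (Polynomial.lcoeff 𝕜 k).toAddMonoidHom (PowerSeries.coeff w (orbit z)) =
      ((k.factorial : ℚ)⁻¹) • generator^[k] (PowerSeries.coeff w z) := by
  ext m
  rw [coeff_mapCoeff, map_rat_smul (coeff m)]
  exact coeff_orbit hz w m k

/-- The evolution equation `∂_s Ψ = D Ψ`. -/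
theorem timeDerivation_orbit (w : ℕ) :
    timeDerivation 𝕜 n (PowerSeries.coeff w (orbit z)) =
      generator (PowerSeries.coeff w (orbit z)) := by
  ext m k
  have h1 := congrArg (coeff m) (generator_mapCoeff (Polynomial.lcoeff 𝕜 k).toAddMonoidHom
    (PowerSeries.coeff w (orbit z)))
  rw [mapCoeff_orbit hz, generator_rat_smul, map_rat_smul (coeff m), coeff_mapCoeff] at h1
  refine Eq.trans ?_ h1
  rw [coeff_timeDerivation, Polynomial.coeff_derivative, coeff_orbit hz,
    Function.iterate_succ_apply', Rat.smul_def, Rat.smul_def, Nat.factorial_succ]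
  have h2 : (k.factorial : 𝕜) ≠ 0 := by exact_mod_cast k.factorial_ne_zero
  have h3 : (k : 𝕜) + 1 ≠ 0 := by exact_mod_cast k.succ_ne_zero
  push_cast
  field_simp

theorem eval_orbit (w : ℕ) (m : Label n →₀ ℕ) (s : 𝕜) {N : ℕ}
    (hN : 3 * w + 2 * lastCount m + 1 ≤ N) :
    (coeff m (PowerSeries.coeff w (orbit z))).eval s = ∑ k ∈ Finset.range N,
      (((k.factorial : ℚ)⁻¹) • coeff m (generator^[k] (PowerSeries.coeff w z))) * s ^ k := by
  rw [orbit, PowerSeries.coeff_mk, coeff_ofCoeff, Polynomial.eval_finsetSum]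
  simp only [Polynomial.eval_monomial]
  refine Finset.sum_subset (fun x hx => ?_) fun k _ hk => ?_
  · simp only [Finset.mem_range] at hx ⊢; omega
  · rw [coeff_generator_iterate_of_le hz w m (by simpa using hk), smul_zero, zero_mul]

theorem evalTime_zero_orbit : PowerSeries.map (evalTime n (0 : 𝕜)) (orbit z) = z := by
  ext w m
  rw [PowerSeries.coeff_map, coeff_evalTime, eval_orbit hz w m 0 le_rfl, Finset.sum_range_succ',
    Finset.sum_eq_zero fun k _ => by rw [pow_succ, mul_zero, mul_zero]]
  simp

theorem constantCoeff_orbit (h1 : PowerSeries.constantCoeff z = 1) :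
    PowerSeries.constantCoeff (orbit z) = 1 := by
  classical
  have hk : ∀ k : ℕ, generator^[k + 1] (1 : MvPowerSeries (Label n) 𝕜) = 0 := by
    intro k
    rw [Function.iterate_succ_apply, generator_one]
    exact Function.iterate_fixed generator_zero k
  rw [← PowerSeries.coeff_zero_eq_constantCoeff_apply] at h1 ⊢
  ext m k
  rw [coeff_orbit hz, h1]
  cases k with
  | zero =>
    rw [coeff_one]
    split_ifs with h <;> simp [coeff_one, h]
  | succ k =>
    rw [hk, map_zero, smul_zero, coeff_one]
    split_ifs with h <;> simp [Polynomial.coeff_one]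

end Orbit

/-- Conjugating the heat-type equation `∂_s Ψ = D Ψ` by the exponential: the logarithm of the
orbit exists as a power series, and solves the Hamilton–Jacobi equation with a dispersive term
`∂_s W = A W - ½ (∂² W + (∂ W)²)`. -/
theorem exists_potential_flow {T : PowerSeries (MvPowerSeries (Label n) 𝕜)}
    (hT0 : PowerSeries.constantCoeff T = 0)
    (hT : ∀ (w : ℕ) (m : Label n →₀ ℕ), 3 * w < m.degree → coeff m (PowerSeries.coeff w T) = 0) :
    ∃ W : PowerSeries (MvPowerSeries (Label n) (Polynomial 𝕜)),
      PowerSeries.constantCoeff W = 0 ∧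
      PowerSeries.map (evalTime n (0 : 𝕜)) W = T ∧
      liftDerivation (timeDerivation 𝕜 n) W =
        liftDerivation (shiftDerivation (Polynomial 𝕜) n) W - (1 / 2 : ℚ) •
          (liftDerivation (unitDerivation (Polynomial 𝕜) n)
              (liftDerivation (unitDerivation (Polynomial 𝕜) n) W) +
            liftDerivation (unitDerivation (Polynomial 𝕜) n) W *
              liftDerivation (unitDerivation (Polynomial 𝕜) n) W) ∧
      ∀ (w : ℕ) (m : Label n →₀ ℕ) (N : ℕ), 3 * w + 2 * lastCount m + 1 ≤ N →
        ∑ k ∈ Finset.range N, ((k.factorial : ℚ)⁻¹) •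
          coeff m (generator^[k] (PowerSeries.coeff w (expSeries T))) =
        coeff m (PowerSeries.coeff w (expSeries (PowerSeries.map (evalTime n (1 : 𝕜)) W))) := by
  have hz := coeff_expSeries_of_degree_bound hT
  obtain ⟨W, hW0, hW⟩ := exists_expSeries_eq
    (constantCoeff_orbit hz (constantCoeff_expSeries T))
  have hmap0 : ∀ s : 𝕜, PowerSeries.constantCoeff (PowerSeries.map (evalTime n s) W) = 0 := by
    intro s
    rw [← PowerSeries.coeff_zero_eq_constantCoeff_apply, PowerSeries.coeff_map,
      PowerSeries.coeff_zero_eq_constantCoeff_apply, hW0, map_zero]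
  refine ⟨W, hW0, ?_, ?_, ?_⟩
  · refine expSeries_injective (a := PowerSeries.map (evalTime n (0 : 𝕜)) W) (b := T)
      (hmap0 0) hT0 ?_
    rw [← map_expSeries, hW, evalTime_zero_orbit hz]
  · have h1 : liftDerivation (timeDerivation 𝕜 n) (expSeries W) =
        liftDerivation (shiftDerivation (Polynomial 𝕜) n) (expSeries W) - (1 / 2 : ℚ) •
          liftDerivation (unitDerivation (Polynomial 𝕜) n)
            (liftDerivation (unitDerivation (Polynomial 𝕜) n) (expSeries W)) := by
      rw [hW]
      ext1 w
      rw [map_sub, map_rat_smul (PowerSeries.coeff w)]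
      simp only [coeff_liftDerivation]
      exact timeDerivation_orbit hz w
    -- Every derivation `δ` satisfies `δ (exp W) = δ W exp W`, and `exp W` may be cancelled.
    have hu := isUnit_expSeries W
    refine hu.mul_right_cancel ?_
    rw [liftDerivation_expSeries _ hW0, liftDerivation_expSeries _ hW0,
      liftDerivation_expSeries _ hW0, AddDerivation.leibniz, liftDerivation_expSeries _ hW0] at h1
    rw [h1, sub_mul, smul_mul_assoc]
    congr 2
    ring
  · intro w m N hN
    rw [← map_expSeries, hW, PowerSeries.coeff_map, coeff_evalTime, eval_orbit hz w m 1 hN]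
    simp

end Flow


/-! ### Genus expansion and genus zero part of the flow -/

section Vanishing

variable {𝕜 : Type*} [Field 𝕜] [CharZero 𝕜]

theorem X_pow_succ_dvd_of_derivative {f : Polynomial 𝕜} {i : ℕ} (h0 : f.eval 0 = 0)
    (h : Polynomial.X ^ i ∣ Polynomial.derivative f) : Polynomial.X ^ (i + 1) ∣ f := by
  rw [Polynomial.X_pow_dvd_iff] at h ⊢
  intro d hd
  cases d with
  | zero => rwa [Polynomial.coeff_zero_eq_eval_zero]
  | succ d =>
    have h1 := h d (by omega)
    rw [Polynomial.coeff_derivative] at h1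
    exact (mul_eq_zero.1 h1).resolve_right (by exact_mod_cast d.succ_ne_zero)

/-- Uniqueness for evolution equations, in the form of a Gronwall lemma: a family of polynomials
in the time vanishes if it vanishes at time zero, and if its derivative vanishes to every order
to which the family does. -/
theorem eq_zero_of_evolution {ι : Type*} (f : ι → Polynomial 𝕜) (h0 : ∀ x, (f x).eval 0 = 0)
    (h : ∀ i : ℕ, (∀ x, Polynomial.X ^ i ∣ f x) →
      ∀ x, Polynomial.X ^ i ∣ Polynomial.derivative (f x)) (x : ι) : f x = 0 := by
  have key : ∀ i : ℕ, ∀ x, Polynomial.X ^ i ∣ f x := by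
    intro i
    induction i with
    | zero => intro x; rw [pow_zero]; exact one_dvd _
    | succ i ih => exact fun x => X_pow_succ_dvd_of_derivative (h0 x) (h i ih x)
  ext d
  exact Polynomial.X_pow_dvd_iff.1 (key (d + 1) x) d (Nat.lt_succ_self d)

end Vanishing

section GenusExpansion

open MvPowerSeries

variable {𝕜 : Type*} [RCLike 𝕜] {n : ℕ}

theorem dvd_coeff_mul {σ K : Type*} [CommRing K] {f g : MvPowerSeries σ K} {a : K}
    (h : ∀ m, a ∣ coeff m g) (m : σ →₀ ℕ) : a ∣ coeff m (f * g) := by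
  classical
  rw [coeff_mul]
  exact Finset.dvd_sum fun p _ => Dvd.dvd.mul_left (h _) _

theorem dvd_coeff_unitDerivation {K : Type*} [CommRing K] {f : MvPowerSeries (Label n) K} {a : K}
    (h : ∀ m, a ∣ coeff m f) (m : Label n →₀ ℕ) : a ∣ coeff m (unitDerivation K n f) := by
  rw [coeff_unitDerivation]
  exact Dvd.dvd.mul_right (h _) _

/-- The flow `∂_s W = A W - ½ (∂² W + (∂ W)²)` of total potentials. -/
def IsPotentialFlow (W : PowerSeries (MvPowerSeries (Label n) (Polynomial 𝕜))) : Prop :=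
  liftDerivation (timeDerivation 𝕜 n) W =
    liftDerivation (shiftDerivation (Polynomial 𝕜) n) W - (1 / 2 : ℚ) •
      (liftDerivation (unitDerivation (Polynomial 𝕜) n)
          (liftDerivation (unitDerivation (Polynomial 𝕜) n) W) +
        liftDerivation (unitDerivation (Polynomial 𝕜) n) W *
          liftDerivation (unitDerivation (Polynomial 𝕜) n) W)

variable {W : PowerSeries (MvPowerSeries (Label n) (Polynomial 𝕜))}

theorem IsPotentialFlow.coeff (hW : IsPotentialFlow W) (w : ℕ) (m : Label n →₀ ℕ) :
    Polynomial.derivative (coeff m (PowerSeries.coeff w W)) =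
      MvPowerSeries.coeff m (shiftDerivation (Polynomial 𝕜) n (PowerSeries.coeff w W)) -
        (1 / 2 : ℚ) •
        (MvPowerSeries.coeff m (unitDerivation (Polynomial 𝕜) n
            (unitDerivation (Polynomial 𝕜) n (PowerSeries.coeff w W))) +
          MvPowerSeries.coeff m (PowerSeries.coeff w
            (liftDerivation (unitDerivation (Polynomial 𝕜) n) W *
              liftDerivation (unitDerivation (Polynomial 𝕜) n) W))) := by
  have h := congrArg (fun f => MvPowerSeries.coeff m (PowerSeries.coeff w f)) hW
  simp only [map_sub, map_rat_smul (PowerSeries.coeff w), map_add,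
    map_rat_smul (MvPowerSeries.coeff m), coeff_liftDerivation, coeff_timeDerivation] at h
  exact h

theorem coeff_coeff_mul (f g : PowerSeries (MvPowerSeries (Label n) (Polynomial 𝕜))) (w : ℕ)
    (m : Label n →₀ ℕ) : coeff m (PowerSeries.coeff w (f * g)) =
      ∑ q ∈ Finset.HasAntidiagonal.antidiagonal m, ∑ p ∈ Finset.HasAntidiagonal.antidiagonal w,
        coeff q.1 (PowerSeries.coeff p.1 f) * coeff q.2 (PowerSeries.coeff p.2 g) := by
  classical
  rw [PowerSeries.coeff_mul, map_sum, Finset.sum_comm]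
  exact Finset.sum_congr rfl fun p _ => coeff_mul _ _ _

/-- The flow preserves the genus expansion: only the monomials `q^w t^m` with
`w = 2 (g - 1) + |m|` for some `g ≥ 0` occur. -/
theorem coeff_eq_zero_of_flow (hW : IsPotentialFlow W)
    (h0 : ∀ (w : ℕ) (m : Label n →₀ ℕ), (∀ g, w + 2 ≠ m.degree + 2 * g) →
      (coeff m (PowerSeries.coeff w W)).eval 0 = 0)
    (w : ℕ) (m : Label n →₀ ℕ) (h : ∀ g, w + 2 ≠ m.degree + 2 * g) :
    coeff m (PowerSeries.coeff w W) = 0 := by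
  -- The monomials without genus form a closed linear system: a derivative `∂²` lowers the genus by
  -- one, and a product of two monomials with genera `g₁` and `g₂` has genus `g₁ + g₂`.
  refine eq_zero_of_evolution
    (ι := {x : ℕ × (Label n →₀ ℕ) // ∀ g, x.1 + 2 ≠ x.2.degree + 2 * g})
    (fun x => coeff x.1.2 (PowerSeries.coeff x.1.1 W)) (fun x => h0 _ _ x.2) ?_ ⟨(w, m), h⟩
  rintro i hi ⟨⟨w, m⟩, h⟩
  replace hi : ∀ (w : ℕ) (m : Label n →₀ ℕ), (∀ g, w + 2 ≠ m.degree + 2 * g) →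
      Polynomial.X ^ i ∣ coeff m (PowerSeries.coeff w W) := fun w m h => hi ⟨(w, m), h⟩
  dsimp only at h ⊢
  rw [hW.coeff]
  refine dvd_sub (dvd_coeff_shiftDerivation fun v hv => hi _ _ ?_)
    (dvd_smul_of_dvd _ (dvd_add ?_ ?_))
  · rwa [degree_shiftLabel hv]
  · rw [coeff_unitDerivation, coeff_unitDerivation]
    refine Dvd.dvd.mul_right (Dvd.dvd.mul_right (hi _ _ fun g hg => ?_) _) _
    simp only [map_add, Finsupp.degree_single] at hg
    exact h (g + 1) (by omega)
  · rw [coeff_coeff_mul]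
    refine Finset.dvd_sum fun q hq => Finset.dvd_sum fun p hp => ?_
    have hp' := Finset.HasAntidiagonal.mem_antidiagonal.1 hp
    have hq' := congrArg Finsupp.degree (Finset.HasAntidiagonal.mem_antidiagonal.1 hq)
    simp only [map_add] at hq'
    rw [coeff_liftDerivation, coeff_liftDerivation, coeff_unitDerivation, coeff_unitDerivation]
    by_cases h1 : ∃ g, p.1 + 2 = (q.1 + Finsupp.single (0, 0) 1).degree + 2 * g
    · by_cases h2 : ∃ g, p.2 + 2 = (q.2 + Finsupp.single (0, 0) 1).degree + 2 * g
      · obtain ⟨g1, h1⟩ := h1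
        obtain ⟨g2, h2⟩ := h2
        simp only [map_add, Finsupp.degree_single] at h1 h2
        exact absurd (show w + 2 = m.degree + 2 * (g1 + g2) by omega) (h _)
      · push Not at h2
        exact Dvd.dvd.mul_left (Dvd.dvd.mul_right (hi _ _ h2) _) _
    · push Not at h1
      exact Dvd.dvd.mul_right (Dvd.dvd.mul_right (hi _ _ h1) _) _

/-- The genus `g` part at time one of a total potential that depends polynomially on the time. -/
def potentialAtOne (W : PowerSeries (MvPowerSeries (Label n) (Polynomial 𝕜))) (g : ℕ) :
    MvPowerSeries (Label n) 𝕜 :=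
  ofCoeff fun m => if 2 * g + m.degree ≤ 2 then 0 else
    (coeff m (PowerSeries.coeff (2 * g + m.degree - 2) W)).eval 1

theorem isStable_potentialAtOne (W : PowerSeries (MvPowerSeries (Label n) (Polynomial 𝕜))) :
    IsStable (potentialAtOne W) := by
  intro g m h
  rw [potentialAtOne, coeff_ofCoeff, if_pos h]

theorem regraded_potentialAtOne (hW0 : PowerSeries.constantCoeff W = 0)
    (hW : ∀ (w : ℕ) (m : Label n →₀ ℕ), (∀ g, w + 2 ≠ m.degree + 2 * g) →
      coeff m (PowerSeries.coeff w W) = 0) :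
    regraded (potentialAtOne W) = PowerSeries.map (evalTime n (1 : 𝕜)) W := by
  ext w m
  rw [PowerSeries.coeff_map, coeff_evalTime]
  by_cases h : ∃ g, w + 2 = m.degree + 2 * g
  · obtain ⟨g, hg⟩ := h
    rw [coeff_regraded _ hg, potentialAtOne, coeff_ofCoeff]
    split_ifs with h1
    · obtain rfl : w = 0 := by omega
      rw [PowerSeries.coeff_zero_eq_constantCoeff_apply, hW0, map_zero, Polynomial.eval_zero]
    · rw [show 2 * g + m.degree - 2 = w by omega]
  · push Not at h
    rw [coeff_regraded_eq_zero _ h, hW w m h, Polynomial.eval_zero]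

/-- The genus zero part of a total potential, as a function of the time. -/
def genusZero (W : PowerSeries (MvPowerSeries (Label n) (Polynomial 𝕜))) :
    MvPowerSeries (Label n) (Polynomial 𝕜) :=
  ofCoeff fun m => if m.degree < 2 then 0 else coeff m (PowerSeries.coeff (m.degree - 2) W)

theorem coeff_genusZero {m : Label n →₀ ℕ} {w : ℕ} (h : w + 2 = m.degree) :
    coeff m (genusZero W) = coeff m (PowerSeries.coeff w W) := by
  rw [genusZero, coeff_ofCoeff, if_neg (by omega), show m.degree - 2 = w by omega]

theorem coeff_genusZero_of_lt {m : Label n →₀ ℕ} (h : m.degree < 2) :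
    coeff m (genusZero W) = 0 := by
  rw [genusZero, coeff_ofCoeff, if_pos h]

theorem coeff_unitDerivation_genusZero {m : Label n →₀ ℕ} {w : ℕ} (h : w + 1 = m.degree) :
    coeff m (unitDerivation (Polynomial 𝕜) n (genusZero W)) =
      coeff m (unitDerivation (Polynomial 𝕜) n (PowerSeries.coeff w W)) := by
  rw [coeff_unitDerivation, coeff_unitDerivation, coeff_genusZero (w := w)]
  simp only [map_add, Finsupp.degree_single]
  omega

theorem coeff_unitDerivation_genusZero_of_degree_zero {m : Label n →₀ ℕ} (h : m.degree = 0) :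
    coeff m (unitDerivation (Polynomial 𝕜) n (genusZero W)) = 0 := by
  rw [coeff_unitDerivation, coeff_genusZero_of_lt, zero_mul]
  simp only [map_add, Finsupp.degree_single]
  omega

/-- The genus zero part satisfies the Hamilton–Jacobi equation `∂_s W = A W - ½ (∂ W)²`. -/
theorem timeDerivation_genusZero (hW : IsPotentialFlow W)
    (hg : ∀ (w : ℕ) (m : Label n →₀ ℕ), (∀ g, w + 2 ≠ m.degree + 2 * g) →
      coeff m (PowerSeries.coeff w W) = 0) :
    timeDerivation 𝕜 n (genusZero W) =
      shiftDerivation (Polynomial 𝕜) n (genusZero W) - (1 / 2 : ℚ) •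
        (unitDerivation (Polynomial 𝕜) n (genusZero W) *
          unitDerivation (Polynomial 𝕜) n (genusZero W)) := by
  classical
  -- a derivative of `W` has no terms of genus less than zero
  have hg1 : ∀ (w : ℕ) (m : Label n →₀ ℕ), w + 1 < m.degree →
      coeff m (unitDerivation (Polynomial 𝕜) n (PowerSeries.coeff w W)) = 0 := by
    intro w m h
    rw [coeff_unitDerivation, hg, zero_mul]
    intro g
    simp only [map_add, Finsupp.degree_single]
    omega
  ext1 m
  rw [coeff_timeDerivation, map_sub, map_rat_smul (coeff m), coeff_mul]
  by_cases hm : m.degree < 2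
  · rw [coeff_genusZero_of_lt hm, Polynomial.derivative_zero,
      zero_dvd_iff.1 (dvd_coeff_shiftDerivation fun v hv => zero_dvd_iff.2
        (coeff_genusZero_of_lt (by rwa [degree_shiftLabel hv]))), Finset.sum_eq_zero, smul_zero,
      sub_zero]
    intro q hq
    have hq' := congrArg Finsupp.degree (Finset.HasAntidiagonal.mem_antidiagonal.1 hq)
    simp only [map_add] at hq'
    by_cases h1 : q.1.degree = 0
    · rw [coeff_unitDerivation_genusZero_of_degree_zero h1, zero_mul]
    · rw [coeff_unitDerivation_genusZero_of_degree_zero (m := q.2) (by omega), mul_zero]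
  · obtain ⟨w, hw⟩ : ∃ w, w + 2 = m.degree := ⟨m.degree - 2, by omega⟩
    -- the dispersive term `∂² W` has genus at least one
    have h2 : coeff m (unitDerivation (Polynomial 𝕜) n
        (unitDerivation (Polynomial 𝕜) n (PowerSeries.coeff w W))) = 0 := by
      rw [coeff_unitDerivation, hg1, zero_mul]
      simp only [map_add, Finsupp.degree_single]
      omega
    rw [coeff_genusZero hw, hW.coeff, h2, zero_add, coeff_coeff_mul]
    have hS : coeff m (shiftDerivation (Polynomial 𝕜) n (PowerSeries.coeff w W)) =
        coeff m (shiftDerivation (Polynomial 𝕜) n (genusZero W)) := by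
      rw [coeff_shiftDerivation, coeff_shiftDerivation]
      refine Finset.sum_congr rfl fun v hv => ?_
      rw [coeff_genusZero (w := w) (by rw [degree_shiftLabel hv, hw])]
    rw [hS]
    refine congrArg (fun x => coeff m (shiftDerivation (Polynomial 𝕜) n (genusZero W)) -
      (1 / 2 : ℚ) • x) (Finset.sum_congr rfl fun q hq => ?_)
    · have hq' := congrArg Finsupp.degree (Finset.HasAntidiagonal.mem_antidiagonal.1 hq)
      simp only [map_add] at hq'
      simp only [coeff_liftDerivation]
      -- in the square `(∂ W)²` only products of two genus zero terms have genus zero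
      have hz : ∀ p ∈ Finset.HasAntidiagonal.antidiagonal w,
          (p.1 + 1 ≠ q.1.degree ∨ p.2 + 1 ≠ q.2.degree) →
          coeff q.1 (unitDerivation (Polynomial 𝕜) n (PowerSeries.coeff p.1 W)) *
            coeff q.2 (unitDerivation (Polynomial 𝕜) n (PowerSeries.coeff p.2 W)) = 0 := by
        intro p hp hne
        have hp' := Finset.HasAntidiagonal.mem_antidiagonal.1 hp
        by_cases h3 : p.1 + 1 < q.1.degree
        · rw [hg1 _ _ h3, zero_mul]
        · rw [hg1 p.2 q.2 (by omega), mul_zero]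
      by_cases h3 : q.1.degree = 0
      · rw [coeff_unitDerivation_genusZero_of_degree_zero h3, zero_mul]
        exact Finset.sum_eq_zero fun p hp => hz p hp (Or.inl (by omega))
      by_cases h4 : q.2.degree = 0
      · rw [coeff_unitDerivation_genusZero_of_degree_zero h4, mul_zero]
        exact Finset.sum_eq_zero fun p hp => hz p hp (Or.inr (by omega))
      rw [Finset.sum_eq_single (q.1.degree - 1, q.2.degree - 1)]
      · rw [coeff_unitDerivation_genusZero (w := q.1.degree - 1) (by omega),
          coeff_unitDerivation_genusZero (w := q.2.degree - 1) (by omega)]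
      · intro p hp hne
        refine hz p hp ?_
        by_contra hcon
        push Not at hcon
        exact hne (Prod.ext (by simp only; omega) (by simp only; omega))
      · intro hn
        exact absurd (Finset.HasAntidiagonal.mem_antidiagonal.2 (by simp only; omega)) hn

end GenusExpansion

/-! ### The dilaton equation along the flow -/

section Dilaton

open MvPowerSeries

variable {K : Type*} [CommRing K] {n : ℕ}

/-- The derivation `∂_{1,1} - ∑ t^{d,μ} ∂_{d,μ}`. -/
def dilatonDerivation (K : Type*) [CommRing K] (n : ℕ) :
    AddDerivation (MvPowerSeries (Label n) K) :=
  AddDerivation.mk (AddMonoidHom.mk' (fun f => pderiv K ((1 : ℕ), (0 : Fin (n + 2))) f -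
      ofCoeff fun m => coeff m f * (m.degree : K)) (by
    intro f g
    ext m
    simp only [map_add, map_sub, coeff_ofCoeff]
    ring))
    (by
      classical
      intro f g
      ext m
      change coeff m (pderiv K _ (f * g) - _) =
        coeff m (f * (pderiv K _ g - _) + g * (pderiv K _ f - _))
      rw [Derivation.leibniz, smul_eq_mul, smul_eq_mul, mul_sub, mul_sub]
      have h : coeff m (ofCoeff fun m => coeff m (f * g) * (m.degree : K)) =
          coeff m (f * ofCoeff fun m => coeff m g * (m.degree : K)) +
            coeff m (g * ofCoeff fun m => coeff m f * (m.degree : K)) := by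
        rw [coeff_ofCoeff, mul_comm g, coeff_mul, coeff_mul, coeff_mul, Finset.sum_mul,
          ← Finset.sum_add_distrib]
        refine Finset.sum_congr rfl fun p hp => ?_
        rw [← Finset.HasAntidiagonal.mem_antidiagonal.1 hp, map_add, coeff_ofCoeff, coeff_ofCoeff]
        push_cast
        ring
      simp only [map_sub, map_add, h]
      ring)

theorem coeff_dilatonDerivation (f : MvPowerSeries (Label n) K) (m : Label n →₀ ℕ) :
    coeff m (dilatonDerivation K n f) =
      coeff (m + Finsupp.single (1, 0) 1) f * ((m (1, 0) : ℕ) + 1) -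
        coeff m f * (m.degree : K) := by
  rw [← coeff_pderiv]
  rfl

theorem dilatonDerivation_pderiv (v : Label n) (f : MvPowerSeries (Label n) K) :
    dilatonDerivation K n (pderiv K v f) =
      pderiv K v (dilatonDerivation K n f) + pderiv K v f := by
  ext m
  rw [map_add, coeff_dilatonDerivation, coeff_pderiv (dilatonDerivation K n f),
    coeff_dilatonDerivation, ← coeff_pderiv (pderiv K v f), pderiv_comm, coeff_pderiv, coeff_pderiv,
    sub_mul, ← coeff_pderiv f, coeff_pderiv f, coeff_pderiv f]
  simp only [map_add, Finsupp.degree_single]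
  push_cast
  ring

theorem dilatonDerivation_unitDerivation (f : MvPowerSeries (Label n) K) :
    dilatonDerivation K n (unitDerivation K n f) =
      unitDerivation K n (dilatonDerivation K n f) + unitDerivation K n f :=
  dilatonDerivation_pderiv (0, 0) f

theorem pderiv_shiftDerivation (f : MvPowerSeries (Label n) K) :
    pderiv K ((1 : ℕ), (0 : Fin (n + 2))) (shiftDerivation K n f) =
      shiftDerivation K n (pderiv K ((1 : ℕ), (0 : Fin (n + 2))) f) := by
  have h0 : (0 : Fin (n + 2)) ≠ Fin.last (n + 1) := by simp [Fin.ext_iff]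
  ext m
  have hsub : lastLabels (m + Finsupp.single ((1 : ℕ), (0 : Fin (n + 2))) 1) ⊆ lastLabels m := by
    intro v hv
    rw [mem_lastLabels] at hv ⊢
    refine ⟨?_, hv.2⟩
    have hv1 : ((1 : ℕ), (0 : Fin (n + 2))) ≠ v := by
      rintro rfl
      exact h0 hv.2
    simpa [Finsupp.single_eq_of_ne (Ne.symm hv1)] using hv.1
  rw [coeff_pderiv]
  change coeff _ (shiftFun f) * _ = coeff _ (shiftFun _)
  rw [coeff_shiftFun f _ hsub fun v hv => (mem_lastLabels.1 hv).2,
    coeff_shiftFun _ m subset_rfl fun v hv => (mem_lastLabels.1 hv).2, Finset.sum_mul]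
  refine Finset.sum_congr rfl fun v hv => ?_
  rw [← coeff_pderiv, Derivation.leibniz, pderiv_X_of_ne, smul_zero, add_zero, smul_eq_mul,
    pderiv_comm]
  rintro rfl
  exact h0 (mem_lastLabels.1 hv).2

theorem dilatonDerivation_shiftDerivation (f : MvPowerSeries (Label n) K) :
    dilatonDerivation K n (shiftDerivation K n f) =
      shiftDerivation K n (dilatonDerivation K n f) := by
  ext m
  rw [coeff_dilatonDerivation, ← coeff_pderiv, pderiv_shiftDerivation, coeff_shiftDerivation,
    coeff_shiftDerivation, coeff_shiftDerivation, Finset.sum_mul, ← Finset.sum_sub_distrib]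
  refine Finset.sum_congr rfl fun v hv => ?_
  rw [coeff_dilatonDerivation, coeff_pderiv, degree_shiftLabel hv]
  ring

variable {𝕜 : Type*} [RCLike 𝕜]

/-- The genus zero flow preserves the dilaton equation `∂_{1,1} F = (∑ t^{d,μ} ∂_{d,μ} - 2) F`. -/
theorem dilaton_of_flow {w : MvPowerSeries (Label n) (Polynomial 𝕜)}
    (hw : timeDerivation 𝕜 n w = shiftDerivation (Polynomial 𝕜) n w - (1 / 2 : ℚ) •
        (unitDerivation (Polynomial 𝕜) n w * unitDerivation (Polynomial 𝕜) n w))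
    (h0 : ∀ m : Label n →₀ ℕ,
      (coeff m (dilatonDerivation (Polynomial 𝕜) n w + (2 : ℕ) • w)).eval 0 = 0) :
    dilatonDerivation (Polynomial 𝕜) n w + (2 : ℕ) • w = 0 := by
  set Y := dilatonDerivation (Polynomial 𝕜) n w + (2 : ℕ) • w with hY
  have hdil : timeDerivation 𝕜 n (dilatonDerivation (Polynomial 𝕜) n w) =
      dilatonDerivation (Polynomial 𝕜) n (timeDerivation 𝕜 n w) := by
    ext1 m
    rw [coeff_timeDerivation, coeff_dilatonDerivation, coeff_dilatonDerivation,
      coeff_timeDerivation, coeff_timeDerivation, Polynomial.derivative_sub,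
      Polynomial.derivative_mul, Polynomial.derivative_mul]
    simp
  -- The defect `Y` of the dilaton equation satisfies the linearized flow equation.
  have key : timeDerivation 𝕜 n Y = shiftDerivation (Polynomial 𝕜) n Y -
      unitDerivation (Polynomial 𝕜) n w * unitDerivation (Polynomial 𝕜) n Y := by
    have h2 : ∀ f : MvPowerSeries (Label n) (Polynomial 𝕜),
        (1 / 2 : ℚ) • ((2 : ℕ) • f) = f := by
      intro f
      rw [← Nat.cast_smul_eq_nsmul ℚ, smul_smul]
      norm_num
    have h3 : dilatonDerivation (Polynomial 𝕜) n
        (unitDerivation (Polynomial 𝕜) n w * unitDerivation (Polynomial 𝕜) n w) +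
          (2 : ℕ) • (unitDerivation (Polynomial 𝕜) n w * unitDerivation (Polynomial 𝕜) n w) =
        (2 : ℕ) • (unitDerivation (Polynomial 𝕜) n w * unitDerivation (Polynomial 𝕜) n Y) := by
      rw [hY, AddDerivation.leibniz, dilatonDerivation_unitDerivation, map_add, map_nsmul]
      simp only [nsmul_eq_mul]
      push_cast
      ring
    rw [hY, map_add, map_nsmul, hdil, hw, map_sub, dilatonDerivation_shiftDerivation,
      map_rat_smul (dilatonDerivation (Polynomial 𝕜) n), map_add, map_nsmul, ← hY, smul_sub,
      smul_comm (2 : ℕ) (1 / 2 : ℚ), ← h2 (unitDerivation (Polynomial 𝕜) n w *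
        unitDerivation (Polynomial 𝕜) n Y), ← h3, smul_add]
    abel
  ext1 m
  refine eq_zero_of_evolution (fun m => coeff m Y) h0 (fun i hi m => ?_) m
  rw [← coeff_timeDerivation, key, map_sub]
  exact dvd_sub (dvd_coeff_shiftDerivation fun v _ => hi _)
    (dvd_coeff_mul (dvd_coeff_unitDerivation hi) m)

end Dilaton


/-! ### Restriction to the small phase space -/

section Restriction

open MvPowerSeries

variable {K : Type*} [CommRing K] {n : ℕ}

/-- The part of a monomial in the variables `t^{0,μ}`. -/
def primaryPart (m : Label n →₀ ℕ) : Fin (n + 2) →₀ ℕ :=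
  m.comapDomain (fun μ => ((0 : ℕ), μ)) fun _ _ _ _ h => (Prod.mk.inj h).2

theorem primary_zero_apply (m : Fin (n + 2) →₀ ℕ) (μ : Fin (n + 2)) :
    primary m ((0 : ℕ), μ) = m μ :=
  Finsupp.mapDomain_apply (fun _ _ h => (Prod.mk.inj h).2) m μ

theorem primary_succ_apply (m : Fin (n + 2) →₀ ℕ) (d : ℕ) (μ : Fin (n + 2)) :
    primary m (d + 1, μ) = 0 := by
  refine Finsupp.mapDomain_of_notMem_range m _ ?_
  rintro ⟨ν, hν⟩
  simp at hν

theorem primaryPart_primary (m : Fin (n + 2) →₀ ℕ) : primaryPart (primary m) = m := by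
  ext μ
  exact primary_zero_apply m μ

theorem primary_add (a b : Fin (n + 2) →₀ ℕ) : primary (a + b) = primary a + primary b :=
  Finsupp.mapDomain_add

theorem primary_single (μ : Fin (n + 2)) (c : ℕ) :
    primary (Finsupp.single μ c) = Finsupp.single ((0 : ℕ), μ) c :=
  Finsupp.mapDomain_single

theorem degree_primary (m : Fin (n + 2) →₀ ℕ) : (primary m).degree = m.degree :=
  Finsupp.degree_mapDomain _ _

theorem primary_injective : Function.Injective (primary (n := n)) :=
  Function.LeftInverse.injective primaryPart_primary

/-- The level `∑ d` of a monomial `∏ t^{d,μ}`. -/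
def level : (Label n →₀ ℕ) →+ ℕ := Finsupp.weight fun v : Label n => v.1

theorem level_single (v : Label n) (c : ℕ) : level (Finsupp.single v c) = c * v.1 := by
  simp [level, Finsupp.weight_single]

theorem le_level {m : Label n →₀ ℕ} {v : Label n} (h : m v ≠ 0) : v.1 ≤ level m :=
  Finsupp.le_weight_of_ne_zero' (fun v : Label n => v.1) h

theorem primary_primaryPart {m : Label n →₀ ℕ} (h : level m = 0) : primary (primaryPart m) = m := by
  ext ⟨d, μ⟩
  cases d with
  | zero => exact primary_zero_apply _ _
  | succ d =>
    rw [primary_succ_apply]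
    by_contra hne
    have := le_level (Ne.symm hne)
    rw [h] at this
    simp at this

theorem level_primary (m : Fin (n + 2) →₀ ℕ) : level (primary m) = 0 := by
  by_contra h
  have h1 : (primary m).sum (fun v c => c • v.1) ≠ 0 := by
    rwa [level, Finsupp.weight_apply] at h
  obtain ⟨⟨d, μ⟩, hv, hne⟩ := Finset.exists_ne_zero_of_sum_ne_zero h1
  cases d with
  | zero => simp at hne
  | succ d => exact Finsupp.mem_support_iff.1 hv (primary_succ_apply m d μ)

/-- The restriction to `t^{d,μ} = 0` for `d > 0`. -/
def restrictPrimary (K : Type*) [CommRing K] (n : ℕ) :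
    MvPowerSeries (Label n) K →+* MvPowerSeries (Fin (n + 2)) K where
  toFun f := ofCoeff fun m => coeff (primary m) f
  map_zero' := by ext m; rw [coeff_ofCoeff, map_zero, map_zero]
  map_one' := by
    classical
    ext m
    rw [coeff_ofCoeff, coeff_one, coeff_one]
    congr 1
    rw [eq_iff_iff]
    exact primary_injective.eq_iff' Finsupp.mapDomain_zero
  map_add' f g := by ext m; simp only [map_add, coeff_ofCoeff]
  map_mul' f g := by
    classical
    ext m
    rw [coeff_ofCoeff, coeff_mul, coeff_mul]
    refine Finset.sum_bij' (fun p _ => (primaryPart p.1, primaryPart p.2))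
      (fun p _ => (primary p.1, primary p.2)) ?_ ?_ ?_ ?_ ?_
    · intro p hp
      rw [Finset.HasAntidiagonal.mem_antidiagonal] at hp ⊢
      rw [← primaryPart_primary m, ← hp]
      ext μ
      rfl
    · intro p hp
      rw [Finset.HasAntidiagonal.mem_antidiagonal] at hp ⊢
      rw [← hp, primary_add]
    · intro p hp
      rw [Finset.HasAntidiagonal.mem_antidiagonal] at hp
      have h := level_primary m
      rw [← hp, map_add] at h
      simp only
      rw [primary_primaryPart (by omega), primary_primaryPart (by omega)]
    · intro p _
      simp only [primaryPart_primary]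
    · intro p hp
      rw [Finset.HasAntidiagonal.mem_antidiagonal] at hp
      have h := level_primary m
      rw [← hp, map_add] at h
      simp only [coeff_ofCoeff]
      rw [primary_primaryPart (by omega), primary_primaryPart (by omega)]

theorem coeff_restrictPrimary (f : MvPowerSeries (Label n) K) (m : Fin (n + 2) →₀ ℕ) :
    coeff m (restrictPrimary K n f) = coeff (primary m) f := rfl

theorem restrictPrimary_pderiv (μ : Fin (n + 2)) (f : MvPowerSeries (Label n) K) :
    restrictPrimary K n (pderiv K ((0 : ℕ), μ) f) = pderiv K μ (restrictPrimary K n f) := by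
  ext m
  rw [coeff_restrictPrimary, coeff_pderiv, coeff_pderiv, coeff_restrictPrimary, primary_add,
    primary_single, primary_zero_apply]

end Restriction

/-! ### Descendant potentials: truncation by the level -/

section Level

open MvPowerSeries

variable {K : Type*} [CommRing K] {n : ℕ}

/-- The ideal of the power series without terms of level at most `j`. -/
def levelIdeal (K : Type*) [CommRing K] (n j : ℕ) : Ideal (MvPowerSeries (Label n) K) where
  carrier := {f | ∀ m, level m ≤ j → coeff m f = 0}
  add_mem' := fun ha hb m hm => by rw [map_add, ha m hm, hb m hm, add_zero]
  zero_mem' := fun m _ => map_zero _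
  smul_mem' := fun c f hf m hm => by
    classical
    rw [smul_eq_mul, coeff_mul]
    refine Finset.sum_eq_zero fun p hp => ?_
    have h := congrArg level (Finset.HasAntidiagonal.mem_antidiagonal.1 hp)
    rw [map_add] at h
    rw [hf p.2 (by omega), mul_zero]

/-- Truncation of power series after the level `j`. -/
def levelTrunc (K : Type*) [CommRing K] (n j : ℕ) :
    MvPowerSeries (Label n) K →+* MvPowerSeries (Label n) K ⧸ levelIdeal K n j :=
  Ideal.Quotient.mk _

theorem levelTrunc_eq_iff {j : ℕ} {f g : MvPowerSeries (Label n) K} :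
    levelTrunc K n j f = levelTrunc K n j g ↔ ∀ m, level m ≤ j → coeff m f = coeff m g := by
  rw [levelTrunc, Ideal.Quotient.eq]
  refine forall_congr' fun m => imp_congr_right fun _ => ?_
  rw [map_sub, sub_eq_zero]

theorem levelTrunc_pderiv {i j : ℕ} (v : Label n) (h : i + v.1 ≤ j)
    {f g : MvPowerSeries (Label n) K} (hfg : levelTrunc K n j f = levelTrunc K n j g) :
    levelTrunc K n i (pderiv K v f) = levelTrunc K n i (pderiv K v g) := by
  refine levelTrunc_eq_iff.2 fun m hm => ?_
  rw [coeff_pderiv, coeff_pderiv, levelTrunc_eq_iff.1 hfg]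
  rw [map_add, level_single]
  omega

/-- Agreement up to level `j` can be tested on level zero and on the derivatives with respect to
the variables of positive level. -/
theorem levelTrunc_eq_of_pderiv {𝕜 : Type*} [Field 𝕜] [CharZero 𝕜] {j : ℕ}
    {f g : MvPowerSeries (Label n) 𝕜}
    (h0 : levelTrunc 𝕜 n 0 f = levelTrunc 𝕜 n 0 g)
    (h : ∀ (d : ℕ) (α : Fin (n + 2)) (i : ℕ), i + (d + 1) = j →
      levelTrunc 𝕜 n i (pderiv 𝕜 (d + 1, α) f) = levelTrunc 𝕜 n i (pderiv 𝕜 (d + 1, α) g)) :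
    levelTrunc 𝕜 n j f = levelTrunc 𝕜 n j g := by
  refine levelTrunc_eq_iff.2 fun m hm => ?_
  by_cases hm0 : level m = 0
  · exact levelTrunc_eq_iff.1 h0 m hm0.le
  · obtain ⟨⟨d, α⟩, hv, hne⟩ := Finset.exists_ne_zero_of_sum_ne_zero
      (by rwa [level, Finsupp.weight_apply] at hm0 : m.sum (fun v c => c • v.1) ≠ 0)
    obtain ⟨d, rfl⟩ : ∃ d', d = d' + 1 :=
      Nat.exists_eq_succ_of_ne_zero (by rintro rfl; simp at hne)
    have hv' := Finsupp.mem_support_iff.1 hv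
    have hle := le_level hv'
    have hm' := sub_single_add hv'
    have hlev := congrArg level hm'
    rw [map_add, level_single] at hlev
    have h1 := levelTrunc_eq_iff.1 (h d α (j - (d + 1)) (by simp only at hle; omega))
      (m - Finsupp.single (d + 1, α) 1) (by simp only at hlev; omega)
    rw [coeff_pderiv, coeff_pderiv, hm'] at h1
    exact mul_right_cancel₀ (Nat.cast_add_one_ne_zero _) h1

/-- The third derivatives of a potential. -/
def thirdD (F : MvPowerSeries (Label n) K) (a b c : Label n) : MvPowerSeries (Label n) K :=
  pderiv K a (pderiv K b (pderiv K c F))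

theorem thirdD_swap_left (F : MvPowerSeries (Label n) K) (a b c : Label n) :
    thirdD F a b c = thirdD F b a c := pderiv_comm _ _ _

theorem thirdD_swap_right (F : MvPowerSeries (Label n) K) (a b c : Label n) :
    thirdD F a b c = thirdD F a c b := by
  rw [thirdD, thirdD, pderiv_comm b c]

theorem thirdD_rotate (F : MvPowerSeries (Label n) K) (a b c : Label n) :
    thirdD F a b c = thirdD F b c a := by
  rw [thirdD_swap_left, thirdD_swap_right]

theorem thirdD_reverse (F : MvPowerSeries (Label n) K) (a b c : Label n) :
    thirdD F a b c = thirdD F c b a := by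
  rw [thirdD_rotate, thirdD_swap_left]

theorem pderiv_thirdD (F : MvPowerSeries (Label n) K) (u a b c : Label n) :
    pderiv K u (thirdD F a b c) = pderiv K c (thirdD F u a b) := by
  rw [thirdD, thirdD, pderiv_comm b c, pderiv_comm a c, pderiv_comm u c]

/-- The contraction `∑ ∂_a ∂_b ∂_λ F η^{λσ} ∂_σ ∂_c ∂_e F`, with `λ`, `σ` of level zero. -/
def wdvvSum (F : MvPowerSeries (Label n) K) (a b c e : Label n) : MvPowerSeries (Label n) K :=
  ∑ l : Fin (n + 2), thirdD F a b (0, l) * thirdD F (0, l.rev) c e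

/-- The right hand side `∑ ∂_u ∂_λ F η^{λσ} ∂_σ ∂_v ∂_w F` of the topological recursion relation. -/
def trrSum (F : MvPowerSeries (Label n) K) (u v w : Label n) : MvPowerSeries (Label n) K :=
  ∑ l : Fin (n + 2), pderiv K u (pderiv K (0, l) F) * thirdD F (0, l.rev) v w

theorem trrSum_swap (F : MvPowerSeries (Label n) K) (u v w : Label n) :
    trrSum F u v w = trrSum F u w v :=
  Finset.sum_congr rfl fun l _ => by rw [thirdD_swap_right]

theorem sum_rev {M : Type*} [AddCommMonoid M] (f : Fin (n + 2) → M) :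
    ∑ l, f l = ∑ l : Fin (n + 2), f l.rev :=
  (Equiv.sum_comp Fin.revPerm f).symm

theorem wdvvSum_swap (F : MvPowerSeries (Label n) K) (a b c e : Label n) :
    wdvvSum F a b c e = wdvvSum F c e a b := by
  rw [wdvvSum, wdvvSum, sum_rev]
  refine Finset.sum_congr rfl fun l _ => ?_
  rw [Fin.rev_rev, mul_comm, thirdD_rotate F (0, l) c e, ← thirdD_rotate F (0, l.rev) a b]

theorem wdvvSum_swap_left (F : MvPowerSeries (Label n) K) (a b c e : Label n) :
    wdvvSum F a b c e = wdvvSum F b a c e :=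
  Finset.sum_congr rfl fun l _ => by rw [thirdD_swap_left]

theorem wdvvSum_swap_right (F : MvPowerSeries (Label n) K) (a b c e : Label n) :
    wdvvSum F a b c e = wdvvSum F a b e c :=
  Finset.sum_congr rfl fun l _ => by rw [thirdD_swap_right F (0, l.rev)]

/-- The topological recursion relation for the coefficients of total level at most `k`. -/
def TRRUpTo (F : MvPowerSeries (Label n) K) (k : ℕ) : Prop :=
  ∀ (d : ℕ) (α : Fin (n + 2)) (v w : Label n) (j : ℕ), d + 1 + v.1 + w.1 + j ≤ k →
    levelTrunc K n j (thirdD F (d + 1, α) v w) = levelTrunc K n j (trrSum F (d, α) v w)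

/-- The WDVV equations on the big phase space, for the coefficients of total level at most `k`. -/
def WDVVUpTo (F : MvPowerSeries (Label n) K) (k : ℕ) : Prop :=
  ∀ (a b c e : Label n) (j : ℕ), a.1 + b.1 + c.1 + e.1 + j ≤ k →
    levelTrunc K n j (wdvvSum F a b c e) = levelTrunc K n j (wdvvSum F a c b e)

/-- A descendant in one of the slots of a WDVV sum is removed by topological recursion. -/
theorem levelTrunc_wdvvSum_succ {F : MvPowerSeries (Label n) K} {k : ℕ} (hF : TRRUpTo F k)
    (d : ℕ) (α : Fin (n + 2)) (b c e : Label n) (j : ℕ) (h : d + 1 + b.1 + j ≤ k) :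
    levelTrunc K n j (wdvvSum F (d + 1, α) b c e) =
      ∑ ρ : Fin (n + 2), levelTrunc K n j (pderiv K (d, α) (pderiv K (0, ρ) F)) *
        levelTrunc K n j (wdvvSum F (0, ρ.rev) b c e) := by
  have h1 : ∀ l : Fin (n + 2), levelTrunc K n j (thirdD F (d + 1, α) b (0, l)) =
      levelTrunc K n j (trrSum F (d, α) b (0, l)) := fun l => hF d α b (0, l) j (by simpa using h)
  simp only [wdvvSum, trrSum, map_sum, map_mul, h1, Finset.sum_mul, Finset.mul_sum, mul_assoc]
  rw [Finset.sum_comm]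

/-- The associativity relation for three-fold contractions, with an arbitrary label `u` in the
middle. -/
theorem levelTrunc_triple {F : MvPowerSeries (Label n) K} {k : ℕ} (hF : WDVVUpTo F k)
    (u a b c e : Label n) (j : ℕ) (h : u.1 + a.1 + b.1 + c.1 + e.1 + j ≤ k) :
    ∑ l : Fin (n + 2), levelTrunc K n j (wdvvSum F a b u (0, l)) *
        levelTrunc K n j (thirdD F (0, l.rev) c e) =
      ∑ l : Fin (n + 2), levelTrunc K n j (wdvvSum F a c u (0, l)) *
        levelTrunc K n j (thirdD F (0, l.rev) b e) := by
  have assoc : ∀ b c : Label n,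
      ∑ l : Fin (n + 2), levelTrunc K n j (wdvvSum F a u b (0, l)) *
        levelTrunc K n j (thirdD F (0, l.rev) c e) =
      ∑ ρ : Fin (n + 2), levelTrunc K n j (thirdD F a u (0, ρ)) *
        levelTrunc K n j (wdvvSum F (0, ρ.rev) b c e) := by
    intro b c
    simp only [wdvvSum, map_sum, map_mul, Finset.sum_mul, Finset.mul_sum, mul_assoc]
    rw [Finset.sum_comm]
  have h1 : ∀ l : Fin (n + 2), levelTrunc K n j (wdvvSum F a b u (0, l)) =
      levelTrunc K n j (wdvvSum F a u b (0, l)) := fun l => hF _ _ _ _ _ (by simp only; omega)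
  have h2 : ∀ l : Fin (n + 2), levelTrunc K n j (wdvvSum F a c u (0, l)) =
      levelTrunc K n j (wdvvSum F a u c (0, l)) := fun l => hF _ _ _ _ _ (by simp only; omega)
  have h3 : ∀ ρ : Fin (n + 2), levelTrunc K n j (wdvvSum F (0, ρ.rev) b c e) =
      levelTrunc K n j (wdvvSum F (0, ρ.rev) c b e) :=
    fun ρ => hF _ _ _ _ _ (by simp only; omega)
  rw [Finset.sum_congr rfl fun l _ => by rw [h1 l], assoc,
    Finset.sum_congr rfl fun l _ => by rw [h3 l], ← assoc,
    Finset.sum_congr rfl fun l _ => by rw [← h2 l]]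

/-- The derivative of a WDVV sum in a descendant direction, by topological recursion. -/
theorem levelTrunc_pderiv_wdvvSum {F : MvPowerSeries (Label n) K} {k : ℕ} (hF : TRRUpTo F k)
    (d : ℕ) (α : Fin (n + 2)) (a b c e : Label n) (j : ℕ)
    (h : d + 1 + a.1 + b.1 + c.1 + e.1 + j ≤ k) :
    levelTrunc K n j (pderiv K (d + 1, α) (wdvvSum F a b c e)) =
      (2 : ℕ) • ∑ l : Fin (n + 2), levelTrunc K n j (wdvvSum F a b (d, α) (0, l)) *
        levelTrunc K n j (thirdD F (0, l.rev) c e) +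
      ∑ ρ : Fin (n + 2), levelTrunc K n j (pderiv K (d, α) (pderiv K (0, ρ) F)) *
        levelTrunc K n j (pderiv K (0, ρ.rev) (wdvvSum F a b c e)) := by
  -- the recursion relation, differentiated in a primary direction
  have h1 : ∀ (a b : Label n) (l : Fin (n + 2)), d + 1 + a.1 + b.1 + j ≤ k →
      levelTrunc K n j (pderiv K (d + 1, α) (thirdD F a b (0, l))) =
      ∑ ρ : Fin (n + 2), (levelTrunc K n j (thirdD F (0, l) (d, α) (0, ρ)) *
          levelTrunc K n j (thirdD F (0, ρ.rev) a b) +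
        levelTrunc K n j (pderiv K (d, α) (pderiv K (0, ρ) F)) *
          levelTrunc K n j (pderiv K (0, ρ.rev) (thirdD F a b (0, l)))) := by
    intro a b l hab
    rw [pderiv_thirdD, levelTrunc_pderiv (0, l) le_rfl (hF d α a b _ (by simpa using hab)),
      trrSum, map_sum, map_sum]
    refine Finset.sum_congr rfl fun ρ _ => ?_
    rw [Derivation.leibniz, smul_eq_mul, smul_eq_mul, map_add, map_mul, map_mul,
      pderiv_thirdD F (0, ρ.rev) a b (0, l), add_comm, mul_comm]
    rfl
  have h2 : ∀ l : Fin (n + 2),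
      levelTrunc K n j (pderiv K (d + 1, α) (thirdD F (0, l.rev) c e)) =
      ∑ ρ : Fin (n + 2), (levelTrunc K n j (thirdD F (0, l.rev) (d, α) (0, ρ)) *
          levelTrunc K n j (thirdD F (0, ρ.rev) c e) +
        levelTrunc K n j (pderiv K (d, α) (pderiv K (0, ρ) F)) *
          levelTrunc K n j (pderiv K (0, ρ.rev) (thirdD F (0, l.rev) c e))) := by
    intro l
    rw [thirdD_rotate F (0, l.rev) c e]
    exact h1 c e l.rev (by omega)
  -- The terms with three third derivatives, from the first and from the second factor, agree after
  -- relabelling the summation indices.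
  have e1 : ∑ l : Fin (n + 2), ∑ ρ : Fin (n + 2),
        levelTrunc K n j (thirdD F (0, l) (d, α) (0, ρ)) *
          levelTrunc K n j (thirdD F (0, ρ.rev) a b) *
          levelTrunc K n j (thirdD F (0, l.rev) c e) =
      ∑ l : Fin (n + 2), levelTrunc K n j (wdvvSum F a b (d, α) (0, l)) *
        levelTrunc K n j (thirdD F (0, l.rev) c e) := by
    refine Finset.sum_congr rfl fun l _ => ?_
    rw [wdvvSum, map_sum, ← Finset.sum_mul, sum_rev]
    congr 1
    refine Finset.sum_congr rfl fun ρ _ => ?_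
    rw [map_mul, Fin.rev_rev, mul_comm, ← thirdD_rotate F (0, ρ) a b,
      thirdD_reverse F (0, ρ.rev) (d, α) (0, l)]
  have e2 : ∑ l : Fin (n + 2), ∑ ρ : Fin (n + 2),
        levelTrunc K n j (thirdD F a b (0, l)) *
          (levelTrunc K n j (thirdD F (0, l.rev) (d, α) (0, ρ)) *
          levelTrunc K n j (thirdD F (0, ρ.rev) c e)) =
      ∑ l : Fin (n + 2), levelTrunc K n j (wdvvSum F a b (d, α) (0, l)) *
        levelTrunc K n j (thirdD F (0, l.rev) c e) := by
    rw [Finset.sum_comm]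
    refine Finset.sum_congr rfl fun l _ => ?_
    rw [wdvvSum, map_sum, Finset.sum_mul]
    refine Finset.sum_congr rfl fun ρ _ => ?_
    rw [map_mul, mul_assoc]
  -- The other terms are a primary derivative of the contraction, by the Leibniz rule.
  have e3 : ∑ l : Fin (n + 2), ∑ ρ : Fin (n + 2),
        (levelTrunc K n j (pderiv K (d, α) (pderiv K (0, ρ) F)) *
          levelTrunc K n j (pderiv K (0, ρ.rev) (thirdD F a b (0, l))) *
          levelTrunc K n j (thirdD F (0, l.rev) c e) +
        levelTrunc K n j (thirdD F a b (0, l)) *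
          (levelTrunc K n j (pderiv K (d, α) (pderiv K (0, ρ) F)) *
          levelTrunc K n j (pderiv K (0, ρ.rev) (thirdD F (0, l.rev) c e)))) =
      ∑ ρ : Fin (n + 2), levelTrunc K n j (pderiv K (d, α) (pderiv K (0, ρ) F)) *
        levelTrunc K n j (pderiv K (0, ρ.rev) (wdvvSum F a b c e)) := by
    rw [Finset.sum_comm]
    refine Finset.sum_congr rfl fun ρ _ => ?_
    rw [wdvvSum, map_sum, map_sum, Finset.mul_sum]
    refine Finset.sum_congr rfl fun l _ => ?_
    rw [Derivation.leibniz, smul_eq_mul, smul_eq_mul, map_add, map_mul, map_mul]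
    ring
  rw [two_nsmul]
  nth_rewrite 1 [← e1]
  rw [← e2, ← e3, ← Finset.sum_add_distrib, ← Finset.sum_add_distrib, wdvvSum, map_sum, map_sum]
  refine Finset.sum_congr rfl fun l _ => ?_
  rw [Derivation.leibniz, smul_eq_mul, smul_eq_mul, map_add, map_mul, map_mul,
    h1 a b l (by omega), h2 l, Finset.mul_sum, Finset.mul_sum, ← Finset.sum_add_distrib,
    ← Finset.sum_add_distrib, ← Finset.sum_add_distrib]
  refine Finset.sum_congr rfl fun ρ _ => ?_
  ring

/-- The WDVV equations on the big phase space follow from the topological recursion relation and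
the WDVV equations on the small phase space. -/
theorem wdvvUpTo_of_trrUpTo {𝕜 : Type*} [Field 𝕜] [CharZero 𝕜] {F : MvPowerSeries (Label n) 𝕜}
    {k : ℕ} (hF : TRRUpTo F k)
    (h0 : ∀ a b c e : Fin (n + 2), levelTrunc 𝕜 n 0 (wdvvSum F (0, a) (0, b) (0, c) (0, e)) =
      levelTrunc 𝕜 n 0 (wdvvSum F (0, a) (0, c) (0, b) (0, e))) :
    WDVVUpTo F k := by
  suffices H : ∀ i ≤ k, WDVVUpTo F i from H k le_rfl
  intro i
  induction i with
  | zero =>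
    rintro _ ⟨a0, a⟩ ⟨b0, b⟩ ⟨c0, c⟩ ⟨e0, e⟩ j h
    simp only at h
    obtain ⟨rfl, rfl, rfl, rfl, rfl⟩ : a0 = 0 ∧ b0 = 0 ∧ c0 = 0 ∧ e0 = 0 ∧ j = 0 := by omega
    exact h0 a b c e
  | succ i ih =>
    intro hi
    replace ih := ih (by omega)
    -- the case of a descendant in the first slot
    have first : ∀ (d : ℕ) (α : Fin (n + 2)) (b c e : Label n) (j : ℕ),
        d + 1 + b.1 + c.1 + e.1 + j ≤ i + 1 →
        levelTrunc 𝕜 n j (wdvvSum F (d + 1, α) b c e) =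
          levelTrunc 𝕜 n j (wdvvSum F (d + 1, α) c b e) := by
      intro d α b c e j h
      rw [levelTrunc_wdvvSum_succ hF d α b c e j (by omega),
        levelTrunc_wdvvSum_succ hF d α c b e j (by omega)]
      refine Finset.sum_congr rfl fun ρ _ => ?_
      rw [ih (0, ρ.rev) b c e j (by simp only; omega)]
    rintro ⟨a0, a⟩ ⟨b0, b⟩ ⟨c0, c⟩ ⟨e0, e⟩ j h
    simp only at h
    rcases a0 with _ | a0
    swap
    · exact first a0 a (b0, b) (c0, c) (e0, e) j (by simp only; omega)
    rcases b0 with _ | b0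
    swap
    · rw [wdvvSum_swap_left, wdvvSum_swap_right, first b0 b _ _ _ j (by simp only; omega),
        wdvvSum_swap]
    rcases c0 with _ | c0
    swap
    · rw [wdvvSum_swap, first c0 c _ _ _ j (by simp only; omega), wdvvSum_swap_left,
        wdvvSum_swap_right]
    rcases e0 with _ | e0
    swap
    · rw [wdvvSum_swap, wdvvSum_swap_left, wdvvSum_swap_right,
        first e0 e _ _ _ j (by simp only; omega), wdvvSum_swap, wdvvSum_swap_left,
        wdvvSum_swap_right]
    -- All four insertions are primary: induct on the level by a descendant derivative, which the
    -- recursion relation turns into primary derivatives and triple products.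
    refine levelTrunc_eq_of_pderiv (h0 a b c e) fun d α j' hj => ?_
    have hd : ∀ ρ : Fin (n + 2),
        levelTrunc 𝕜 n j' (pderiv 𝕜 (0, ρ.rev) (wdvvSum F (0, a) (0, b) (0, c) (0, e))) =
        levelTrunc 𝕜 n j' (pderiv 𝕜 (0, ρ.rev) (wdvvSum F (0, a) (0, c) (0, b) (0, e))) :=
      fun ρ => levelTrunc_pderiv _ le_rfl (ih _ _ _ _ _ (by simp only; omega))
    rw [levelTrunc_pderiv_wdvvSum hF d α _ _ _ _ j' (by simp only; omega),
      levelTrunc_pderiv_wdvvSum hF d α _ _ _ _ j' (by simp only; omega),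
      levelTrunc_triple ih (d, α) (0, a) (0, b) (0, c) (0, e) j' (by simp only; omega)]
    simp only [hd]

end Level


/-! ### Descendant potentials: existence and uniqueness -/

section Reconstruction

open MvPowerSeries

variable {K : Type*} [Field K] {n : ℕ}

/-- The correlator of a monomial: its coefficient, multiplied by the factorials of the
exponents. -/
def correlator {σ : Type*} (f : MvPowerSeries σ K) (m : σ →₀ ℕ) : K :=
  (m.prod fun _ c => (c.factorial : K)) * coeff m f

theorem levelTrunc_trrSum {F G : MvPowerSeries (Label n) K} {k j : ℕ} {u v w : Label n}
    (h : levelTrunc K n k F = levelTrunc K n k G) (hj : j + u.1 + v.1 + w.1 ≤ k) :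
    levelTrunc K n j (trrSum F u v w) = levelTrunc K n j (trrSum G u v w) := by
  have h1 : ∀ l : Fin (n + 2), levelTrunc K n j (pderiv K u (pderiv K (0, l) F)) =
      levelTrunc K n j (pderiv K u (pderiv K (0, l) G)) := fun l =>
    levelTrunc_pderiv u (j := j + u.1) le_rfl
      (levelTrunc_pderiv (0, l) (j := k) (by simp only; omega) h)
  have h2 : ∀ l : Fin (n + 2), levelTrunc K n j (thirdD F (0, l) v w) =
      levelTrunc K n j (thirdD G (0, l) v w) := fun l =>
    levelTrunc_pderiv (0, l) (j := j) le_rfl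
      (levelTrunc_pderiv v (j := j + v.1) le_rfl (levelTrunc_pderiv w (j := k) (by omega) h))
  simp only [trrSum, map_sum, map_mul, h1, h2]

/-- Two descendants may be exchanged, since both recursions lead to the same double sum. -/
theorem levelTrunc_trrSum_exchange {F : MvPowerSeries (Label n) K} {k : ℕ} (hF : TRRUpTo F k)
    (d d' : ℕ) (α α' : Fin (n + 2)) (w : Label n) (j : ℕ) (h : d + d' + 1 + w.1 + j ≤ k) :
    levelTrunc K n j (trrSum F (d, α) (d' + 1, α') w) =
      levelTrunc K n j (trrSum F (d', α') (d + 1, α) w) := by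
  have key : ∀ (d d' : ℕ) (α α' : Fin (n + 2)), d + d' + 1 + w.1 + j ≤ k →
      levelTrunc K n j (trrSum F (d, α) (d' + 1, α') w) =
      ∑ l : Fin (n + 2), ∑ ρ : Fin (n + 2),
        levelTrunc K n j (pderiv K (d, α) (pderiv K (0, l) F)) *
        (levelTrunc K n j (pderiv K (d', α') (pderiv K (0, ρ) F)) *
        levelTrunc K n j (thirdD F (0, ρ.rev) (0, l.rev) w)) := by
    intro d d' α α' h
    rw [trrSum, map_sum]
    refine Finset.sum_congr rfl fun l _ => ?_
    rw [map_mul, thirdD_swap_left, hF d' α' (0, l.rev) w j (by simp only; omega), trrSum, map_sum,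
      Finset.mul_sum]
    simp only [map_mul]
  rw [key d d' α α' h, key d' d α' α (by omega), Finset.sum_comm]
  refine Finset.sum_congr rfl fun l _ => Finset.sum_congr rfl fun ρ _ => ?_
  rw [thirdD_swap_left]
  ring

/-- A genus zero potential whose coefficients of level at most `k` satisfy the topological
recursion relation. -/
structure IsPotentialUpTo (f : MvPowerSeries (Fin (n + 2)) K) (F : MvPowerSeries (Label n) K)
    (k : ℕ) : Prop where
  stable : ∀ m : Label n →₀ ℕ, m.degree < 3 → coeff m F = 0
  restrict : ∀ m : Fin (n + 2) →₀ ℕ, 3 ≤ m.degree → coeff (primary m) F = coeff m f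
  trr : TRRUpTo F k

theorem IsPotentialUpTo.mono {f : MvPowerSeries (Fin (n + 2)) K} {F : MvPowerSeries (Label n) K}
    {i k : ℕ} (hF : IsPotentialUpTo f F k) (h : i ≤ k) : IsPotentialUpTo f F i :=
  ⟨hF.stable, hF.restrict, fun d α v w j hj => hF.trr d α v w j (hj.trans h)⟩

/-- The WDVV equations for a formal potential on the small phase space. -/
def FormalWDVV (f : MvPowerSeries (Fin (n + 2)) K) : Prop :=
  ∀ a b c e : Fin (n + 2),
    ∑ l : Fin (n + 2), pderiv K a (pderiv K b (pderiv K l f)) *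
        pderiv K l.rev (pderiv K c (pderiv K e f)) =
      ∑ l : Fin (n + 2), pderiv K a (pderiv K c (pderiv K l f)) *
        pderiv K l.rev (pderiv K b (pderiv K e f))

theorem restrictPrimary_thirdD {f : MvPowerSeries (Fin (n + 2)) K}
    {F : MvPowerSeries (Label n) K}
    (h : ∀ m : Fin (n + 2) →₀ ℕ, 3 ≤ m.degree → coeff (primary m) F = coeff m f)
    (a b c : Fin (n + 2)) :
    restrictPrimary K n (thirdD F (0, a) (0, b) (0, c)) =
      pderiv K a (pderiv K b (pderiv K c f)) := by
  ext m
  rw [thirdD, restrictPrimary_pderiv, restrictPrimary_pderiv, restrictPrimary_pderiv]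
  simp only [coeff_pderiv]
  rw [coeff_restrictPrimary, h]
  simp only [map_add, Finsupp.degree_single]
  omega

theorem levelTrunc_zero_of_restrictPrimary {f g : MvPowerSeries (Label n) K}
    (h : restrictPrimary K n f = restrictPrimary K n g) :
    levelTrunc K n 0 f = levelTrunc K n 0 g := by
  refine levelTrunc_eq_iff.2 fun m hm => ?_
  rw [← primary_primaryPart (Nat.le_zero.1 hm), ← coeff_restrictPrimary, h,
    coeff_restrictPrimary]

theorem prod_factorial_add_single {σ : Type*} (m : σ →₀ ℕ) (v : σ) :
    ((m + Finsupp.single v 1).prod fun _ c => (c.factorial : K)) =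
      (m.prod fun _ c => (c.factorial : K)) * ((m v : K) + 1) := by
  classical
  have h1 := Finsupp.mul_prod_erase' m v (fun _ c => (c.factorial : K)) fun _ => by simp
  have h2 := Finsupp.mul_prod_erase' (m + Finsupp.single v 1) v (fun _ c => (c.factorial : K))
    fun _ => by simp
  rw [Finsupp.erase_add, Finsupp.erase_single, add_zero] at h2
  rw [← h1, ← h2, Finsupp.add_apply, Finsupp.single_eq_same, Nat.factorial_succ]
  push_cast
  ring

theorem correlator_pderiv {σ : Type*} (v : σ) (f : MvPowerSeries σ K) (m : σ →₀ ℕ) :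
    correlator (pderiv K v f) m = correlator f (m + Finsupp.single v 1) := by
  rw [correlator, correlator, coeff_pderiv, prod_factorial_add_single]
  ring

theorem correlator_thirdD (F : MvPowerSeries (Label n) K) (a b c : Label n)
    (r : Label n →₀ ℕ) :
    correlator (thirdD F a b c) r =
      correlator F (r + Finsupp.single a 1 + Finsupp.single b 1 + Finsupp.single c 1) := by
  rw [thirdD, correlator_pderiv, correlator_pderiv, correlator_pderiv]

variable [CharZero K]

theorem prod_factorial_ne_zero {σ : Type*} (m : σ →₀ ℕ) :
    (m.prod fun _ c => (c.factorial : K)) ≠ 0 :=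
  Finset.prod_ne_zero_iff.2 fun _ _ => Nat.cast_ne_zero.2 (Nat.factorial_ne_zero _)

theorem correlator_injective {σ : Type*} {f g : MvPowerSeries σ K} {m : σ →₀ ℕ}
    (h : correlator f m = correlator g m) : coeff m f = coeff m g :=
  mul_left_cancel₀ (prod_factorial_ne_zero m) h

theorem levelTrunc_eq_iff_correlator {j : ℕ} {f g : MvPowerSeries (Label n) K} :
    levelTrunc K n j f = levelTrunc K n j g ↔
      ∀ m, level m ≤ j → correlator f m = correlator g m :=
  levelTrunc_eq_iff.trans ⟨fun h m hm => by rw [correlator, correlator, h m hm],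
    fun h m hm => correlator_injective (h m hm)⟩

/-- A monomial of degree at least three, divisible by the variable `v`, contains two more
variables. -/
theorem exists_eq_add_three {m : Label n →₀ ℕ} {v : Label n} (hv : m v ≠ 0)
    (h : 3 ≤ m.degree) :
    ∃ (r : Label n →₀ ℕ) (a b : Label n),
      m = r + Finsupp.single a 1 + Finsupp.single b 1 + Finsupp.single v 1 := by
  have split : ∀ m : Label n →₀ ℕ, m.degree ≠ 0 → ∃ r a, m = r + Finsupp.single a 1 := by
    intro m hm
    obtain ⟨a, ha⟩ : ∃ a, m a ≠ 0 := by
      by_contra! h0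
      exact hm (by rw [show m = 0 from Finsupp.ext h0, map_zero])
    exact ⟨_, a, (sub_single_add ha).symm⟩
  have h1 := (sub_single_add hv).symm
  have d1 := congrArg Finsupp.degree h1
  rw [map_add, Finsupp.degree_single] at d1
  obtain ⟨r1, b, h2⟩ := split (m - Finsupp.single v 1) (by omega)
  have d2 := congrArg Finsupp.degree h2
  rw [map_add, Finsupp.degree_single] at d2
  obtain ⟨r, a, h3⟩ := split r1 (by omega)
  exact ⟨r, a, b, by rw [← h3, ← h2, ← h1]⟩

/-- A monomial of positive level and of degree at least three, as it occurs in the topological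
recursion relation. -/
theorem exists_eq_of_level_ne_zero {m : Label n →₀ ℕ} (hl : level m ≠ 0) (h : 3 ≤ m.degree) :
    ∃ (d : ℕ) (α : Fin (n + 2)) (v w : Label n) (r : Label n →₀ ℕ),
      m = r + Finsupp.single w 1 + Finsupp.single v 1 + Finsupp.single (d + 1, α) 1 := by
  obtain ⟨⟨d, α⟩, hv, hne⟩ := Finset.exists_ne_zero_of_sum_ne_zero
    (by rwa [level, Finsupp.weight_apply] at hl : m.sum (fun v c => c • v.1) ≠ 0)
  obtain ⟨d, rfl⟩ : ∃ d', d = d' + 1 :=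
    Nat.exists_eq_succ_of_ne_zero (by rintro rfl; simp at hne)
  obtain ⟨r, a, b, hr⟩ := exists_eq_add_three (Finsupp.mem_support_iff.1 hv) h
  exact ⟨d, α, b, a, r, hr⟩

theorem level_add_three (d : ℕ) (α : Fin (n + 2)) (v w : Label n) (r : Label n →₀ ℕ) :
    level (r + Finsupp.single w 1 + Finsupp.single v 1 + Finsupp.single (d + 1, α) 1) =
      level r + w.1 + v.1 + (d + 1) := by
  simp only [map_add, level_single, one_mul]

theorem trrUpTo_iff {F : MvPowerSeries (Label n) K} {k : ℕ} :
    TRRUpTo F k ↔ ∀ (d : ℕ) (α : Fin (n + 2)) (v w : Label n) (r : Label n →₀ ℕ),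
      level r + w.1 + v.1 + (d + 1) ≤ k →
      correlator F
          (r + Finsupp.single w 1 + Finsupp.single v 1 + Finsupp.single (d + 1, α) 1) =
        correlator (trrSum F (d, α) v w) r := by
  constructor
  · intro h d α v w r hk
    have := levelTrunc_eq_iff_correlator.1 (h d α v w (level r) (by omega)) r le_rfl
    rw [thirdD_reverse, correlator_thirdD] at this
    exact this
  · intro h d α v w j hk
    refine levelTrunc_eq_iff_correlator.2 fun r hr => ?_
    rw [thirdD_reverse, correlator_thirdD, h d α v w r (by omega)]

/-- The topological recursion relation determines the coefficients of positive level. -/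
theorem IsPotentialUpTo.levelTrunc_eq {f : MvPowerSeries (Fin (n + 2)) K}
    {F G : MvPowerSeries (Label n) K} {k : ℕ} (hF : IsPotentialUpTo f F k)
    (hG : IsPotentialUpTo f G k) : levelTrunc K n k F = levelTrunc K n k G := by
  induction k with
  | zero =>
    refine levelTrunc_eq_iff.2 fun m hm => ?_
    by_cases hd : m.degree < 3
    · rw [hF.stable m hd, hG.stable m hd]
    · rw [← primary_primaryPart (Nat.le_zero.1 hm)] at hd ⊢
      rw [degree_primary] at hd
      rw [hF.restrict _ (by omega), hG.restrict _ (by omega)]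
  | succ k ih =>
    have hk := ih (hF.mono (by omega)) (hG.mono (by omega))
    refine levelTrunc_eq_iff.2 fun m hm => ?_
    by_cases hmk : level m ≤ k
    · exact levelTrunc_eq_iff.1 hk m hmk
    by_cases hd : m.degree < 3
    · rw [hF.stable m hd, hG.stable m hd]
    obtain ⟨d, α, v, w, r, rfl⟩ := exists_eq_of_level_ne_zero (by omega) (by omega : 3 ≤ m.degree)
    rw [level_add_three] at hm
    refine correlator_injective ?_
    rw [trrUpTo_iff.1 hF.trr d α v w r hm, trrUpTo_iff.1 hG.trr d α v w r hm]
    exact levelTrunc_eq_iff_correlator.1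
      (levelTrunc_trrSum hk (j := level r) (by simp only; omega)) r le_rfl

/-- In the right hand side of the topological recursion relation the insertions `w` and `x` may be
exchanged: this is the WDVV equation on the big phase space. -/
theorem correlator_trrSum_exchange {F : MvPowerSeries (Label n) K} {k : ℕ} (hF : WDVVUpTo F k)
    (u v w x : Label n) (r : Label n →₀ ℕ) (h : u.1 + v.1 + w.1 + x.1 + level r ≤ k) :
    correlator (trrSum F u v w) (r + Finsupp.single x 1) =
      correlator (trrSum F u v x) (r + Finsupp.single w 1) := by
  have hd : ∀ x w : Label n, pderiv K x (trrSum F u v w) = wdvvSum F u x w v +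
      ∑ l : Fin (n + 2), pderiv K u (pderiv K (0, l) F) *
        pderiv K (0, l.rev) (pderiv K v (pderiv K x (pderiv K w F))) := by
    intro x w
    rw [trrSum, map_sum, wdvvSum, ← Finset.sum_add_distrib]
    refine Finset.sum_congr rfl fun l _ => ?_
    rw [Derivation.leibniz, smul_eq_mul, smul_eq_mul, thirdD_swap_right F (0, l.rev) w v,
      thirdD_swap_left F u x, add_comm]
    congr 1
    · rw [thirdD, thirdD, mul_comm]
    · rw [thirdD, pderiv_comm x, pderiv_comm x v]
  rw [← correlator_pderiv, ← correlator_pderiv]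
  refine levelTrunc_eq_iff_correlator.1 ?_ r le_rfl
  rw [hd x w, hd w x, map_add, map_add, hF u x w v (level r) (by omega)]
  simp only [pderiv_comm x w]

theorem correlator_trrSum_eq_of_add {F : MvPowerSeries (Label n) K} {k : ℕ} (hF : WDVVUpTo F k)
    (u v : Label n) {w w' : Label n} {r r' : Label n →₀ ℕ}
    (h : u.1 + v.1 + w.1 + level r ≤ k)
    (e : r + Finsupp.single w 1 = r' + Finsupp.single w' 1) :
    correlator (trrSum F u v w) r = correlator (trrSum F u v w') r' := by
  by_cases hw : w = w'
  · subst hw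
    rw [add_right_cancel e]
  · have hr : r w' ≠ 0 := by
      have := DFunLike.congr_fun e w'
      simp only [Finsupp.add_apply, Finsupp.single_eq_same,
        Finsupp.single_eq_of_ne (Ne.symm hw)] at this
      omega
    have hr0 := sub_single_add hr
    generalize r - Finsupp.single w' 1 = s at hr0
    subst hr0
    obtain rfl : s + Finsupp.single w 1 = r' :=
      add_right_cancel (b := Finsupp.single w' 1) (by rw [← e]; abel)
    rw [map_add, level_single, one_mul] at h
    exact correlator_trrSum_exchange hF u v w w' s (by omega)

theorem correlator_trrSum_eq_of_add_add {F : MvPowerSeries (Label n) K} {k : ℕ}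
    (hF : WDVVUpTo F k) (u : Label n) {v v' w w' : Label n} {r r' : Label n →₀ ℕ}
    (h : u.1 + v.1 + w.1 + level r ≤ k)
    (e : r + Finsupp.single w 1 + Finsupp.single v 1 =
      r' + Finsupp.single w' 1 + Finsupp.single v' 1) :
    correlator (trrSum F u v w) r = correlator (trrSum F u v' w') r' := by
  by_cases hv : v = v'
  · subst hv
    exact correlator_trrSum_eq_of_add hF u v h (add_right_cancel e)
  · have hr : (r + Finsupp.single w 1 : Label n →₀ ℕ) v' ≠ 0 := by
      have := DFunLike.congr_fun e v'
      rw [Finsupp.add_apply, Finsupp.add_apply _ (Finsupp.single v' 1), Finsupp.single_eq_same,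
        Finsupp.single_eq_of_ne (Ne.symm hv)] at this
      omega
    have hs := (sub_single_add hr).symm
    generalize r + Finsupp.single w 1 - Finsupp.single v' 1 = s at hs
    have hlev := congrArg level hs
    rw [map_add, map_add, level_single, level_single, one_mul, one_mul] at hlev
    rw [correlator_trrSum_eq_of_add hF u v h hs, trrSum_swap]
    refine correlator_trrSum_eq_of_add hF u v' (by omega)
      (add_right_cancel (b := Finsupp.single v' 1) ?_)
    rw [← e, hs]
    abel

/-- The right hand side of the topological recursion relation depends only on the monomial on
the left hand side. -/
theorem correlator_trrSum_eq {F : MvPowerSeries (Label n) K} {k : ℕ} (hF : TRRUpTo F k)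
    (hW : WDVVUpTo F k) {d d' : ℕ} {α α' : Fin (n + 2)} {v v' w w' : Label n}
    {r r' : Label n →₀ ℕ} (h : level r + w.1 + v.1 + (d + 1) ≤ k + 1)
    (e : r + Finsupp.single w 1 + Finsupp.single v 1 + Finsupp.single (d + 1, α) 1 =
      r' + Finsupp.single w' 1 + Finsupp.single v' 1 + Finsupp.single (d' + 1, α') 1) :
    correlator (trrSum F (d, α) v w) r = correlator (trrSum F (d', α') v' w') r' := by
  -- If the relation is applied to the same insertion, the choices of `v` and `w` differ by WDVV
  -- exchanges. Otherwise such exchanges move `(d' + 1, α')` to the slot of `v`, and the relation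
  -- gives the same result for the two insertions.
  by_cases hu : (d + 1, α) = (d' + 1, α')
  · obtain ⟨rfl, rfl⟩ : d = d' ∧ α = α' := by simpa using hu
    exact correlator_trrSum_eq_of_add_add hW _ (by simp only; omega) (add_right_cancel e)
  · have hlev := congrArg level e
    rw [level_add_three, level_add_three] at hlev
    have hr : (r + Finsupp.single w 1 + Finsupp.single v 1 : Label n →₀ ℕ) (d' + 1, α') ≠ 0 := by
      have := DFunLike.congr_fun e (d' + 1, α')
      rw [Finsupp.add_apply, Finsupp.add_apply _ (Finsupp.single (d' + 1, α') 1),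
        Finsupp.single_eq_same, Finsupp.single_eq_of_ne (Ne.symm hu)] at this
      omega
    have hdeg : 3 ≤ (r + Finsupp.single w 1 + Finsupp.single v 1 +
        Finsupp.single (d + 1, α) 1).degree := by
      simp only [map_add, Finsupp.degree_single]
      omega
    have hs := (sub_single_add hr).symm
    generalize hM : r + Finsupp.single w 1 + Finsupp.single v 1 -
      Finsupp.single (d' + 1, α') 1 = s at hs
    have hs0 : s ≠ 0 := by
      rintro rfl
      rw [hs] at hdeg
      simp [Finsupp.degree_single] at hdeg
    obtain ⟨x, hx⟩ := Finsupp.ne_iff.1 hs0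
    have hsx := (sub_single_add (m := s) (v := x) hx).symm
    generalize s - Finsupp.single x 1 = s' at hsx
    subst hsx
    have hlev2 := congrArg level hs
    simp only [map_add, level_single, one_mul] at hlev2
    rw [correlator_trrSum_eq_of_add_add hW (d, α) (v' := (d' + 1, α')) (w' := x) (r' := s')
      (by simp only; omega) hs, levelTrunc_eq_iff_correlator.1 (levelTrunc_trrSum_exchange hF
        d d' α α' x (level s') (by omega)) s' le_rfl]
    refine correlator_trrSum_eq_of_add_add hW _ (by simp only; omega)
      (add_right_cancel (b := Finsupp.single (d' + 1, α') 1) ?_)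
    rw [← e, hs]
    abel

theorem IsPotentialUpTo.wdvv {f : MvPowerSeries (Fin (n + 2)) K} (hf : FormalWDVV f)
    {F : MvPowerSeries (Label n) K} {k : ℕ} (hF : IsPotentialUpTo f F k) : WDVVUpTo F k := by
  refine wdvvUpTo_of_trrUpTo hF.trr fun a b c e => levelTrunc_zero_of_restrictPrimary ?_
  simp only [wdvvSum, map_sum, map_mul, restrictPrimary_thirdD hF.restrict]
  exact hf a b c e

theorem correlator_ofCoeff {σ : Type*} (c : (σ →₀ ℕ) → K) (m : σ →₀ ℕ) :
    correlator (ofCoeff fun m => (m.prod fun _ c => (c.factorial : K))⁻¹ * c m) m = c m := by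
  rw [correlator, coeff_ofCoeff, mul_inv_cancel_left₀ (prod_factorial_ne_zero m)]

/-- Extension of the potential level by level: a correlator of level `k + 1` is defined by the
recursion relation, applied to any of its descendant insertions. -/
theorem exists_isPotentialUpTo {f : MvPowerSeries (Fin (n + 2)) K} (hf : FormalWDVV f) (k : ℕ) :
    ∃ F : MvPowerSeries (Label n) K, IsPotentialUpTo f F k := by
  classical
  induction k with
  | zero =>
    refine ⟨ofCoeff fun m => if 3 ≤ m.degree then coeff (primaryPart m) f else 0, ?_, ?_, ?_⟩
    · intro m hm
      rw [coeff_ofCoeff, if_neg (by omega)]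
    · intro m hm
      rw [coeff_ofCoeff, if_pos (by rwa [degree_primary]), primaryPart_primary]
    · intro d α v w j h
      omega
  | succ k ih =>
    obtain ⟨F, hF⟩ := ih
    have hW := hF.wdvv hf
    -- the monomials of level `k + 1` that occur on the left hand side of the recursion
    let P : (Label n →₀ ℕ) → (ℕ × Fin (n + 2)) × Label n × Label n × (Label n →₀ ℕ) → Prop :=
      fun m p => m = p.2.2.2 + Finsupp.single p.2.2.1 1 + Finsupp.single p.2.1 1 +
        Finsupp.single (p.1.1 + 1, p.1.2) 1
    let e : (Label n →₀ ℕ) → K := fun m =>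
      if h : level m = k + 1 ∧ ∃ p, P m p then
        correlator (trrSum F h.2.choose.1 h.2.choose.2.1 h.2.choose.2.2.1) h.2.choose.2.2.2
      else correlator F m
    let G : MvPowerSeries (Label n) K :=
      ofCoeff fun m => (m.prod fun _ c => (c.factorial : K))⁻¹ * e m
    have hG : ∀ m, correlator G m = e m := fun m => correlator_ofCoeff e m
    have heq : ∀ m, level m ≠ k + 1 → correlator G m = correlator F m := fun m hm => by
      rw [hG m]
      exact dif_neg fun h => hm h.1
    have hk : levelTrunc K n k G = levelTrunc K n k F :=
      levelTrunc_eq_iff_correlator.2 fun m hm => heq m (by omega)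
    refine ⟨G, ?_, ?_, trrUpTo_iff.2 ?_⟩
    · intro m hm
      rw [← hF.stable m hm]
      refine correlator_injective ((hG m).trans (dif_neg ?_))
      rintro ⟨-, p, rfl⟩
      simp only [map_add, Finsupp.degree_single] at hm
      omega
    · intro m hm
      rw [← hF.restrict m hm]
      exact correlator_injective (heq _ (by rw [level_primary]; omega))
    · intro d α v w r h
      have hs : correlator (trrSum G (d, α) v w) r = correlator (trrSum F (d, α) v w) r :=
        levelTrunc_eq_iff_correlator.1
          (levelTrunc_trrSum hk (j := level r) (by simp only; omega)) r le_rfl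
      rw [hs]
      by_cases hlt : level r + w.1 + v.1 + (d + 1) = k + 1
      · have hex : level (r + Finsupp.single w 1 + Finsupp.single v 1 +
            Finsupp.single (d + 1, α) 1) = k + 1 ∧ ∃ p, P (r + Finsupp.single w 1 +
            Finsupp.single v 1 + Finsupp.single (d + 1, α) 1) p :=
          ⟨by rw [level_add_three, hlt], ⟨⟨d, α⟩, v, w, r⟩, rfl⟩
        rw [hG]
        refine (dif_pos hex).trans (correlator_trrSum_eq hF.trr hW h ?_).symm
        exact hex.2.choose_spec
      · rw [heq _ (by rw [level_add_three]; exact hlt)]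
        exact trrUpTo_iff.1 hF.trr d α v w r (by omega)

end Reconstruction

section Potential

open MvPowerSeries

variable {𝕜 : Type*} [RCLike 𝕜] {n : ℕ}

theorem isDescendantPotential_iff {f : MvPowerSeries (Fin (n + 2)) 𝕜}
    {F : MvPowerSeries (Label n) 𝕜} :
    IsDescendantPotential f F ↔ ∀ k, IsPotentialUpTo f F k := by
  have hsum : ∀ (d : ℕ) (α : Fin (n + 2)) (v w : Label n),
      ∑ l, ∑ s, eta 𝕜 n l s • (pderiv 𝕜 (d, α) (pderiv 𝕜 ((0 : ℕ), l) F) *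
        pderiv 𝕜 ((0 : ℕ), s) (pderiv 𝕜 v (pderiv 𝕜 w F))) = trrSum F (d, α) v w := by
    intro d α v w
    refine Finset.sum_congr rfl fun l _ => ?_
    rw [Finset.sum_eq_single l.rev]
    · rw [eta, Matrix.of_apply, if_pos rfl, one_smul, thirdD]
    · intro s _ hs
      rw [eta, Matrix.of_apply, if_neg hs, zero_smul]
    · intro h
      exact absurd (Finset.mem_univ _) h
  constructor
  · intro h k
    refine ⟨h.stable, h.restrict, fun d α v w j _ => ?_⟩
    rw [← hsum, ← h.trr]
    rfl
  · intro h
    refine ⟨(h 0).stable, (h 0).restrict, fun d α v w => ?_⟩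
    rw [hsum]
    ext m
    exact levelTrunc_eq_iff.1 ((h (d + 1 + v.1 + w.1 + level m)).trr d α v w (level m) le_rfl)
      m le_rfl

/-- A formal solution of the WDVV equations has a unique genus zero descendant potential. -/
theorem existsUnique_isDescendantPotential {f : MvPowerSeries (Fin (n + 2)) 𝕜}
    (hf : FormalWDVV f) : ∃! F : MvPowerSeries (Label n) 𝕜, IsDescendantPotential f F := by
  refine existsUnique_of_exists_of_unique ?_ ?_
  · choose P hP using fun k => exists_isPotentialUpTo hf k
    let F : MvPowerSeries (Label n) 𝕜 := ofCoeff fun m => coeff m (P (level m))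
    have hF : ∀ k, levelTrunc 𝕜 n k F = levelTrunc 𝕜 n k (P k) := fun k =>
      levelTrunc_eq_iff.2 fun m hm => by
        rw [coeff_ofCoeff]
        exact levelTrunc_eq_iff.1 ((hP (level m)).levelTrunc_eq ((hP k).mono hm)) m le_rfl
    refine ⟨F, isDescendantPotential_iff.2 fun k => ⟨?_, ?_, trrUpTo_iff.2 ?_⟩⟩
    · intro m hm
      rw [coeff_ofCoeff, (hP _).stable m hm]
    · intro m hm
      rw [coeff_ofCoeff, (hP _).restrict m hm]
    · intro d α v w r h
      rw [levelTrunc_eq_iff_correlator.1 (hF k) _ (by rwa [level_add_three]),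
        trrUpTo_iff.1 (hP k).trr d α v w r h]
      exact (levelTrunc_eq_iff_correlator.1
        (levelTrunc_trrSum (hF k) (j := level r) (by simp only; omega)) r le_rfl).symm
  · intro F G hF hG
    ext m
    exact levelTrunc_eq_iff.1 ((isDescendantPotential_iff.1 hF (level m)).levelTrunc_eq
      (isDescendantPotential_iff.1 hG (level m))) m le_rfl

end Potential


/-! ### The dilaton equation for the genus zero potential -/

section GenusZeroDilaton

open MvPowerSeries

variable {K : Type*} [Field K] {n : ℕ}

theorem coeff_X_mul_pderiv {σ : Type*} (v : σ) (f : MvPowerSeries σ K) (m : σ →₀ ℕ) :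
    coeff m (X v * pderiv K v f) = (m v : K) * coeff m f := by
  by_cases h : m v = 0
  · rw [coeff_X_mul_of_eq_zero h, h, Nat.cast_zero, zero_mul]
  · rw [coeff_X_mul_of_ne_zero h, coeff_pderiv, sub_single_add h, mul_comm]
    congr 1
    rw [Finsupp.tsub_apply, Finsupp.single_eq_same, ← Nat.cast_add_one,
      Nat.sub_add_cancel (Nat.one_le_iff_ne_zero.2 h)]

/-- The Euler vector field multiplies a monomial by its degree. -/
theorem coeff_sum_X_mul_pderiv {σ : Type*} [Fintype σ] (f : MvPowerSeries σ K) (m : σ →₀ ℕ) :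
    coeff m (∑ v, X v * pderiv K v f) = (m.degree : K) * coeff m f := by
  rw [map_sum, Finsupp.degree_eq_sum, Nat.cast_sum, Finset.sum_mul]
  exact Finset.sum_congr rfl fun v _ => coeff_X_mul_pderiv v f m

theorem eq_of_pderiv_eq [CharZero K] {σ : Type*} {f g : MvPowerSeries σ K}
    (h0 : constantCoeff f = constantCoeff g) (h : ∀ v, pderiv K v f = pderiv K v g) : f = g := by
  ext m
  by_cases hm : m = 0
  · subst hm
    exact h0
  · obtain ⟨v, hv⟩ := Finsupp.ne_iff.1 hm
    have h1 := congrArg (coeff (m - Finsupp.single v 1)) (h v)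
    rw [coeff_pderiv, coeff_pderiv, sub_single_add hv] at h1
    exact mul_right_cancel₀ (Nat.cast_add_one_ne_zero _) h1

/-- The unit axiom for a formal potential on the small phase space. -/
def FormalUnit (f : MvPowerSeries (Fin (n + 2)) K) : Prop :=
  ∀ a b : Fin (n + 2), pderiv K 0 (pderiv K a (pderiv K b f)) = C (if b = a.rev then 1 else 0)

theorem restrictPrimary_pderiv_unit [CharZero K] {f : MvPowerSeries (Fin (n + 2)) K}
    (hu : FormalUnit f) {F : MvPowerSeries (Label n) K} {k : ℕ} (hF : IsPotentialUpTo f F k)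
    (l : Fin (n + 2)) :
    restrictPrimary K n (pderiv K (0, 0) (pderiv K (0, l) F)) = X l.rev := by
  classical
  refine eq_of_pderiv_eq ?_ fun c => ?_
  · rw [constantCoeff_X, ← coeff_zero_eq_constantCoeff_apply, restrictPrimary_pderiv,
      restrictPrimary_pderiv, coeff_pderiv, coeff_pderiv, coeff_restrictPrimary, hF.stable,
      zero_mul, zero_mul]
    simp [degree_primary, Finsupp.degree_single]
  · rw [← restrictPrimary_pderiv]
    have h := restrictPrimary_thirdD hF.restrict c 0 l
    rw [thirdD] at h
    rw [h, pderiv_comm c, pderiv_comm c, hu l c]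
    by_cases hc : c = l.rev
    · rw [if_pos hc, hc, pderiv_X_self, map_one]
    · rw [if_neg hc, pderiv_X_of_ne (Ne.symm hc), map_zero]

/-- The dilaton equation on the small phase space. -/
theorem correlator_dilaton_primary [CharZero K] {f : MvPowerSeries (Fin (n + 2)) K}
    (hu : FormalUnit f) {F : MvPowerSeries (Label n) K} {k : ℕ} (hF : IsPotentialUpTo f F (k + 1))
    (a b : Fin (n + 2)) (r : Fin (n + 2) →₀ ℕ) :
    correlator (trrSum F (0, 0) (0, a) (0, b)) (primary r) =
      (r.degree : K) * correlator (pderiv K (0, a) (pderiv K (0, b) F)) (primary r) := by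
  rw [correlator, correlator, ← coeff_restrictPrimary, ← coeff_restrictPrimary, trrSum, map_sum]
  simp only [map_mul, restrictPrimary_pderiv_unit hu hF, thirdD]
  rw [sum_rev]
  simp only [Fin.rev_rev, restrictPrimary_pderiv _ (pderiv K _ (pderiv K _ F))]
  rw [coeff_sum_X_mul_pderiv]
  ring

theorem thirdD_dilaton (F : MvPowerSeries (Label n) K) (a b c : Label n) :
    thirdD (dilatonDerivation K n F + (2 : ℕ) • F) a b c =
      dilatonDerivation K n (thirdD F a b c) - thirdD F a b c := by
  simp only [thirdD, dilatonDerivation_pderiv, map_add, two_nsmul]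
  abel

theorem pderiv_pderiv_dilaton (F : MvPowerSeries (Label n) K) (a b : Label n) :
    pderiv K a (pderiv K b (dilatonDerivation K n F + (2 : ℕ) • F)) =
      dilatonDerivation K n (pderiv K a (pderiv K b F)) := by
  simp only [dilatonDerivation_pderiv, map_add, two_nsmul]
  abel

theorem correlator_dilaton (F : MvPowerSeries (Label n) K) (m : Label n →₀ ℕ) :
    correlator (dilatonDerivation K n F + (2 : ℕ) • F) m =
      correlator F (m + Finsupp.single (1, 0) 1) - ((m.degree : K) - 2) * correlator F m := by
  rw [← correlator_pderiv, correlator, correlator, correlator, map_add, map_nsmul,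
    coeff_dilatonDerivation, coeff_pderiv, nsmul_eq_mul]
  push_cast
  ring

theorem IsPotentialUpTo.correlator_of_degree_lt {f : MvPowerSeries (Fin (n + 2)) K}
    {F : MvPowerSeries (Label n) K} {k : ℕ} (hF : IsPotentialUpTo f F k) {m : Label n →₀ ℕ}
    (h : m.degree < 3) : correlator F m = 0 := by
  rw [correlator, hF.stable m h, mul_zero]

variable [CharZero K]

/-- The dilaton equation: it holds on the small phase space by the unit axiom, and both of its
sides satisfy the same linearized topological recursion relation. -/
theorem dilaton_of_isPotential {f : MvPowerSeries (Fin (n + 2)) K} (hu : FormalUnit f)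
    {F : MvPowerSeries (Label n) K} (hF : ∀ k, IsPotentialUpTo f F k) :
    dilatonDerivation K n F + (2 : ℕ) • F = 0 := by
  set G := dilatonDerivation K n F + (2 : ℕ) • F with hG
  -- correlators with at most two insertions
  have hlow : ∀ m : Label n →₀ ℕ, m.degree < 3 → correlator G m = 0 := by
    intro m hm
    rw [hG, correlator_dilaton, (hF 0).correlator_of_degree_lt hm, mul_zero, sub_zero]
    by_cases hm2 : m.degree = 2
    · obtain ⟨r, a, b, h⟩ := exists_eq_add_three (m := m + Finsupp.single (1, 0) 1) (v := (1, 0))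
        (by simp) (by rw [map_add, Finsupp.degree_single]; omega)
      have h' := add_right_cancel h
      have hr : r = 0 := by
        have hd := congrArg Finsupp.degree h'
        simp only [map_add, Finsupp.degree_single] at hd
        rw [← Finsupp.degree_eq_zero_iff]
        omega
      subst hr
      rw [h, trrUpTo_iff.1 (hF _).trr 0 0 b a 0 le_rfl, correlator, trrSum, map_sum,
        Finset.sum_eq_zero, mul_zero]
      intro l _
      rw [coeff_zero_eq_constantCoeff_apply, map_mul, ← coeff_zero_eq_constantCoeff_apply,
        coeff_pderiv, coeff_pderiv, (hF 0).stable, zero_mul, zero_mul, zero_mul]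
      simp only [map_add, Finsupp.degree_single, map_zero]
      omega
    · refine (hF 0).correlator_of_degree_lt ?_
      rw [map_add, Finsupp.degree_single]
      omega
  suffices H : ∀ k, levelTrunc K n k G = levelTrunc K n k 0 by
    ext m
    exact levelTrunc_eq_iff.1 (H (level m)) m le_rfl
  have hzero : ∀ m : Label n →₀ ℕ, correlator (0 : MvPowerSeries (Label n) K) m = 0 := fun m => by
    rw [correlator, map_zero, mul_zero]
  intro k
  induction k with
  | zero =>
    refine levelTrunc_eq_iff_correlator.2 fun m hm => ?_
    rw [hzero]
    by_cases hd : m.degree < 3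
    · exact hlow m hd
    obtain ⟨p, rfl⟩ : ∃ p, m = primary p := ⟨_, (primary_primaryPart (Nat.le_zero.1 hm)).symm⟩
    rw [degree_primary] at hd
    obtain ⟨v, hv⟩ : ∃ v, p v ≠ 0 := by
      by_contra! h0
      rw [show p = 0 from Finsupp.ext h0, map_zero] at hd
      omega
    obtain ⟨r, a, b, h⟩ := exists_eq_add_three (m := primary p) (v := (0, v))
      (by rwa [primary_zero_apply]) (by rw [degree_primary]; omega)
    have hlev := congrArg level h
    rw [level_primary] at hlev
    simp only [map_add, level_single, one_mul] at hlev
    obtain ⟨b0, b⟩ := b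
    obtain rfl : b0 = 0 := by simp only at hlev; omega
    obtain ⟨q, hq⟩ : ∃ q, r + Finsupp.single a 1 = primary q :=
      ⟨_, (primary_primaryPart (by rw [map_add, level_single]; omega)).symm⟩
    rw [hq] at h
    have hdeg := congrArg Finsupp.degree h
    simp only [map_add, degree_primary, Finsupp.degree_single] at hdeg
    rw [hG, correlator_dilaton, degree_primary, h,
      trrUpTo_iff.1 (hF (level (primary q) + 1)).trr 0 0 (0, v) (0, b) (primary q) (by simp),
      correlator_dilaton_primary hu (hF (0 + 1)), correlator_pderiv, correlator_pderiv, hdeg,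
      add_right_comm (primary q)]
    push_cast
    ring
  | succ k ih =>
    refine levelTrunc_eq_iff_correlator.2 fun m hm => ?_
    rw [hzero]
    by_cases hd : m.degree < 3
    · exact hlow m hd
    by_cases hk : level m ≤ k
    · rw [levelTrunc_eq_iff_correlator.1 ih m hk, hzero]
    obtain ⟨d, α, v, w, r, rfl⟩ := exists_eq_of_level_ne_zero (by omega) (by omega : 3 ≤ m.degree)
    rw [level_add_three] at hm
    rw [← correlator_thirdD, thirdD_reverse, ← hzero r]
    refine levelTrunc_eq_iff_correlator.1 ?_ r le_rfl
    -- The defect `G` of the dilaton equation satisfies the linearized recursion relation, whose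
    -- right hand side involves only coefficients of `G` of lower level.
    have htrr : thirdD F (d + 1, α) v w = trrSum F (d, α) v w := by
      ext m
      exact levelTrunc_eq_iff.1
        ((hF (d + 1 + v.1 + w.1 + level m)).trr d α v w (level m) le_rfl) m le_rfl
    have e : thirdD G (d + 1, α) v w = ∑ l : Fin (n + 2),
        (pderiv K (d, α) (pderiv K (0, l) G) * thirdD F (0, l.rev) v w +
          pderiv K (d, α) (pderiv K (0, l) F) * thirdD G (0, l.rev) v w) := by
      rw [hG, thirdD_dilaton, htrr, trrSum, map_sum, ← Finset.sum_sub_distrib]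
      refine Finset.sum_congr rfl fun l _ => ?_
      rw [AddDerivation.leibniz, thirdD_dilaton, pderiv_pderiv_dilaton]
      ring
    have h1 : ∀ l : Fin (n + 2), levelTrunc K n (level r) (pderiv K (d, α) (pderiv K (0, l) G)) =
        0 := fun l => by
      have := levelTrunc_pderiv (d, α) (i := level r) (j := level r + d) le_rfl
        (levelTrunc_pderiv (0, l) (j := k) (by simp only; omega) ih)
      rwa [map_zero, map_zero, map_zero] at this
    have h2 : ∀ l : Fin (n + 2), levelTrunc K n (level r) (thirdD G (0, l) v w) = 0 := fun l => by
      have := levelTrunc_pderiv (0, l) (i := level r) (j := level r) le_rfl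
        (levelTrunc_pderiv v (j := level r + v.1) le_rfl
          (levelTrunc_pderiv w (j := k) (by omega) ih))
      rwa [map_zero, map_zero, map_zero, map_zero] at this
    rw [e, map_sum, map_zero]
    refine Finset.sum_eq_zero fun l _ => ?_
    rw [map_add, map_mul, map_mul, h1, h2, zero_mul, mul_zero, add_zero]

end GenusZeroDilaton


/-! ### The change of variables `y ↦ y / (1 - s y)` on formal power series -/

section Stretch

open MvPowerSeries

variable {R : Type*} [CommRing R] {n : ℕ}

/-- The operator `E - k`, where `E` is the Euler vector field, which multiplies a monomial by its
degree. -/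
def shiftedEuler {σ : Type*} (k : ℤ) (f : MvPowerSeries σ R) : MvPowerSeries σ R :=
  ofCoeff fun m => (((m.degree : ℤ) - k : ℤ) : R) * coeff m f

theorem coeff_shiftedEuler {σ : Type*} (k : ℤ) (f : MvPowerSeries σ R) (m : σ →₀ ℕ) :
    coeff m (shiftedEuler k f) = (((m.degree : ℤ) - k : ℤ) : R) * coeff m f := rfl

theorem shiftedEuler_add {σ : Type*} (k : ℤ) (f g : MvPowerSeries σ R) :
    shiftedEuler k (f + g) = shiftedEuler k f + shiftedEuler k g := by
  ext m
  simp only [coeff_shiftedEuler, map_add, mul_add]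

theorem shiftedEuler_sub {σ : Type*} (k : ℤ) (f g : MvPowerSeries σ R) :
    shiftedEuler k (f - g) = shiftedEuler k f - shiftedEuler k g := by
  ext m
  simp only [coeff_shiftedEuler, map_sub, mul_sub]

theorem shiftedEuler_C_mul {σ : Type*} (k : ℤ) (c : R) (f : MvPowerSeries σ R) :
    shiftedEuler k (C c * f) = C c * shiftedEuler k f := by
  ext m
  simp only [coeff_shiftedEuler, coeff_C_mul]
  ring

theorem shiftedEuler_of_homogeneous {σ : Type*} (k : ℤ) {d : ℕ} {f : MvPowerSeries σ R}
    (hf : ∀ m : σ →₀ ℕ, m.degree ≠ d → coeff m f = 0) :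
    shiftedEuler k f = (((d : ℤ) - k : ℤ) : R) • f := by
  ext m
  rw [coeff_shiftedEuler, coeff_smul]
  by_cases h : m.degree = d
  · rw [h]
  · rw [hf m h, mul_zero, mul_zero]

/-- The change of variables `h ↦ (1 - s y)^k h(x / (1 - s y))`, where `x` runs through all
variables and `y` is the last one. -/
def stretch (k : ℤ) (s : R) (h : MvPowerSeries (Fin (n + 2)) R) :
    MvPowerSeries (Fin (n + 2)) R :=
  ofCoeff fun m => ∑ i ∈ Finset.range (m (Fin.last (n + 1)) + 1),
    s ^ i * ((Ring.choose ((m.degree : ℤ) - 1 - k) i : ℤ) : R) *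
      coeff (m - Finsupp.single (Fin.last (n + 1)) i) h

theorem coeff_stretch (k : ℤ) (s : R) (h : MvPowerSeries (Fin (n + 2)) R)
    (m : Fin (n + 2) →₀ ℕ) :
    coeff m (stretch k s h) = ∑ i ∈ Finset.range (m (Fin.last (n + 1)) + 1),
      s ^ i * ((Ring.choose ((m.degree : ℤ) - 1 - k) i : ℤ) : R) *
        coeff (m - Finsupp.single (Fin.last (n + 1)) i) h := rfl

theorem coeff_stretch_of_eq_zero (k : ℤ) (s : R) (h : MvPowerSeries (Fin (n + 2)) R)
    {m : Fin (n + 2) →₀ ℕ} (hm : m (Fin.last (n + 1)) = 0) :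
    coeff m (stretch k s h) = coeff m h := by
  rw [coeff_stretch, hm, zero_add, Finset.sum_range_one, Ring.choose_zero_right]
  simp

theorem stretch_zero (k : ℤ) (s : R) :
    stretch k s (0 : MvPowerSeries (Fin (n + 2)) R) = 0 := by
  ext m
  rw [coeff_stretch, Finset.sum_eq_zero, map_zero]
  intro i _
  rw [map_zero, mul_zero]

theorem degree_sub_single {σ : Type*} {m : σ →₀ ℕ} {v : σ} {i : ℕ} (h : i ≤ m v) :
    (m - Finsupp.single v i).degree = m.degree - i := by
  have h1 := congrArg Finsupp.degree
    (tsub_add_cancel_of_le (Finsupp.single_le_iff.2 h : Finsupp.single v i ≤ m))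
  rw [map_add, Finsupp.degree_single] at h1
  omega

theorem le_degree_of_le {σ : Type*} {m : σ →₀ ℕ} {v : σ} {i : ℕ} (h : i ≤ m v) : i ≤ m.degree :=
  h.trans (Finsupp.le_degree v m)

theorem pderiv_stretch_of_ne (k : ℤ) (s : R) (h : MvPowerSeries (Fin (n + 2)) R)
    {v : Fin (n + 2)} (hv : v ≠ Fin.last (n + 1)) :
    pderiv R v (stretch k s h) = stretch (k - 1) s (pderiv R v h) := by
  ext m
  have hL : (m + Finsupp.single v 1 : Fin (n + 2) →₀ ℕ) (Fin.last (n + 1)) =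
      m (Fin.last (n + 1)) := by
    rw [Finsupp.add_apply, Finsupp.single_eq_of_ne (Ne.symm hv), add_zero]
  rw [coeff_pderiv, coeff_stretch, coeff_stretch, hL, Finset.sum_mul]
  refine Finset.sum_congr rfl fun i hi => ?_
  have hi' : i ≤ m (Fin.last (n + 1)) := Nat.lt_succ_iff.1 (Finset.mem_range.1 hi)
  rw [coeff_pderiv, tsub_add_eq_add_tsub (Finsupp.single_le_iff.2 hi'), Finsupp.tsub_apply,
    Finsupp.single_eq_of_ne hv, tsub_zero, map_add, Finsupp.degree_single,
    show ((m.degree + 1 : ℕ) : ℤ) - 1 - k = (m.degree : ℤ) - 1 - (k - 1) by push_cast; ring]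
  ring

theorem succ_mul_choose (r : ℤ) (i : ℕ) :
    ((i : R) + 1) * ((Ring.choose r (i + 1) : ℤ) : R) =
      ((Ring.choose r i : ℤ) : R) * ((r - i : ℤ) : R) := by
  have h := Ring.choose_smul_choose r (Nat.le_succ i)
  rw [Nat.succ_sub (le_refl i), Nat.sub_self, Ring.choose_one_right, Nat.choose_succ_self_right,
    nsmul_eq_mul] at h
  exact_mod_cast congrArg (Int.cast : ℤ → R) h

theorem succ_mul_choose_pred (r : ℤ) (i : ℕ) :
    ((i : R) + 1) * ((Ring.choose r (i + 1) : ℤ) : R) =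
      (r : R) * ((Ring.choose (r - 1) i : ℤ) : R) := by
  have h := Ring.choose_smul_choose r (Nat.le_add_left 1 i)
  rw [Nat.add_sub_cancel, Ring.choose_one_right, Nat.choose_one_right, nsmul_eq_mul,
    Nat.cast_one] at h
  exact_mod_cast congrArg (Int.cast : ℤ → R) h

/-- The chain rule for `(1 - y)^k h(x / (1 - y))`, differentiated with respect to `y`. -/
theorem pderiv_last_stretch (k : ℤ) (h : MvPowerSeries (Fin (n + 2)) R) :
    pderiv R (Fin.last (n + 1)) (stretch k 1 h) =
      stretch (k - 1) 1 (shiftedEuler k h + pderiv R (Fin.last (n + 1)) h) := by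
  ext m
  set L := Fin.last (n + 1) with hL
  set M := m L with hM
  have hML : (m + Finsupp.single L 1 : Fin (n + 2) →₀ ℕ) L = M + 1 := by
    rw [Finsupp.add_apply, Finsupp.single_eq_same]
  -- the coefficients of `h` that occur
  let H : ℕ → R := fun i => coeff (m + Finsupp.single L 1 - Finsupp.single L i) h
  let c : ℕ → R := fun i => ((Ring.choose ((m.degree : ℤ) - k) i : ℤ) : R)
  have hl : coeff m (pderiv R L (stretch k 1 h)) =
      (∑ i ∈ Finset.range (M + 2), c i * H i) * ((M : R) + 1) := by
    rw [coeff_pderiv, coeff_stretch, ← hL, hML, map_add, Finsupp.degree_single]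
    congr 1
    refine Finset.sum_congr rfl fun i _ => ?_
    rw [one_pow, one_mul,
      show ((m.degree + 1 : ℕ) : ℤ) - 1 - k = (m.degree : ℤ) - k by push_cast; ring]
  have hr : coeff m (stretch (k - 1) 1 (shiftedEuler k h + pderiv R L h)) =
      ∑ i ∈ Finset.range (M + 1), (c i * (((m.degree : ℤ) - k - i : ℤ) : R) * H (i + 1) +
        ((M : R) + 1 - i) * (c i * H i)) := by
    rw [coeff_stretch, ← hL, ← hM]
    refine Finset.sum_congr rfl fun i hi => ?_
    have hi' : i ≤ m L := Nat.lt_succ_iff.1 (Finset.mem_range.1 hi)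
    rw [map_add, coeff_shiftedEuler, coeff_pderiv,
      tsub_add_eq_add_tsub (Finsupp.single_le_iff.2 hi'), Finsupp.tsub_apply,
      Finsupp.single_eq_same, degree_sub_single hi', ← hM, one_pow, one_mul,
      Nat.cast_sub (hi'.trans (le_of_eq hM.symm)), Nat.cast_sub (le_degree_of_le hi'),
      show (m.degree : ℤ) - 1 - (k - 1) = (m.degree : ℤ) - k by ring,
      show (m.degree : ℤ) - i - k = (m.degree : ℤ) - k - i by ring]
    have e : m - Finsupp.single L i = m + Finsupp.single L 1 - Finsupp.single L (i + 1) := by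
      rw [add_comm i 1, Finsupp.single_add, ← tsub_tsub, add_tsub_cancel_right]
    rw [e]
    simp only [c, H]
    ring
  rw [hl, hr, Finset.sum_add_distrib]
  -- Both halves become sums over the same range: the first by a shift of the index, the second
  -- because its additional term has the factor `M + 1 - (M + 1)`.
  have h1 : ∑ i ∈ Finset.range (M + 1), c i * (((m.degree : ℤ) - k - i : ℤ) : R) * H (i + 1) =
      ∑ i ∈ Finset.range (M + 2), (i : R) * (c i * H i) := by
    rw [Finset.sum_range_succ' _ (M + 1), Nat.cast_zero, zero_mul, add_zero]
    refine Finset.sum_congr rfl fun i _ => ?_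
    rw [← succ_mul_choose]
    push_cast
    ring
  have h2 : ∑ i ∈ Finset.range (M + 1), ((M : R) + 1 - i) * (c i * H i) =
      ∑ i ∈ Finset.range (M + 2), ((M : R) + 1 - i) * (c i * H i) := by
    rw [Finset.sum_range_succ _ (M + 1)]
    push_cast
    rw [sub_self, zero_mul, add_zero]
  rw [h1, h2, ← Finset.sum_add_distrib, Finset.sum_mul]
  refine Finset.sum_congr rfl fun i _ => ?_
  ring

/-- Multiplication by `1 - s y`, by the Pascal rule. -/
theorem stretch_sub_mul (k : ℤ) (s : R) (h : MvPowerSeries (Fin (n + 2)) R) :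
    stretch k s h - C s * (X (Fin.last (n + 1)) * stretch k s h) = stretch (k + 1) s h := by
  ext m
  rw [map_sub, coeff_C_mul]
  by_cases hm : m (Fin.last (n + 1)) = 0
  · rw [coeff_X_mul_of_eq_zero hm, mul_zero, sub_zero, coeff_stretch_of_eq_zero k s h hm,
      coeff_stretch_of_eq_zero _ s h hm]
  · obtain ⟨M, hM⟩ := Nat.exists_eq_succ_of_ne_zero hm
    have hle : 1 ≤ m (Fin.last (n + 1)) := by omega
    have hdeg : ((m - Finsupp.single (Fin.last (n + 1)) 1).degree : ℤ) = (m.degree : ℤ) - 1 := by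
      rw [degree_sub_single hle, Nat.cast_sub (le_degree_of_le hle), Nat.cast_one]
    rw [coeff_X_mul_of_ne_zero hm, coeff_stretch, coeff_stretch, coeff_stretch, hdeg,
      Finsupp.tsub_apply, Finsupp.single_eq_same, hM, Nat.succ_sub_one, Finset.sum_range_succ',
      Finset.sum_range_succ' _ M.succ, Finset.mul_sum, add_sub_right_comm,
      ← Finset.sum_sub_distrib]
    congr 1
    · refine Finset.sum_congr rfl fun i _ => ?_
      rw [tsub_tsub m, ← Finsupp.single_add, add_comm 1 i,
        show (m.degree : ℤ) - 1 - k = ((m.degree : ℤ) - 1 - (k + 1)) + 1 by ring,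
        Ring.choose_succ_succ,
        show (m.degree : ℤ) - 1 - 1 - k = (m.degree : ℤ) - 1 - (k + 1) by ring]
      push_cast
      ring
    · rw [Ring.choose_zero_right, Ring.choose_zero_right]

theorem choose_eq_zero_of_lt {r : ℤ} (hr : 0 ≤ r) {i : ℕ} (h : r < i) : Ring.choose r i = 0 := by
  lift r to ℕ using hr
  rw [Ring.choose_natCast, Nat.choose_eq_zero_of_lt (by exact_mod_cast h), Nat.cast_zero]

theorem stretch_of_homogeneous (s : R) {d : ℕ} {h : MvPowerSeries (Fin (n + 2)) R}
    (hh : ∀ m : Fin (n + 2) →₀ ℕ, m.degree ≠ d → coeff m h = 0) : stretch d s h = h := by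
  ext m
  rw [coeff_stretch, Finset.sum_eq_single 0]
  · rw [Ring.choose_zero_right]
    simp
  · intro i hi hi0
    have hi' : i ≤ m (Fin.last (n + 1)) := Nat.lt_succ_iff.1 (Finset.mem_range.1 hi)
    have hi2 := le_degree_of_le hi'
    by_cases hd : m.degree - i = d
    · rw [choose_eq_zero_of_lt (by omega) (by omega), Int.cast_zero, mul_zero, zero_mul]
    · rw [hh _ (by rwa [degree_sub_single hi']), mul_zero]
  · intro h0
    simp at h0

/-- In degrees above `k`, the terms of degree at most `k` do not contribute. -/
theorem coeff_stretch_congr (s : R) {k : ℕ} {h h' : MvPowerSeries (Fin (n + 2)) R}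
    (hh : ∀ m : Fin (n + 2) →₀ ℕ, k < m.degree → coeff m h = coeff m h')
    {m : Fin (n + 2) →₀ ℕ} (hm : k < m.degree) :
    coeff m (stretch k s h) = coeff m (stretch k s h') := by
  rw [coeff_stretch, coeff_stretch]
  refine Finset.sum_congr rfl fun i hi => ?_
  have hi' : i ≤ m (Fin.last (n + 1)) := Nat.lt_succ_iff.1 (Finset.mem_range.1 hi)
  have hi2 := le_degree_of_le hi'
  by_cases hd : k < m.degree - i
  · rw [hh _ (by rwa [degree_sub_single hi'])]
  · rw [choose_eq_zero_of_lt (by omega) (by omega), Int.cast_zero, mul_zero, zero_mul, zero_mul]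

theorem map_stretch {R' : Type*} [CommRing R'] (φ : R →+* R') (k : ℤ) (s : R)
    (h : MvPowerSeries (Fin (n + 2)) R) :
    MvPowerSeries.map φ (stretch k s h) = stretch k (φ s) (MvPowerSeries.map φ h) := by
  ext m
  rw [coeff_map, coeff_stretch, coeff_stretch, map_sum]
  refine Finset.sum_congr rfl fun i _ => ?_
  rw [map_mul, map_mul, map_pow, map_intCast, coeff_map]

theorem stretch_at_zero (k : ℤ) (h : MvPowerSeries (Fin (n + 2)) R) : stretch k 0 h = h := by
  ext m
  rw [coeff_stretch, Finset.sum_range_succ', Finset.sum_eq_zero fun i _ => by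
    rw [pow_succ, mul_zero, zero_mul, zero_mul], Ring.choose_zero_right]
  simp

/-- The operators `stretch k s` are the flow of the vector field `y (E - k)`. -/
theorem derivative_coeff_stretch (k : ℤ) (h : MvPowerSeries (Fin (n + 2)) R)
    (m : Fin (n + 2) →₀ ℕ) :
    Polynomial.derivative (coeff m (stretch k Polynomial.X (MvPowerSeries.map Polynomial.C h))) =
      coeff m (X (Fin.last (n + 1)) *
        shiftedEuler k (stretch k Polynomial.X (MvPowerSeries.map Polynomial.C h))) := by
  have hterm : ∀ (i : ℕ) (r : ℤ) (a : R), Polynomial.derivative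
      ((Polynomial.X : Polynomial R) ^ (i + 1) * ((Ring.choose r (i + 1) : ℤ) : Polynomial R) *
        Polynomial.C a) =
      (r : Polynomial R) * (Polynomial.X ^ i * ((Ring.choose (r - 1) i : ℤ) : Polynomial R) *
        Polynomial.C a) := by
    intro i r a
    have h1 := succ_mul_choose_pred (R := Polynomial R) r i
    rw [Polynomial.derivative_mul, Polynomial.derivative_C, mul_zero, add_zero,
      Polynomial.derivative_mul, Polynomial.derivative_intCast, mul_zero, add_zero,
      Polynomial.derivative_X_pow_succ]
    rw [Polynomial.C_add, Polynomial.C_1, Polynomial.C_eq_natCast]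
    linear_combination (Polynomial.X ^ i * Polynomial.C a) * h1
  rw [coeff_stretch, Finset.sum_range_succ', Polynomial.derivative_add, Ring.choose_zero_right,
    pow_zero, one_mul, Int.cast_one, one_mul, coeff_map, Polynomial.derivative_C, add_zero,
    Polynomial.derivative_sum]
  simp only [coeff_map, hterm]
  by_cases hm : m (Fin.last (n + 1)) = 0
  · rw [coeff_X_mul_of_eq_zero hm, hm, Finset.sum_range_zero]
  · obtain ⟨M, hM⟩ := Nat.exists_eq_succ_of_ne_zero hm
    have hle : 1 ≤ m (Fin.last (n + 1)) := by omega
    have hdeg : ((m - Finsupp.single (Fin.last (n + 1)) 1).degree : ℤ) = (m.degree : ℤ) - 1 := by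
      rw [degree_sub_single hle, Nat.cast_sub (le_degree_of_le hle), Nat.cast_one]
    rw [coeff_X_mul_of_ne_zero hm, coeff_shiftedEuler, coeff_stretch, hdeg, Finsupp.tsub_apply,
      Finsupp.single_eq_same, hM, Nat.succ_sub_one, Finset.mul_sum]
    refine Finset.sum_congr rfl fun i _ => ?_
    rw [coeff_map, tsub_tsub m, ← Finsupp.single_add, add_comm 1 i,
      show (m.degree : ℤ) - 1 - 1 - k = (m.degree : ℤ) - 1 - k - 1 by ring]

end Stretch


/-! ### The genus zero flow on the small phase space -/

section SmallFlow

open MvPowerSeries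

variable {𝕜 : Type*} [RCLike 𝕜] {n : ℕ}

/-- The coefficientwise derivative with respect to the time. -/
def smallTimeDerivation (𝕜 : Type*) [RCLike 𝕜] (n : ℕ) :
    AddDerivation (MvPowerSeries (Fin (n + 2)) (Polynomial 𝕜)) :=
  liftMvDerivation (AddDerivation.mk (Polynomial.derivative (R := 𝕜)).toAddMonoidHom fun f g => by
    simp [mul_comm, add_comm])

theorem coeff_smallTimeDerivation (f : MvPowerSeries (Fin (n + 2)) (Polynomial 𝕜))
    (m : Fin (n + 2) →₀ ℕ) :
    coeff m (smallTimeDerivation 𝕜 n f) = Polynomial.derivative (coeff m f) := rfl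

/-- The genus zero flow on the small phase space, after elimination of the descendants by the
dilaton equation. -/
def IsSmallFlow (u : MvPowerSeries (Fin (n + 2)) (Polynomial 𝕜)) : Prop :=
  smallTimeDerivation 𝕜 n u = X (Fin.last (n + 1)) * shiftedEuler 2 u -
    (1 / 2 : ℚ) • (pderiv (Polynomial 𝕜) 0 u * pderiv (Polynomial 𝕜) 0 u)

theorem restrictPrimary_X {K : Type*} [CommRing K] (μ : Fin (n + 2)) :
    restrictPrimary K n (X ((0 : ℕ), μ)) = X μ := by
  classical
  ext m
  rw [coeff_restrictPrimary, coeff_X, coeff_X, ← primary_single]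
  refine if_congr primary_injective.eq_iff rfl rfl

/-- On the small phase space only `t^{0,n} ∂_{1,1}` survives of the vector field, and the dilaton
equation replaces `∂_{1,1}` by `E - 2`. -/
theorem isSmallFlow_restrictPrimary {w : MvPowerSeries (Label n) (Polynomial 𝕜)}
    (hw : timeDerivation 𝕜 n w = shiftDerivation (Polynomial 𝕜) n w - (1 / 2 : ℚ) •
        (unitDerivation (Polynomial 𝕜) n w * unitDerivation (Polynomial 𝕜) n w))
    (hd : dilatonDerivation (Polynomial 𝕜) n w + (2 : ℕ) • w = 0) :
    IsSmallFlow (restrictPrimary (Polynomial 𝕜) n w) := by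
  have h1 : restrictPrimary (Polynomial 𝕜) n (shiftDerivation (Polynomial 𝕜) n w) =
      X (Fin.last (n + 1)) * shiftedEuler 2 (restrictPrimary (Polynomial 𝕜) n w) := by
    have hE : restrictPrimary (Polynomial 𝕜) n (pderiv (Polynomial 𝕜) (1, 0) w) =
        shiftedEuler 2 (restrictPrimary (Polynomial 𝕜) n w) := by
      ext1 m
      have h := congrArg (coeff (primary m)) hd
      rw [map_add, coeff_dilatonDerivation, ← coeff_pderiv, map_nsmul, map_zero, degree_primary,
        nsmul_eq_mul] at h
      rw [coeff_restrictPrimary, coeff_shiftedEuler, coeff_restrictPrimary]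
      push_cast at h ⊢
      linear_combination h
    rw [← hE, ← restrictPrimary_X, ← map_mul]
    ext1 m
    refine (coeff_shiftFun w (primary m) (V := {(0, Fin.last (n + 1))}) ?_ ?_).trans ?_
    · intro v hv
      rw [mem_lastLabels] at hv
      obtain ⟨d, μ⟩ := v
      cases d with
      | zero => exact Finset.mem_singleton.2 (Prod.ext rfl hv.2)
      | succ d => exact absurd (primary_succ_apply m d μ) hv.1
    · intro v hv
      rw [Finset.mem_singleton.1 hv]
    · rw [Finset.sum_singleton]
      rfl
  have h2 : restrictPrimary (Polynomial 𝕜) n (timeDerivation 𝕜 n w) =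
      smallTimeDerivation 𝕜 n (restrictPrimary (Polynomial 𝕜) n w) := rfl
  have h3 : restrictPrimary (Polynomial 𝕜) n (unitDerivation (Polynomial 𝕜) n w) =
      pderiv (Polynomial 𝕜) 0 (restrictPrimary (Polynomial 𝕜) n w) := restrictPrimary_pderiv 0 w
  rw [IsSmallFlow, ← h1, ← h2, hw, map_sub, map_rat_smul (restrictPrimary (Polynomial 𝕜) n),
    map_mul, h3]

theorem IsSmallFlow.eq {u v : MvPowerSeries (Fin (n + 2)) (Polynomial 𝕜)} (hu : IsSmallFlow u)
    (hv : IsSmallFlow v) (h0 : ∀ m, (coeff m u).eval 0 = (coeff m v).eval 0) : u = v := by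
  have key : smallTimeDerivation 𝕜 n (u - v) = X (Fin.last (n + 1)) * shiftedEuler 2 (u - v) -
      (1 / 2 : ℚ) • ((pderiv (Polynomial 𝕜) 0 u + pderiv (Polynomial 𝕜) 0 v) *
        pderiv (Polynomial 𝕜) 0 (u - v)) := by
    rw [map_sub, hu, hv, shiftedEuler_sub, map_sub, mul_sub]
    rw [show (pderiv (Polynomial 𝕜) 0 u + pderiv (Polynomial 𝕜) 0 v) *
        (pderiv (Polynomial 𝕜) 0 u - pderiv (Polynomial 𝕜) 0 v) =
      pderiv (Polynomial 𝕜) 0 u * pderiv (Polynomial 𝕜) 0 u -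
        pderiv (Polynomial 𝕜) 0 v * pderiv (Polynomial 𝕜) 0 v by ring, smul_sub]
    abel
  rw [← sub_eq_zero]
  ext1 m
  refine eq_zero_of_evolution (fun m => coeff m (u - v)) (fun m => ?_) (fun i hi m => ?_) m
  · rw [map_sub, Polynomial.eval_sub, h0, sub_self]
  · rw [← coeff_smallTimeDerivation, key, map_sub, map_rat_smul (coeff m), Algebra.smul_def]
    refine dvd_sub (dvd_coeff_mul (fun m => ?_) m)
      (Dvd.dvd.mul_left (dvd_coeff_mul (fun m => ?_) m) _)
    · rw [coeff_shiftedEuler]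
      exact Dvd.dvd.mul_left (hi m) _
    · rw [coeff_pderiv]
      exact Dvd.dvd.mul_right (hi _) _

/-- The quadratic form `∑ t^μ t_μ` in the variables different from the first and the last one. -/
def middleForm (R : Type*) [CommRing R] (n : ℕ) : MvPowerSeries (Fin (n + 2)) R :=
  ∑ i : Fin n, X i.succ.castSucc * X i.succ.castSucc.rev

/-- The cubic `½ x² y + ½ x q`, where `x` and `y` are the first and the last variable, and `q` is
the quadratic form in the others. -/
def unitCubic (R : Type*) [CommRing R] [Algebra ℚ R] (n : ℕ) : MvPowerSeries (Fin (n + 2)) R :=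
  (1 / 2 : ℚ) • (X 0 * X 0 * X (Fin.last (n + 1)) + X 0 * middleForm R n)

/-- A power series is homogeneous of degree `d`. -/
def IsHomogeneousOfDegree {σ R : Type*} [CommRing R] (f : MvPowerSeries σ R) (d : ℕ) : Prop :=
  ∀ m : σ →₀ ℕ, m.degree ≠ d → coeff m f = 0

theorem IsHomogeneousOfDegree.mul {σ R : Type*} [CommRing R] {f g : MvPowerSeries σ R} {d e : ℕ}
    (hf : IsHomogeneousOfDegree f d) (hg : IsHomogeneousOfDegree g e) :
    IsHomogeneousOfDegree (f * g) (d + e) := by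
  classical
  intro m hm
  rw [coeff_mul]
  refine Finset.sum_eq_zero fun p hp => ?_
  have h := congrArg Finsupp.degree (Finset.HasAntidiagonal.mem_antidiagonal.1 hp)
  rw [map_add] at h
  by_cases h1 : p.1.degree = d
  · rw [hg p.2 (by omega), mul_zero]
  · rw [hf p.1 h1, zero_mul]

theorem isHomogeneousOfDegree_X {σ R : Type*} [CommRing R] (v : σ) :
    IsHomogeneousOfDegree (X v : MvPowerSeries σ R) 1 := by
  classical
  intro m hm
  rw [coeff_X, if_neg]
  rintro rfl
  simp [Finsupp.degree_single] at hm

theorem isHomogeneousOfDegree_middleForm (R : Type*) [CommRing R] (n : ℕ) :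
    IsHomogeneousOfDegree (middleForm R n) 2 := by
  intro m hm
  rw [middleForm, map_sum]
  exact Finset.sum_eq_zero fun i _ =>
    ((isHomogeneousOfDegree_X _).mul (isHomogeneousOfDegree_X _)) m hm

theorem isHomogeneousOfDegree_unitCubic (R : Type*) [CommRing R] [Algebra ℚ R] (n : ℕ) :
    IsHomogeneousOfDegree (unitCubic R n) 3 := by
  intro m hm
  rw [unitCubic, map_rat_smul (coeff m), map_add,
    (((isHomogeneousOfDegree_X _).mul (isHomogeneousOfDegree_X _)).mul
      (isHomogeneousOfDegree_X _)) m hm,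
    ((isHomogeneousOfDegree_X _).mul (isHomogeneousOfDegree_middleForm R n)) m hm, add_zero,
    smul_zero]

theorem pderiv_zero_middleForm (R : Type*) [CommRing R] (n : ℕ) :
    pderiv R 0 (middleForm R n) = 0 := by
  rw [middleForm, map_sum]
  refine Finset.sum_eq_zero fun i _ => ?_
  have h1 : i.succ.castSucc ≠ (0 : Fin (n + 2)) := by
    intro h; simp [Fin.ext_iff] at h
  have h2 : i.succ.castSucc.rev ≠ (0 : Fin (n + 2)) := by
    intro h; simp [Fin.ext_iff, Fin.val_rev] at h; omega
  rw [Derivation.leibniz, pderiv_X_of_ne h1, pderiv_X_of_ne h2, smul_zero, smul_zero, add_zero]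

theorem two_mul_algebraMap_half (S : Type*) [CommRing S] [Algebra ℚ S] :
    2 * algebraMap ℚ S (1 / 2) = 1 := by
  rw [← map_ofNat (algebraMap ℚ S) 2, ← map_mul]
  norm_num

theorem pderiv_zero_unitCubic (R : Type*) [CommRing R] [Algebra ℚ R] (n : ℕ) :
    pderiv R 0 (unitCubic R n) =
      X 0 * X (Fin.last (n + 1)) + (1 / 2 : ℚ) • middleForm R n := by
  have h5 : Fin.last (n + 1) ≠ 0 := by simp [Fin.ext_iff]
  rw [unitCubic, map_rat_smul (pderiv R (0 : Fin (n + 2))), map_add, Derivation.leibniz,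
    Derivation.leibniz, Derivation.leibniz, pderiv_zero_middleForm, pderiv_X_self,
    pderiv_X_of_ne h5]
  simp only [smul_eq_mul, mul_zero, mul_one, zero_add]
  simp only [Algebra.smul_def]
  linear_combination (X 0 * X (Fin.last (n + 1))) *
    two_mul_algebraMap_half (MvPowerSeries (Fin (n + 2)) R)

theorem map_middleForm {R R' : Type*} [CommRing R] [CommRing R'] (φ : R →+* R') :
    MvPowerSeries.map φ (middleForm R n) = middleForm R' n := by
  rw [middleForm, middleForm, map_sum]
  simp only [map_mul, map_X]

theorem map_unitCubic {R R' : Type*} [CommRing R] [CommRing R'] [Algebra ℚ R] [Algebra ℚ R']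
    (φ : R →+* R') : MvPowerSeries.map φ (unitCubic R n) = unitCubic R' n := by
  rw [unitCubic, unitCubic, map_rat_smul (MvPowerSeries.map φ)]
  simp only [map_add, map_mul, map_X, map_middleForm]

/-- The inversion of the formal potential `½ x² y + ½ x q + h`, where `h` does not depend on `x`,
with a parameter `s`; the inversion proper is the case `s = 1`. -/
def invertedSeries {R : Type*} [CommRing R] [Algebra ℚ R] (s : R)
    (h : MvPowerSeries (Fin (n + 2)) R) : MvPowerSeries (Fin (n + 2)) R :=
  unitCubic R n + stretch 2 s h -
    (1 / 8 : ℚ) • (C s * stretch 3 s (middleForm R n * middleForm R n))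

theorem map_invertedSeries {R R' : Type*} [CommRing R] [CommRing R'] [Algebra ℚ R] [Algebra ℚ R']
    (φ : R →+* R') (s : R) (h : MvPowerSeries (Fin (n + 2)) R) :
    MvPowerSeries.map φ (invertedSeries s h) = invertedSeries (φ s) (MvPowerSeries.map φ h) := by
  rw [invertedSeries, invertedSeries, map_sub, map_rat_smul (MvPowerSeries.map φ), map_add,
    map_mul, map_unitCubic, map_stretch, map_stretch, map_mul, map_middleForm, map_C]

theorem smallTimeDerivation_map_C (f : MvPowerSeries (Fin (n + 2)) 𝕜) :
    smallTimeDerivation 𝕜 n (MvPowerSeries.map Polynomial.C f) = 0 := by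
  ext1 m
  rw [coeff_smallTimeDerivation, coeff_map, Polynomial.derivative_C, map_zero]

theorem smallTimeDerivation_stretch (k : ℤ) (h : MvPowerSeries (Fin (n + 2)) 𝕜) :
    smallTimeDerivation 𝕜 n (stretch k Polynomial.X (MvPowerSeries.map Polynomial.C h)) =
      X (Fin.last (n + 1)) *
        shiftedEuler k (stretch k Polynomial.X (MvPowerSeries.map Polynomial.C h)) := by
  ext1 m
  rw [coeff_smallTimeDerivation, derivative_coeff_stretch]

/-- The explicit solution of the genus zero flow on the small phase space. -/
theorem isSmallFlow_invertedSeries {h : MvPowerSeries (Fin (n + 2)) 𝕜} (h0 : pderiv 𝕜 0 h = 0) :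
    IsSmallFlow (invertedSeries Polynomial.X (MvPowerSeries.map Polynomial.C h)) := by
  classical
  have h5 : (0 : Fin (n + 2)) ≠ Fin.last (n + 1) := by simp [Fin.ext_iff]
  set q := middleForm (Polynomial 𝕜) n with hq
  set κ := unitCubic (Polynomial 𝕜) n with hκ
  set c : MvPowerSeries (Fin (n + 2)) (Polynomial 𝕜) := C Polynomial.X with hc
  set S2 := stretch 2 Polynomial.X (MvPowerSeries.map Polynomial.C h) with hS2
  set S3 := stretch 3 Polynomial.X (q * q) with hS3
  have hqq : q * q = MvPowerSeries.map Polynomial.C (middleForm 𝕜 n * middleForm 𝕜 n) := by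
    rw [map_mul, map_middleForm]
  -- the derivatives with respect to the first variable
  have hx : pderiv (Polynomial 𝕜) 0 (invertedSeries Polynomial.X (MvPowerSeries.map Polynomial.C h))
      = X 0 * X (Fin.last (n + 1)) + (1 / 2 : ℚ) • q := by
    have e1 : pderiv (Polynomial 𝕜) 0 (MvPowerSeries.map Polynomial.C h) = 0 := by
      ext1 m
      have := congrArg (coeff m) h0
      rw [coeff_pderiv, map_zero (coeff m)] at this
      rw [coeff_pderiv, coeff_map, map_zero (coeff m), ← Polynomial.C_eq_natCast,
        ← Polynomial.C_1, ← Polynomial.C_add, ← Polynomial.C_mul, this, Polynomial.C_0]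
    have e2 : pderiv (Polynomial 𝕜) 0 (q * q) = 0 := by
      rw [Derivation.leibniz, pderiv_zero_middleForm, smul_zero, add_zero]
    rw [invertedSeries, map_sub, map_add, map_rat_smul (pderiv (Polynomial 𝕜) (0 : Fin (n + 2))),
      Derivation.leibniz, pderiv_stretch_of_ne _ _ _ h5, pderiv_stretch_of_ne _ _ _ h5, e1, e2,
      stretch_zero, stretch_zero, pderiv_C, pderiv_zero_unitCubic, smul_zero, smul_zero, add_zero,
      add_zero, smul_zero, sub_zero]
  -- the time derivatives
  have ht1 : smallTimeDerivation 𝕜 n κ = 0 := by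
    rw [hκ, ← map_unitCubic Polynomial.C, smallTimeDerivation_map_C]
  have ht2 : smallTimeDerivation 𝕜 n c = 1 := by
    ext1 m
    rw [coeff_smallTimeDerivation, hc, coeff_C, coeff_one]
    split_ifs
    · exact Polynomial.derivative_X
    · exact Polynomial.derivative_zero
  have ht3 : smallTimeDerivation 𝕜 n S3 = X (Fin.last (n + 1)) * shiftedEuler 3 S3 := by
    rw [hS3, hqq, smallTimeDerivation_stretch]
  have hE : shiftedEuler 2 S3 = shiftedEuler 3 S3 + S3 := by
    ext1 m
    rw [map_add, coeff_shiftedEuler, coeff_shiftedEuler]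
    push_cast
    ring
  have hEκ : shiftedEuler 2 κ = κ := by
    rw [hκ, shiftedEuler_of_homogeneous 2 (isHomogeneousOfDegree_unitCubic _ n)]
    norm_num
  have hP : S3 - c * (X (Fin.last (n + 1)) * S3) = q * q := by
    rw [hS3, hc, stretch_sub_mul]
    exact stretch_of_homogeneous (d := 4) _
      ((isHomogeneousOfDegree_middleForm _ n).mul (isHomogeneousOfDegree_middleForm _ n))
  have hhom : ∀ f : MvPowerSeries (Fin (n + 2)) (Polynomial 𝕜),
      shiftedEuler 2 ((1 / 8 : ℚ) • f) = (1 / 8 : ℚ) • shiftedEuler 2 f := by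
    intro f
    ext1 m
    rw [coeff_shiftedEuler, map_rat_smul (coeff m), map_rat_smul (coeff m), coeff_shiftedEuler,
      mul_smul_comm]
  rw [IsSmallFlow, hx, invertedSeries, map_sub, map_add, ht1, hS2.symm, smallTimeDerivation_stretch,
    ← hS2, map_rat_smul (smallTimeDerivation 𝕜 n), AddDerivation.leibniz, ht2, ht3,
    shiftedEuler_sub, shiftedEuler_add, hEκ, hhom, shiftedEuler_C_mul, hE, hκ, unitCubic, ← hq]
  simp only [Algebra.smul_def]
  set a := algebraMap ℚ (MvPowerSeries (Fin (n + 2)) (Polynomial 𝕜)) (1 / 2) with ha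
  have ha8 : algebraMap ℚ (MvPowerSeries (Fin (n + 2)) (Polynomial 𝕜)) (1 / 8) = a * a * a := by
    rw [ha, ← map_mul, ← map_mul]
    norm_num
  have ha1 : 2 * a = 1 := two_mul_algebraMap_half _
  rw [ha8, ← hS3, ← hc]
  linear_combination (-(a * a * a)) * hP +
    (a * X 0 * X (Fin.last (n + 1)) * q) * ha1

end SmallFlow


/-! ### Taylor expansions of smooth functions -/

section Taylor

open MvPowerSeries Topology

variable {𝕜 : Type*} [RCLike 𝕜] {n : ℕ}

/-- Smoothness in a neighbourhood of a point. -/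
def SmoothNear (f : (Fin (n + 2) → 𝕜) → 𝕜) (p : Fin (n + 2) → 𝕜) : Prop :=
  ∀ᶠ t in 𝓝 p, ContDiffAt 𝕜 ((⊤ : ℕ∞) : WithTop ℕ∞) f t

variable {f g : (Fin (n + 2) → 𝕜) → 𝕜} {p : Fin (n + 2) → 𝕜}

theorem SmoothNear.eventually_differentiableAt (hf : SmoothNear f p) :
    ∀ᶠ t in 𝓝 p, DifferentiableAt 𝕜 f t :=
  hf.mono fun _ ht => ht.differentiableAt (by simp)

theorem SmoothNear.add (hf : SmoothNear f p) (hg : SmoothNear g p) :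
    SmoothNear (fun t => f t + g t) p := by
  filter_upwards [hf, hg] with t h1 h2 using h1.add h2

theorem SmoothNear.mul (hf : SmoothNear f p) (hg : SmoothNear g p) :
    SmoothNear (fun t => f t * g t) p := by
  filter_upwards [hf, hg] with t h1 h2 using h1.mul h2

theorem SmoothNear.sub (hf : SmoothNear f p) (hg : SmoothNear g p) :
    SmoothNear (fun t => f t - g t) p := by
  filter_upwards [hf, hg] with t h1 h2 using h1.sub h2

theorem smoothNear_const (c : 𝕜) : SmoothNear (fun _ => c) p :=
  Eventually.of_forall fun _ => contDiffAt_const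

theorem smoothNear_coord (α : Fin (n + 2)) : SmoothNear (fun t => t α) p :=
  Eventually.of_forall fun _ => (contDiff_apply 𝕜 𝕜 α).contDiffAt

theorem SmoothNear.sum {ι : Type*} (s : Finset ι) {f : ι → (Fin (n + 2) → 𝕜) → 𝕜}
    (hf : ∀ i ∈ s, SmoothNear (f i) p) : SmoothNear (fun t => ∑ i ∈ s, f i t) p := by
  have := (Finset.eventually_all s).2 hf
  filter_upwards [this] with t ht using ContDiffAt.sum ht

theorem SmoothNear.partialD (hf : SmoothNear f p) (α : Fin (n + 2)) :
    SmoothNear (partialD α f) p := by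
  filter_upwards [hf] with t ht
  exact (ht.fderiv_right (by rfl)).clm_apply contDiffAt_const

theorem partialD_congr (h : f =ᶠ[𝓝 p] g) (α : Fin (n + 2)) :
    partialD α f =ᶠ[𝓝 p] partialD α g := by
  filter_upwards [h.fderiv (𝕜 := 𝕜)] with t ht
  rw [partialD, partialD, ht]

theorem partialD_const (α : Fin (n + 2)) (c : 𝕜) :
    partialD α (fun _ : Fin (n + 2) → 𝕜 => c) = fun _ => 0 := by
  funext t
  simp [partialD]

theorem partialD_coord (α β : Fin (n + 2)) :
    partialD α (fun t : Fin (n + 2) → 𝕜 => t β) = fun _ => if β = α then 1 else 0 := by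
  funext t
  rw [partialD, (hasFDerivAt_apply β t).fderiv]
  simp [Pi.single_apply]

theorem partialD_add_apply {t : Fin (n + 2) → 𝕜} (hf : DifferentiableAt 𝕜 f t)
    (hg : DifferentiableAt 𝕜 g t) (α : Fin (n + 2)) :
    partialD α (fun t => f t + g t) t = partialD α f t + partialD α g t := by
  rw [partialD, fderiv_fun_add hf hg]
  rfl

theorem partialD_sub_apply {t : Fin (n + 2) → 𝕜} (hf : DifferentiableAt 𝕜 f t)
    (hg : DifferentiableAt 𝕜 g t) (α : Fin (n + 2)) :
    partialD α (fun t => f t - g t) t = partialD α f t - partialD α g t := by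
  rw [partialD, fderiv_fun_sub hf hg]
  rfl

theorem partialD_mul_apply {t : Fin (n + 2) → 𝕜} (hf : DifferentiableAt 𝕜 f t)
    (hg : DifferentiableAt 𝕜 g t) (α : Fin (n + 2)) :
    partialD α (fun t => f t * g t) t = partialD α f t * g t + f t * partialD α g t := by
  rw [partialD, fderiv_fun_mul hf hg]
  simp only [add_apply, smul_apply, smul_eq_mul, partialD]
  ring

theorem partialD_add (hf : SmoothNear f p) (hg : SmoothNear g p) (α : Fin (n + 2)) :
    partialD α (fun t => f t + g t) =ᶠ[𝓝 p] fun t => partialD α f t + partialD α g t := by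
  filter_upwards [hf.eventually_differentiableAt, hg.eventually_differentiableAt] with t h1 h2
    using partialD_add_apply h1 h2 α

theorem partialD_mul (hf : SmoothNear f p) (hg : SmoothNear g p) (α : Fin (n + 2)) :
    partialD α (fun t => f t * g t) =ᶠ[𝓝 p]
      fun t => partialD α f t * g t + f t * partialD α g t := by
  filter_upwards [hf.eventually_differentiableAt, hg.eventually_differentiableAt] with t h1 h2
    using partialD_mul_apply h1 h2 α

theorem partialD_partialD_apply {t : Fin (n + 2) → 𝕜}
    (hf : ContDiffAt 𝕜 ((⊤ : ℕ∞) : WithTop ℕ∞) f t) (α β : Fin (n + 2)) :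
    partialD α (partialD β f) t =
      fderiv 𝕜 (fderiv 𝕜 f) t (Pi.single α 1) (Pi.single β 1) := by
  have h1 : DifferentiableAt 𝕜 (fderiv 𝕜 f) t :=
    (hf.fderiv_right (m := ((⊤ : ℕ∞) : WithTop ℕ∞)) (by rfl)).differentiableAt (by simp)
  have h2 : fderiv 𝕜 (fun s => fderiv 𝕜 f s (Pi.single β 1)) t =
      (fderiv 𝕜 (fderiv 𝕜 f) t).flip (Pi.single β 1) := by
    rw [fderiv_clm_apply h1 (differentiableAt_const _)]
    simp
  change fderiv 𝕜 (fun s => fderiv 𝕜 f s (Pi.single β 1)) t _ = _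
  rw [h2]
  rfl

theorem partialD_comm (hf : SmoothNear f p) (α β : Fin (n + 2)) :
    partialD α (partialD β f) =ᶠ[𝓝 p] partialD β (partialD α f) := by
  filter_upwards [hf] with t ht
  rw [partialD_partialD_apply ht, partialD_partialD_apply ht]
  exact (ht.isSymmSndFDerivAt (by
    rw [minSmoothness_of_isRCLikeNormedField]
    exact WithTop.coe_le_coe.2 (le_top : (2 : ℕ∞) ≤ ⊤))) _ _

theorem iterate_partialD_congr (h : f =ᶠ[𝓝 p] g) (α : Fin (n + 2)) (k : ℕ) :
    (partialD α)^[k] f =ᶠ[𝓝 p] (partialD α)^[k] g := by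
  induction k with
  | zero => exact h
  | succ k ih =>
    rw [Function.iterate_succ_apply', Function.iterate_succ_apply']
    exact partialD_congr ih α

theorem SmoothNear.iterate_partialD (hf : SmoothNear f p) (α : Fin (n + 2)) (k : ℕ) :
    SmoothNear ((Givental.partialD α)^[k] f) p := by
  induction k with
  | zero => exact hf
  | succ k ih =>
    rw [Function.iterate_succ_apply']
    exact ih.partialD α

theorem iterate_partialD_comm (hf : SmoothNear f p) (α β : Fin (n + 2)) (k : ℕ) :
    (partialD α)^[k] (partialD β f) =ᶠ[𝓝 p] partialD β ((partialD α)^[k] f) := by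
  induction k with
  | zero => exact EventuallyEq.rfl
  | succ k ih =>
    rw [Function.iterate_succ_apply', Function.iterate_succ_apply']
    exact (partialD_congr ih α).trans (partialD_comm (hf.iterate_partialD α k) α β)

/-- Iterated partial derivatives in the directions of a list. -/
def listPartialD (l : List (Fin (n + 2))) (m : Fin (n + 2) → ℕ) (f : (Fin (n + 2) → 𝕜) → 𝕜) :
    (Fin (n + 2) → 𝕜) → 𝕜 :=
  l.foldr (fun α g => (partialD α)^[m α] g) f

theorem listPartialD_cons (α : Fin (n + 2)) (l : List (Fin (n + 2))) (m : Fin (n + 2) → ℕ) :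
    listPartialD (α :: l) m f = (partialD α)^[m α] (listPartialD l m f) := rfl

theorem listPartialD_congr (h : f =ᶠ[𝓝 p] g) (l : List (Fin (n + 2))) (m : Fin (n + 2) → ℕ) :
    listPartialD l m f =ᶠ[𝓝 p] listPartialD l m g := by
  induction l with
  | nil => exact h
  | cons α l ih => exact iterate_partialD_congr ih α _

theorem SmoothNear.listPartialD (hf : SmoothNear f p) (l : List (Fin (n + 2)))
    (m : Fin (n + 2) → ℕ) : SmoothNear (listPartialD l m f) p := by
  induction l with
  | nil => exact hf
  | cons α l ih => exact ih.iterate_partialD α _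

theorem listPartialD_comm (hf : SmoothNear f p) (β : Fin (n + 2)) (l : List (Fin (n + 2)))
    (m : Fin (n + 2) → ℕ) :
    listPartialD l m (partialD β f) =ᶠ[𝓝 p] partialD β (listPartialD l m f) := by
  induction l with
  | nil => exact EventuallyEq.rfl
  | cons α l ih =>
    exact (iterate_partialD_congr ih α _).trans
      (iterate_partialD_comm (hf.listPartialD l m) α β _)

theorem listPartialD_eq_of_forall_mem {l : List (Fin (n + 2))} {m m' : Fin (n + 2) → ℕ}
    (h : ∀ α ∈ l, m α = m' α) : listPartialD l m f = listPartialD l m' f := by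
  induction l with
  | nil => rfl
  | cons α l ih =>
    rw [listPartialD_cons, listPartialD_cons, h α List.mem_cons_self,
      ih fun β hβ => h β (List.mem_cons_of_mem α hβ)]

theorem listPartialD_partialD (hf : SmoothNear f p) {l : List (Fin (n + 2))} (hl : l.Nodup)
    {β : Fin (n + 2)} (hβ : β ∈ l) {m m' : Fin (n + 2) → ℕ} (h1 : m' β = m β + 1)
    (h2 : ∀ α, α ≠ β → m' α = m α) :
    listPartialD l m (partialD β f) =ᶠ[𝓝 p] listPartialD l m' f := by
  induction l with
  | nil => exact absurd hβ List.not_mem_nil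
  | cons α l ih =>
    rw [List.nodup_cons] at hl
    by_cases hα : β = α
    · subst hα
      rw [listPartialD_cons, listPartialD_cons, h1, Function.iterate_succ_apply]
      refine iterate_partialD_congr ((listPartialD_comm hf β l m).trans ?_) β _
      rw [listPartialD_eq_of_forall_mem (m := m') (m' := m) fun α hα => h2 α ?_]
      rintro rfl
      exact hl.1 hα
    · rw [listPartialD_cons, listPartialD_cons, h2 α (Ne.symm hα)]
      exact iterate_partialD_congr (ih hl.2 ((List.mem_cons.1 hβ).resolve_left hα)) α _

theorem coeff_localExpansion (f : (Fin (n + 2) → 𝕜) → 𝕜) (p : Fin (n + 2) → 𝕜)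
    (m : Fin (n + 2) →₀ ℕ) :
    coeff m (localExpansion f p) =
      (∏ α, ((m α).factorial : 𝕜))⁻¹ * listPartialD (List.finRange (n + 2)) m f p := rfl

theorem localExpansion_congr (h : f =ᶠ[𝓝 p] g) : localExpansion f p = localExpansion g p := by
  ext m
  rw [coeff_localExpansion, coeff_localExpansion, (listPartialD_congr h _ _).eq_of_nhds]

theorem constantCoeff_localExpansion (f : (Fin (n + 2) → 𝕜) → 𝕜) (p : Fin (n + 2) → 𝕜) :
    constantCoeff (localExpansion f p) = f p := by
  rw [← coeff_zero_eq_constantCoeff_apply, coeff_localExpansion]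
  have : ∀ l : List (Fin (n + 2)), listPartialD l 0 f = f := by
    intro l
    induction l with
    | nil => rfl
    | cons α l ih => rw [listPartialD_cons, ih]; rfl
  rw [Finsupp.coe_zero, this]
  simp

theorem localExpansion_partialD (hf : SmoothNear f p) (α : Fin (n + 2)) :
    localExpansion (partialD α f) p = pderiv 𝕜 α (localExpansion f p) := by
  ext m
  rw [coeff_pderiv, coeff_localExpansion, coeff_localExpansion,
    (listPartialD_partialD hf (List.nodup_finRange _) (List.mem_finRange α) (m := m)
      (m' := ⇑(m + Finsupp.single α 1 : Fin (n + 2) →₀ ℕ)) ?_ ?_).eq_of_nhds]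
  · have h1 : ∏ β, (((m + Finsupp.single α 1 : Fin (n + 2) →₀ ℕ) β).factorial : 𝕜) =
        (∏ β, ((m β).factorial : 𝕜)) * ((m α : 𝕜) + 1) := by
      rw [← Finset.mul_prod_erase _ _ (Finset.mem_univ α),
        ← Finset.mul_prod_erase _ (fun β => ((m β).factorial : 𝕜)) (Finset.mem_univ α),
        Finset.prod_congr rfl fun β hβ => by
          rw [Finsupp.add_apply, Finsupp.single_eq_of_ne (Finset.ne_of_mem_erase hβ), add_zero],
        Finsupp.add_apply, Finsupp.single_eq_same, Nat.factorial_succ]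
      push_cast
      ring
    have h2 : ((m α : 𝕜) + 1) ≠ 0 := Nat.cast_add_one_ne_zero _
    rw [h1, mul_inv]
    field_simp
  · simp
  · intro β hβ
    simp [Finsupp.single_eq_of_ne hβ]

/-- A set of power series without constant terms vanishes if it is stable under the partial
derivatives. -/
theorem eq_zero_of_pderiv_mem {σ K : Type*} [Field K] [CharZero K] {S : Set (MvPowerSeries σ K)}
    (h0 : ∀ A ∈ S, constantCoeff A = 0)
    (h : ∀ A ∈ S, ∀ v, pderiv K v A ∈ AddSubgroup.closure S)
    {A : MvPowerSeries σ K} (hA : A ∈ S) : A = 0 := by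
  have key : ∀ (N : ℕ), ∀ A ∈ S, ∀ m : σ →₀ ℕ, m.degree = N → coeff m A = 0 := by
    intro N
    induction N with
    | zero =>
      intro A hA m hm
      rw [Finsupp.degree_eq_zero_iff] at hm
      subst hm
      exact h0 A hA
    | succ N ih =>
      intro A hA m hm
      obtain ⟨v, hv⟩ : ∃ v, m v ≠ 0 := by
        by_contra! hz
        rw [show m = 0 from Finsupp.ext hz, map_zero] at hm
        omega
      have hm' := sub_single_add hv
      have hd := congrArg Finsupp.degree hm'
      rw [map_add, Finsupp.degree_single] at hd
      have hcl : coeff (m - Finsupp.single v 1) (pderiv K v A) = 0 := by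
        refine AddSubgroup.closure_induction (p := fun B _ =>
          coeff (m - Finsupp.single v 1) B = 0) ?_ ?_ ?_ ?_ (h A hA v)
        · exact fun B hB => ih B hB _ (by omega)
        · exact map_zero _
        · exact fun B B' _ _ hB hB' => by rw [map_add, hB, hB', add_zero]
        · exact fun B _ hB => by rw [map_neg, hB, neg_zero]
      rw [coeff_pderiv, hm'] at hcl
      exact (mul_eq_zero.1 hcl).resolve_right (Nat.cast_add_one_ne_zero _)
  ext m
  exact key _ A hA m rfl

theorem localExpansion_add (hf : SmoothNear f p) (hg : SmoothNear g p) :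
    localExpansion (fun t => f t + g t) p = localExpansion f p + localExpansion g p := by
  let S : Set (MvPowerSeries (Fin (n + 2)) 𝕜) := {A | ∃ f g, SmoothNear f p ∧ SmoothNear g p ∧
    A = localExpansion (fun t => f t + g t) p - (localExpansion f p + localExpansion g p)}
  refine sub_eq_zero.1 (eq_zero_of_pderiv_mem (S := S) ?_ ?_ ⟨f, g, hf, hg, rfl⟩)
  · rintro _ ⟨f, g, -, -, rfl⟩
    simp only [map_sub, map_add, constantCoeff_localExpansion, sub_self]
  · rintro _ ⟨f, g, hf, hg, rfl⟩ α
    refine AddSubgroup.subset_closure ⟨_, _, hf.partialD α, hg.partialD α, ?_⟩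
    rw [map_sub, map_add, ← localExpansion_partialD hf, ← localExpansion_partialD hg,
      ← localExpansion_partialD (hf.add hg), localExpansion_congr (partialD_add hf hg α)]

theorem localExpansion_mul (hf : SmoothNear f p) (hg : SmoothNear g p) :
    localExpansion (fun t => f t * g t) p = localExpansion f p * localExpansion g p := by
  let S : Set (MvPowerSeries (Fin (n + 2)) 𝕜) := {A | ∃ f g, SmoothNear f p ∧ SmoothNear g p ∧
    A = localExpansion (fun t => f t * g t) p - localExpansion f p * localExpansion g p}
  refine sub_eq_zero.1 (eq_zero_of_pderiv_mem (S := S) ?_ ?_ ⟨f, g, hf, hg, rfl⟩)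
  · rintro _ ⟨f, g, -, -, rfl⟩
    simp only [map_sub, map_mul, constantCoeff_localExpansion, sub_self]
  · rintro _ ⟨f, g, hf, hg, rfl⟩ α
    have e : pderiv 𝕜 α (localExpansion (fun t => f t * g t) p -
        localExpansion f p * localExpansion g p) =
        (localExpansion (fun t => partialD α f t * g t) p -
          localExpansion (partialD α f) p * localExpansion g p) +
        (localExpansion (fun t => f t * partialD α g t) p -
          localExpansion f p * localExpansion (partialD α g) p) := by
      rw [map_sub, ← localExpansion_partialD (hf.mul hg), Derivation.leibniz,
        localExpansion_congr (partialD_mul hf hg α),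
        localExpansion_add ((hf.partialD α).mul hg) (hf.mul (hg.partialD α)),
        localExpansion_partialD hf, localExpansion_partialD hg, smul_eq_mul, smul_eq_mul]
      ring
    rw [e]
    exact add_mem (AddSubgroup.subset_closure ⟨_, _, hf.partialD α, hg, rfl⟩)
      (AddSubgroup.subset_closure ⟨_, _, hf, hg.partialD α, rfl⟩)

theorem localExpansion_const (c : 𝕜) :
    localExpansion (fun _ => c) p = C c := by
  have h0 : localExpansion (fun _ => (0 : 𝕜)) p = 0 := by
    refine eq_zero_of_pderiv_mem (S := {localExpansion (fun _ => (0 : 𝕜)) p}) ?_ ?_ rfl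
    · rintro _ rfl
      exact constantCoeff_localExpansion _ _
    · rintro _ rfl α
      refine AddSubgroup.subset_closure ?_
      rw [← localExpansion_partialD (smoothNear_const 0), partialD_const]
      rfl
  refine eq_of_pderiv_eq ?_ fun α => ?_
  · rw [constantCoeff_localExpansion, constantCoeff_C]
  · rw [← localExpansion_partialD (smoothNear_const c), partialD_const, h0, pderiv_C]

theorem localExpansion_coord (α : Fin (n + 2)) :
    localExpansion (fun t => t α) p = X α + C (p α) := by
  classical
  refine eq_of_pderiv_eq ?_ fun β => ?_
  · rw [constantCoeff_localExpansion, map_add, constantCoeff_C, constantCoeff_X, zero_add]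
  · rw [← localExpansion_partialD (smoothNear_coord α), partialD_coord, localExpansion_const,
      map_add, pderiv_C, add_zero]
    split_ifs with h
    · rw [h, pderiv_X_self, map_one]
    · rw [pderiv_X_of_ne h, map_zero]

theorem localExpansion_const_mul (c : 𝕜) (hf : SmoothNear f p) :
    localExpansion (fun t => c * f t) p = C c * localExpansion f p := by
  rw [localExpansion_mul (smoothNear_const c) hf, localExpansion_const]

theorem localExpansion_sub (hf : SmoothNear f p) (hg : SmoothNear g p) :
    localExpansion (fun t => f t - g t) p = localExpansion f p - localExpansion g p := by
  rw [eq_sub_iff_add_eq, ← localExpansion_add (hf.sub hg) hg]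
  simp only [sub_add_cancel]

theorem localExpansion_sum {ι : Type*} (s : Finset ι) {f : ι → (Fin (n + 2) → 𝕜) → 𝕜}
    (hf : ∀ i ∈ s, SmoothNear (f i) p) :
    localExpansion (fun t => ∑ i ∈ s, f i t) p = ∑ i ∈ s, localExpansion (f i) p := by
  classical
  induction s using Finset.induction_on with
  | empty => simpa using localExpansion_const (p := p) (0 : 𝕜)
  | insert a s ha ih =>
    simp only [Finset.sum_insert ha]
    rw [localExpansion_add (hf a (Finset.mem_insert_self a s))
      (SmoothNear.sum s fun i hi => hf i (Finset.mem_insert_of_mem hi)),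
      ih fun i hi => hf i (Finset.mem_insert_of_mem hi)]

end Taylor


/-! ### The Taylor expansion of the inverted potential -/

section Inversion

open MvPowerSeries Topology

variable {𝕜 : Type*} [RCLike 𝕜] {n : ℕ}

theorem last_ne_zero : Fin.last (n + 1) ≠ 0 := by simp [Fin.ext_iff]

theorem middle_ne_zero (i : Fin n) : i.succ.castSucc ≠ (0 : Fin (n + 2)) := by
  intro h; simp [Fin.ext_iff] at h

theorem middle_ne_last (i : Fin n) : i.succ.castSucc ≠ Fin.last (n + 1) := by
  intro h; simp [Fin.ext_iff] at h; omega

theorem middle_rev_ne_zero (i : Fin n) : i.succ.castSucc.rev ≠ (0 : Fin (n + 2)) := by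
  intro h; simp [Fin.ext_iff, Fin.val_rev] at h; omega

theorem middle_rev_ne_last (i : Fin n) : i.succ.castSucc.rev ≠ Fin.last (n + 1) := by
  intro h; simp [Fin.ext_iff, Fin.val_rev] at h; omega

/-- The function `(-t̂^n)^k h(t)`, where `t` is the point with the coordinates `t̂`. -/
def pullback (k : ℤ) (h : (Fin (n + 2) → 𝕜) → 𝕜) : (Fin (n + 2) → 𝕜) → 𝕜 := fun s =>
  (-s (Fin.last (n + 1))) ^ k * h (inversionInv s)

theorem inversionInv_apply_last (s : Fin (n + 2) → 𝕜) :
    inversionInv s (Fin.last (n + 1)) = -1 / s (Fin.last (n + 1)) := by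
  rw [inversionInv, if_neg last_ne_zero, if_pos rfl]

theorem inversionInv_apply_of_ne (s : Fin (n + 2) → 𝕜) {j : Fin (n + 2)} (h0 : j ≠ 0)
    (hL : j ≠ Fin.last (n + 1)) : inversionInv s j = -(s j / s (Fin.last (n + 1))) := by
  rw [inversionInv, if_neg h0, if_neg hL]

theorem inversionInv_single :
    inversionInv (Pi.single (Fin.last (n + 1)) (-1) : Fin (n + 2) → 𝕜) =
      Pi.single (Fin.last (n + 1)) 1 := by
  funext j
  by_cases hL : j = Fin.last (n + 1)
  · subst hL
    rw [inversionInv_apply_last, Pi.single_eq_same, Pi.single_eq_same]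
    norm_num
  by_cases h0 : j = 0
  · subst h0
    rw [inversionInv, if_pos rfl, etaSq_eq, Pi.single_eq_of_ne hL, Pi.single_eq_of_ne hL,
      Finset.sum_eq_zero fun i _ => by rw [Pi.single_eq_of_ne (middle_ne_last i), zero_mul]]
    simp
  · rw [inversionInv_apply_of_ne _ h0 hL, Pi.single_eq_of_ne hL, Pi.single_eq_of_ne hL]
    simp

theorem contDiffAt_etaSq (s : Fin (n + 2) → 𝕜) :
    ContDiffAt 𝕜 ((⊤ : ℕ∞) : WithTop ℕ∞) (etaSq : (Fin (n + 2) → 𝕜) → 𝕜) s := by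
  unfold etaSq
  fun_prop

theorem contDiffAt_inversionInv {s : Fin (n + 2) → 𝕜} (hs : s (Fin.last (n + 1)) ≠ 0) :
    ContDiffAt 𝕜 ((⊤ : ℕ∞) : WithTop ℕ∞) (inversionInv : (Fin (n + 2) → 𝕜) → _) s := by
  rw [contDiffAt_pi]
  intro j
  have hc : ∀ j, ContDiffAt 𝕜 ((⊤ : ℕ∞) : WithTop ℕ∞) (fun s : Fin (n + 2) → 𝕜 => s j) s :=
    fun j => (contDiff_apply 𝕜 𝕜 j).contDiffAt
  unfold inversionInv
  split_ifs
  · exact contDiffAt_const.mul ((contDiffAt_etaSq s).div (hc _) hs)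
  · exact contDiffAt_const.div (hc _) hs
  · exact ((hc j).div (hc _) hs).neg

theorem eventually_last_ne_zero {p : Fin (n + 2) → 𝕜} (hp : p (Fin.last (n + 1)) ≠ 0) :
    ∀ᶠ s in 𝓝 p, s (Fin.last (n + 1)) ≠ 0 :=
  (continuous_apply (Fin.last (n + 1))).continuousAt.eventually_ne hp

variable {h : (Fin (n + 2) → 𝕜) → 𝕜} {p : Fin (n + 2) → 𝕜}

theorem eventually_inversionInv (hp : p (Fin.last (n + 1)) ≠ 0) {P : (Fin (n + 2) → 𝕜) → Prop}
    (hP : ∀ᶠ t in 𝓝 (inversionInv p), P t) : ∀ᶠ s in 𝓝 p, P (inversionInv s) :=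
  (contDiffAt_inversionInv hp).continuousAt.eventually hP

theorem SmoothNear.pullback (hp : p (Fin.last (n + 1)) ≠ 0)
    (hh : SmoothNear h (inversionInv p)) (k : ℤ) : SmoothNear (pullback k h) p := by
  filter_upwards [eventually_last_ne_zero hp, eventually_inversionInv hp hh] with s hs h1
  have hc : ContDiffAt 𝕜 ((⊤ : ℕ∞) : WithTop ℕ∞)
      (fun s : Fin (n + 2) → 𝕜 => -s (Fin.last (n + 1))) s :=
    (contDiff_apply 𝕜 𝕜 _).contDiffAt.neg
  refine ContDiffAt.mul ?_ (h1.comp s (contDiffAt_inversionInv hs))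
  cases k with
  | ofNat k =>
    simp only [Int.ofNat_eq_natCast, zpow_natCast]
    exact hc.pow k
  | negSucc k =>
    simp only [zpow_negSucc]
    exact (hc.pow (k + 1)).inv (pow_ne_zero _ (neg_ne_zero.2 hs))

/-- The chain rule in coordinates. -/
theorem partialD_comp {s : Fin (n + 2) → 𝕜} {φ : (Fin (n + 2) → 𝕜) → Fin (n + 2) → 𝕜}
    (hh : DifferentiableAt 𝕜 h (φ s)) (hφ : DifferentiableAt 𝕜 φ s) (i : Fin (n + 2)) :
    partialD i (fun s => h (φ s)) s =
      ∑ j, partialD i (fun s => φ s j) s * partialD j h (φ s) := by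
  have h1 : ∀ j, partialD i (fun s => φ s j) s = fderiv 𝕜 φ s (Pi.single i 1) j := by
    intro j
    rw [partialD, fderiv_apply hφ]
    rfl
  have h2 : fderiv 𝕜 φ s (Pi.single i 1) =
      ∑ j, (fderiv 𝕜 φ s (Pi.single i 1) j) • (Pi.single j (1 : 𝕜) : Fin (n + 2) → 𝕜) :=
    pi_eq_sum_univ' _
  have h3 : fderiv 𝕜 (fun s => h (φ s)) s = (fderiv 𝕜 h (φ s)).comp (fderiv 𝕜 φ s) :=
    fderiv_comp s hh hφ
  rw [partialD, h3, ContinuousLinearMap.comp_apply, h2, map_sum]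
  refine Finset.sum_congr rfl fun j _ => ?_
  rw [map_smul, smul_eq_mul, h1]
  rfl

theorem partialD_inv_last {s : Fin (n + 2) → 𝕜} (hs : s (Fin.last (n + 1)) ≠ 0)
    (i : Fin (n + 2)) :
    partialD i (fun s : Fin (n + 2) → 𝕜 => (s (Fin.last (n + 1)))⁻¹) s =
      if Fin.last (n + 1) = i then -((s (Fin.last (n + 1))) ^ 2)⁻¹ else 0 := by
  have h1 := (hasDerivAt_inv hs).comp_hasFDerivAt s (hasFDerivAt_apply (𝕜 := 𝕜)
    (F' := fun _ : Fin (n + 2) => 𝕜) (Fin.last (n + 1)) s)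
  have h2 : partialD i (fun s : Fin (n + 2) → 𝕜 => (s (Fin.last (n + 1)))⁻¹) s = _ :=
    congrArg (fun A => A (Pi.single i 1)) h1.fderiv
  rw [h2]
  simp [Pi.single_apply]

theorem partialD_inversionInv {s : Fin (n + 2) → 𝕜} (hs : s (Fin.last (n + 1)) ≠ 0)
    (i : Fin (n + 2)) {j : Fin (n + 2)} (hj : j ≠ 0) :
    partialD i (fun s => inversionInv s j) s =
      if i = Fin.last (n + 1) then inversionInv s j * (-s (Fin.last (n + 1)))⁻¹
      else if i = j then (-s (Fin.last (n + 1)))⁻¹ else 0 := by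
  have hinv := partialD_inv_last hs i
  have hd : DifferentiableAt 𝕜 (fun s : Fin (n + 2) → 𝕜 => (s (Fin.last (n + 1)))⁻¹) s :=
    (differentiableAt_apply _ _).fun_inv hs
  by_cases hL : j = Fin.last (n + 1)
  · subst hL
    have e : (fun s : Fin (n + 2) → 𝕜 => inversionInv s (Fin.last (n + 1))) =
        fun s => (-1) * (s (Fin.last (n + 1)))⁻¹ := by
      funext s
      rw [inversionInv_apply_last]
      ring
    rw [e, partialD_mul_apply (differentiableAt_const _) hd, partialD_const, hinv,
      inversionInv_apply_last]
    by_cases hi : i = Fin.last (n + 1)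
    · rw [if_pos hi, if_pos hi.symm]
      field_simp
      ring
    · rw [if_neg hi, if_neg (Ne.symm hi), if_neg hi]
      ring
  · have e : (fun s : Fin (n + 2) → 𝕜 => inversionInv s j) =
        fun s => (-1) * s j * (s (Fin.last (n + 1)))⁻¹ := by
      funext s
      rw [inversionInv_apply_of_ne s hj hL]
      ring
    have hcj : DifferentiableAt 𝕜 (fun s : Fin (n + 2) → 𝕜 => s j) s := differentiableAt_apply _ _
    have hcm : DifferentiableAt 𝕜 (fun s : Fin (n + 2) → 𝕜 => (-1) * s j) s :=
      (differentiableAt_const _).mul hcj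
    rw [e, partialD_mul_apply hcm hd,
      partialD_mul_apply (differentiableAt_const _) hcj, partialD_const, partialD_coord, hinv,
      inversionInv_apply_of_ne s hj hL]
    by_cases hi : i = Fin.last (n + 1)
    · rw [if_pos hi, if_pos hi.symm, if_neg (by rw [hi]; exact hL)]
      field_simp
      ring
    · rw [if_neg hi, if_neg (Ne.symm hi)]
      by_cases hij : i = j
      · rw [if_pos hij, if_pos hij.symm, inv_neg]
        ring
      · rw [if_neg hij, if_neg (Ne.symm hij)]
        ring

theorem partialD_zpow_last {s : Fin (n + 2) → 𝕜} (hs : s (Fin.last (n + 1)) ≠ 0) (k : ℤ)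
    (i : Fin (n + 2)) :
    DifferentiableAt 𝕜 (fun s : Fin (n + 2) → 𝕜 => (-s (Fin.last (n + 1))) ^ k) s ∧
    partialD i (fun s : Fin (n + 2) → 𝕜 => (-s (Fin.last (n + 1))) ^ k) s =
      if i = Fin.last (n + 1) then -(k * (-s (Fin.last (n + 1))) ^ (k - 1)) else 0 := by
  have h1 : HasFDerivAt (fun s : Fin (n + 2) → 𝕜 => -s (Fin.last (n + 1)))
      (-(ContinuousLinearMap.proj (Fin.last (n + 1)) : (Fin (n + 2) → 𝕜) →L[𝕜] 𝕜)) s :=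
    (hasFDerivAt_apply (𝕜 := 𝕜) (F' := fun _ : Fin (n + 2) => 𝕜) (Fin.last (n + 1)) s).neg
  have h2 := (hasDerivAt_zpow k (-s (Fin.last (n + 1)))
    (Or.inl (neg_ne_zero.2 hs))).comp_hasFDerivAt
    s h1
  refine ⟨h2.differentiableAt, ?_⟩
  have h3 : partialD i (fun s : Fin (n + 2) → 𝕜 => (-s (Fin.last (n + 1))) ^ k) s = _ :=
    congrArg (fun A => A (Pi.single i 1)) h2.fderiv
  rw [h3]
  simp only [smul_apply, neg_apply, ContinuousLinearMap.proj_apply, Pi.single_apply, smul_eq_mul,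
    eq_comm (a := Fin.last (n + 1))]
  split_ifs <;> ring

/-- The partial derivatives of a pullback of a function that does not depend on the first
variable. -/
theorem partialD_pullback {s : Fin (n + 2) → 𝕜} (hs : s (Fin.last (n + 1)) ≠ 0)
    (hd : DifferentiableAt 𝕜 h (inversionInv s)) (h0 : partialD 0 h (inversionInv s) = 0)
    (k : ℤ) (i : Fin (n + 2)) :
    partialD i (pullback k h) s =
      if i = Fin.last (n + 1) then
        pullback (k - 1) (fun t => ∑ j, t j * partialD j h t - k * h t) s
      else pullback (k - 1) (partialD i h) s := by
  have hφ : DifferentiableAt 𝕜 (inversionInv : (Fin (n + 2) → 𝕜) → _) s :=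
    (contDiffAt_inversionInv hs).differentiableAt (by simp)
  obtain ⟨hk, hk'⟩ := partialD_zpow_last hs k i
  have hne : -s (Fin.last (n + 1)) ≠ 0 := neg_ne_zero.2 hs
  have hp1 : (-s (Fin.last (n + 1))) ^ (k - 1) =
      (-s (Fin.last (n + 1))) ^ k * (-s (Fin.last (n + 1)))⁻¹ := by
    rw [zpow_sub_one₀ hne]
  have hsum : ∑ j, partialD i (fun s => inversionInv s j) s * partialD j h (inversionInv s) =
      if i = Fin.last (n + 1) then
        (-s (Fin.last (n + 1)))⁻¹ * ∑ j, inversionInv s j * partialD j h (inversionInv s)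
      else (-s (Fin.last (n + 1)))⁻¹ * partialD i h (inversionInv s) := by
    have hterm : ∀ j, partialD i (fun s => inversionInv s j) s * partialD j h (inversionInv s) =
        (if i = Fin.last (n + 1) then inversionInv s j * (-s (Fin.last (n + 1)))⁻¹
          else if i = j then (-s (Fin.last (n + 1)))⁻¹ else 0) *
            partialD j h (inversionInv s) := by
      intro j
      by_cases hj : j = 0
      · rw [hj, h0, mul_zero, mul_zero]
      · rw [partialD_inversionInv hs i hj]
    rw [Finset.sum_congr rfl fun j _ => hterm j]
    by_cases hi : i = Fin.last (n + 1)
    · simp only [if_pos hi, Finset.mul_sum]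
      exact Finset.sum_congr rfl fun j _ => by ring
    · simp only [if_neg hi, ite_mul, zero_mul, Finset.sum_ite_eq, Finset.mem_univ, if_true]
  have hmul : partialD i (pullback k h) s = _ :=
    partialD_mul_apply (g := fun s => h (inversionInv s)) hk (hd.comp s hφ) i
  rw [hmul, hk', partialD_comp hd hφ, hsum]
  by_cases hi : i = Fin.last (n + 1)
  · simp only [if_pos hi, pullback]
    rw [hp1]
    ring
  · simp only [if_neg hi, pullback]
    rw [hp1]
    ring

theorem partialD_sum_apply {ι : Type*} (u : Finset ι) {f : ι → (Fin (n + 2) → 𝕜) → 𝕜}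
    {t : Fin (n + 2) → 𝕜} (hf : ∀ j ∈ u, DifferentiableAt 𝕜 (f j) t) (i : Fin (n + 2)) :
    partialD i (fun t => ∑ j ∈ u, f j t) t = ∑ j ∈ u, partialD i (f j) t := by
  rw [partialD, fderiv_fun_sum hf]
  simp [partialD]

theorem smoothNear_euler (hh : SmoothNear h p) (k : ℤ) :
    SmoothNear (fun t => ∑ j, t j * partialD j h t - (k : 𝕜) * h t) p :=
  (SmoothNear.sum _ fun j _ => (smoothNear_coord j).mul (hh.partialD j)).sub
    ((smoothNear_const _).mul hh)

theorem partialD_zero_partialD (hh : SmoothNear h p)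
    (h0 : partialD 0 h =ᶠ[𝓝 p] fun _ => 0) (j : Fin (n + 2)) :
    partialD 0 (partialD j h) =ᶠ[𝓝 p] fun _ => 0 := by
  refine (partialD_comm hh 0 j).trans ((partialD_congr h0 j).trans ?_)
  rw [partialD_const]

theorem partialD_zero_euler (hh : SmoothNear h p)
    (h0 : partialD 0 h =ᶠ[𝓝 p] fun _ => 0) (k : ℤ) :
    partialD 0 (fun t => ∑ j, t j * partialD j h t - (k : 𝕜) * h t) =ᶠ[𝓝 p] fun _ => 0 := by
  have d1 : ∀ᶠ t in 𝓝 p, ∀ j, DifferentiableAt 𝕜 (partialD j h) t :=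
    eventually_all.2 fun j => (hh.partialD j).eventually_differentiableAt
  have d2 : ∀ᶠ t in 𝓝 p, ∀ j, partialD 0 (partialD j h) t = 0 :=
    eventually_all.2 fun j => partialD_zero_partialD hh h0 j
  filter_upwards [hh.eventually_differentiableAt, h0, d1, d2] with t e1 e2 e3 e4
  have f1 : ∀ j ∈ (Finset.univ : Finset (Fin (n + 2))),
      DifferentiableAt 𝕜 (fun t : Fin (n + 2) → 𝕜 => t j * partialD j h t) t := fun j _ =>
    (differentiableAt_apply _ _).mul (e3 j)
  have f2 : DifferentiableAt 𝕜 (fun t => (k : 𝕜) * h t) t := (differentiableAt_const _).mul e1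
  have f3 : DifferentiableAt 𝕜 (fun t : Fin (n + 2) → 𝕜 => ∑ j, t j * partialD j h t) t :=
    DifferentiableAt.fun_sum f1
  have g1 : partialD 0 (fun t => (k : 𝕜) * h t) t = 0 := by
    rw [partialD_mul_apply (differentiableAt_const _) e1, partialD_const, e2]
    ring
  have g2 : partialD 0 (fun t : Fin (n + 2) → 𝕜 => ∑ j, t j * partialD j h t) t = 0 := by
    refine (partialD_sum_apply Finset.univ f1 0).trans (Finset.sum_eq_zero fun j _ => ?_)
    have f0 : DifferentiableAt 𝕜 (fun t : Fin (n + 2) → 𝕜 => t j) t := differentiableAt_apply j t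
    rw [partialD_mul_apply f0 (e3 j), e4 j, partialD_coord]
    by_cases hj0 : j = 0
    · rw [hj0, e2]
      ring
    · rw [if_neg hj0]
      ring
  rw [partialD_sub_apply f3 f2, g1, g2, sub_zero]

/-- The Euler field `∑ t^j ∂_j`, in coordinates centred at the base point, is `E + ∂_n`. -/
theorem localExpansion_euler (hh : SmoothNear h (Pi.single (Fin.last (n + 1)) 1)) (k : ℤ) :
    localExpansion (fun t => ∑ j, t j * partialD j h t - (k : 𝕜) * h t)
        (Pi.single (Fin.last (n + 1)) 1) =
      shiftedEuler k (localExpansion h (Pi.single (Fin.last (n + 1)) 1)) +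
        pderiv 𝕜 (Fin.last (n + 1)) (localExpansion h (Pi.single (Fin.last (n + 1)) 1)) := by
  classical
  have hs1 : ∀ j ∈ (Finset.univ : Finset (Fin (n + 2))),
      SmoothNear (fun t => t j * partialD j h t) (Pi.single (Fin.last (n + 1)) 1) := fun j _ =>
    (smoothNear_coord j).mul (hh.partialD j)
  rw [localExpansion_sub (SmoothNear.sum _ hs1) ((smoothNear_const _).mul hh),
    localExpansion_sum _ hs1, localExpansion_const_mul _ hh]
  have ht : ∀ j, localExpansion (fun t => t j * partialD j h t)
      (Pi.single (Fin.last (n + 1)) 1) =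
      X j * pderiv 𝕜 j (localExpansion h (Pi.single (Fin.last (n + 1)) 1)) +
        if j = Fin.last (n + 1) then
          pderiv 𝕜 (Fin.last (n + 1)) (localExpansion h (Pi.single (Fin.last (n + 1)) 1))
        else 0 := by
    intro j
    rw [localExpansion_mul (smoothNear_coord j) (hh.partialD j), localExpansion_coord,
      localExpansion_partialD hh, add_mul]
    congr 1
    split_ifs with hj
    · rw [hj, Pi.single_eq_same, map_one, one_mul]
    · rw [Pi.single_eq_of_ne hj, map_zero, zero_mul]
  rw [Finset.sum_congr rfl fun j _ => ht j, Finset.sum_add_distrib,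
    Finset.sum_ite_eq' Finset.univ, if_pos (Finset.mem_univ _)]
  ext m
  rw [map_sub, map_add, map_add, coeff_sum_X_mul_pderiv, coeff_shiftedEuler, coeff_C_mul]
  push_cast
  ring

/-- The Taylor expansion of a pullback under the inversion. -/
theorem localExpansion_pullback
    (hh : SmoothNear h (Pi.single (Fin.last (n + 1)) 1))
    (h0 : partialD 0 h =ᶠ[𝓝 (Pi.single (Fin.last (n + 1)) 1)] fun _ => 0) (k : ℤ) :
    localExpansion (pullback k h) (Pi.single (Fin.last (n + 1)) (-1)) =
      stretch k 1 (localExpansion h (Pi.single (Fin.last (n + 1)) 1)) := by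
  have hp' : (Pi.single (Fin.last (n + 1)) (-1) : Fin (n + 2) → 𝕜) (Fin.last (n + 1)) ≠ 0 := by
    rw [Pi.single_eq_same]
    norm_num
  have hpp : inversionInv (Pi.single (Fin.last (n + 1)) (-1) : Fin (n + 2) → 𝕜) =
    Pi.single (Fin.last (n + 1)) 1 := inversionInv_single
  let S : Set (MvPowerSeries (Fin (n + 2)) 𝕜) := {A | ∃ (h : (Fin (n + 2) → 𝕜) → 𝕜) (k : ℤ),
    SmoothNear h (Pi.single (Fin.last (n + 1)) 1) ∧
    partialD 0 h =ᶠ[𝓝 (Pi.single (Fin.last (n + 1)) 1)] (fun _ => 0) ∧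
    A = localExpansion (pullback k h) (Pi.single (Fin.last (n + 1)) (-1)) -
      stretch k 1 (localExpansion h (Pi.single (Fin.last (n + 1)) 1))}
  refine sub_eq_zero.1 (eq_zero_of_pderiv_mem (S := S) ?_ ?_ ⟨h, k, hh, h0, rfl⟩)
  · rintro _ ⟨h, k, -, -, rfl⟩
    rw [map_sub, ← coeff_zero_eq_constantCoeff_apply (stretch k 1 _),
      coeff_stretch_of_eq_zero _ _ _ (by simp), coeff_zero_eq_constantCoeff_apply,
      constantCoeff_localExpansion, constantCoeff_localExpansion, pullback, hpp,
      Pi.single_eq_same, neg_neg, one_zpow, one_mul, sub_self]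
  · rintro _ ⟨h, k, hh, h0, rfl⟩ i
    refine AddSubgroup.subset_closure ?_
    rw [← hpp] at hh h0
    -- The derivatives of a pullback are again pullbacks, with weight `k - 1`.
    have hder : partialD i (pullback k h) =ᶠ[𝓝 (Pi.single (Fin.last (n + 1)) (-1))]
        if i = Fin.last (n + 1) then
          pullback (k - 1) (fun t => ∑ j, t j * partialD j h t - k * h t)
        else pullback (k - 1) (partialD i h) := by
      filter_upwards [eventually_last_ne_zero hp',
        eventually_inversionInv hp' hh.eventually_differentiableAt,
        eventually_inversionInv hp' h0] with s h1 h2 h3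
      rw [partialD_pullback h1 h2 h3]
      split_ifs <;> rfl
    rw [map_sub, ← localExpansion_partialD (SmoothNear.pullback hp' hh k),
      localExpansion_congr hder]
    rw [hpp] at hh h0
    by_cases hi : i = Fin.last (n + 1)
    · rw [if_pos hi, hi, pderiv_last_stretch, ← localExpansion_euler hh]
      exact ⟨_, _, smoothNear_euler hh k, partialD_zero_euler hh h0 k, rfl⟩
    · rw [if_neg hi, pderiv_stretch_of_ne _ _ _ hi, ← localExpansion_partialD hh]
      exact ⟨_, _, hh.partialD i, partialD_zero_partialD hh h0 i, rfl⟩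

end Inversion


/-! ### Frobenius potentials and their Taylor expansions -/

section FrobeniusPotential

open MvPowerSeries Topology

variable {𝕜 : Type*} [RCLike 𝕜] {n : ℕ} {U : Set (Fin (n + 2) → 𝕜)}
  {F : (Fin (n + 2) → 𝕜) → 𝕜} {p : Fin (n + 2) → 𝕜}

theorem IsFrobeniusPotential.smoothNear (hF : IsFrobeniusPotential U F) (hU : IsOpen U)
    (hp : p ∈ U) : SmoothNear F p := by
  filter_upwards [hU.mem_nhds hp] with t ht
  exact hF.smooth.contDiffAt (hU.mem_nhds ht)

theorem IsFrobeniusPotential.formalUnit (hF : IsFrobeniusPotential U F) (hU : IsOpen U)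
    (hp : p ∈ U) : FormalUnit (localExpansion F p) := by
  intro a b
  have hs := hF.smoothNear hU hp
  have h : partialD 0 (partialD a (partialD b F)) =ᶠ[𝓝 p] fun _ => eta 𝕜 n a b := by
    filter_upwards [hU.mem_nhds hp] with t ht using hF.unit t ht a b
  rw [← localExpansion_partialD hs, ← localExpansion_partialD (hs.partialD b),
    ← localExpansion_partialD ((hs.partialD b).partialD a), localExpansion_congr h,
    localExpansion_const]
  rfl

theorem IsFrobeniusPotential.formalWDVV (hF : IsFrobeniusPotential U F) (hU : IsOpen U)
    (hp : p ∈ U) : FormalWDVV (localExpansion F p) := by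
  have hs := hF.smoothNear hU hp
  have h3 : ∀ a b c, SmoothNear (partialD a (partialD b (partialD c F))) p := fun a b c =>
    ((hs.partialD c).partialD b).partialD a
  have hT : ∀ a b c, pderiv 𝕜 a (pderiv 𝕜 b (pderiv 𝕜 c (localExpansion F p))) =
      localExpansion (partialD a (partialD b (partialD c F))) p := by
    intro a b c
    rw [← localExpansion_partialD hs, ← localExpansion_partialD (hs.partialD c),
      ← localExpansion_partialD ((hs.partialD c).partialD b)]
  have hsum : ∀ a b c e, ∑ l : Fin (n + 2),
      pderiv 𝕜 a (pderiv 𝕜 b (pderiv 𝕜 l (localExpansion F p))) *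
        pderiv 𝕜 l.rev (pderiv 𝕜 c (pderiv 𝕜 e (localExpansion F p))) =
      localExpansion (fun t => ∑ l : Fin (n + 2), partialD a (partialD b (partialD l F)) t *
        partialD l.rev (partialD c (partialD e F)) t) p := by
    intro a b c e
    rw [localExpansion_sum _ fun l _ => (h3 a b l).mul (h3 l.rev c e)]
    refine Finset.sum_congr rfl fun l _ => ?_
    rw [hT, hT, localExpansion_mul (h3 a b l) (h3 l.rev c e)]
  have heta : ∀ (A B : Fin (n + 2) → 𝕜),
      ∑ μ, ∑ ν, A μ * eta 𝕜 n μ ν * B ν = ∑ l : Fin (n + 2), A l * B l.rev := by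
    intro A B
    refine Finset.sum_congr rfl fun l _ => ?_
    rw [Finset.sum_eq_single l.rev]
    · rw [eta, Matrix.of_apply, if_pos rfl, mul_one]
    · intro s _ hs
      rw [eta, Matrix.of_apply, if_neg hs, mul_zero, zero_mul]
    · intro h
      exact absurd (Finset.mem_univ _) h
  intro a b c e
  rw [hsum, hsum]
  refine localExpansion_congr ?_
  filter_upwards [hU.mem_nhds hp] with t ht
  have h := hF.wdvv t ht a b c e
  rw [heta (fun μ => partialD a (partialD b (partialD μ F)) t)
      (fun ν => partialD ν (partialD c (partialD e F)) t),
    heta (fun μ => partialD a (partialD c (partialD μ F)) t)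
      (fun ν => partialD ν (partialD b (partialD e F)) t)] at h
  exact h

/-- The quadratic form `∑ t^μ t_μ` in the coordinates different from the first and the last
one. -/
def middleSq (t : Fin (n + 2) → 𝕜) : 𝕜 :=
  ∑ i : Fin n, t i.succ.castSucc * t i.succ.castSucc.rev

/-- The function `½ (t^1)² t^n + ½ t^1 ∑ t^μ t_μ`, with the sum over `μ ≠ 1, n`. -/
def cubicPart (t : Fin (n + 2) → 𝕜) : 𝕜 :=
  1 / 2 * (t 0 * t 0 * t (Fin.last (n + 1)) + t 0 * middleSq t)

theorem smoothNear_middleSq : SmoothNear (middleSq : (Fin (n + 2) → 𝕜) → 𝕜) p :=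
  SmoothNear.sum _ fun _ _ => (smoothNear_coord _).mul (smoothNear_coord _)

theorem smoothNear_cubicPart : SmoothNear (cubicPart : (Fin (n + 2) → 𝕜) → 𝕜) p :=
  (smoothNear_const _).mul ((((smoothNear_coord _).mul (smoothNear_coord _)).mul
    (smoothNear_coord _)).add ((smoothNear_coord _).mul smoothNear_middleSq))

theorem partialD_zero_middleSq (t : Fin (n + 2) → 𝕜) : partialD 0 middleSq t = 0 := by
  have hc : ∀ j, DifferentiableAt 𝕜 (fun t : Fin (n + 2) → 𝕜 => t j) t := fun j =>
    differentiableAt_apply j t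
  have hm : ∀ i ∈ (Finset.univ : Finset (Fin n)), DifferentiableAt 𝕜
      (fun t : Fin (n + 2) → 𝕜 => t i.succ.castSucc * t i.succ.castSucc.rev) t := fun i _ =>
    (hc _).mul (hc _)
  refine (partialD_sum_apply Finset.univ hm 0).trans (Finset.sum_eq_zero fun i _ => ?_)
  rw [partialD_mul_apply (hc _) (hc _), partialD_coord, partialD_coord, if_neg (middle_ne_zero i),
    if_neg (middle_rev_ne_zero i)]
  ring

theorem partialD_zero_cubicPart (t : Fin (n + 2) → 𝕜) :
    partialD 0 cubicPart t = 1 / 2 * etaSq t := by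
  have hc : ∀ j, DifferentiableAt 𝕜 (fun t : Fin (n + 2) → 𝕜 => t j) t := fun j =>
    differentiableAt_apply j t
  have hq : DifferentiableAt 𝕜 (middleSq : (Fin (n + 2) → 𝕜) → 𝕜) t :=
    smoothNear_middleSq.eventually_differentiableAt.self_of_nhds
  have h1 : DifferentiableAt 𝕜 (fun t : Fin (n + 2) → 𝕜 => t 0 * t 0) t := (hc 0).mul (hc 0)
  have h2 : DifferentiableAt 𝕜 (fun t : Fin (n + 2) → 𝕜 => t 0 * t 0 * t (Fin.last (n + 1))) t :=
    h1.mul (hc _)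
  have h3 : DifferentiableAt 𝕜 (fun t : Fin (n + 2) → 𝕜 => t 0 * middleSq t) t := (hc 0).mul hq
  have h4 : partialD 0 (cubicPart : (Fin (n + 2) → 𝕜) → 𝕜) t = _ :=
    partialD_mul_apply (differentiableAt_const (1 / 2 : 𝕜)) (h2.add h3) 0
  have h5 : partialD 0 (fun t : Fin (n + 2) → 𝕜 => t 0 * t 0 * t (Fin.last (n + 1)) +
      t 0 * middleSq t) t = etaSq t := by
    rw [partialD_add_apply h2 h3, partialD_mul_apply h1 (hc _), partialD_mul_apply (hc 0) (hc 0),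
      partialD_mul_apply (hc 0) hq, partialD_zero_middleSq, partialD_coord, partialD_coord,
      if_pos rfl, if_neg last_ne_zero, etaSq_eq, middleSq]
    ring
  rw [h4, partialD_const, zero_mul, zero_add]
  exact congrArg (1 / 2 * ·) h5

theorem localExpansion_middleSq (c : 𝕜) :
    localExpansion (middleSq : (Fin (n + 2) → 𝕜) → 𝕜) (Pi.single (Fin.last (n + 1)) c) =
      middleForm 𝕜 n := by
  refine (localExpansion_sum Finset.univ fun i _ =>
    (smoothNear_coord _).mul (smoothNear_coord _)).trans ?_
  rw [middleForm]
  refine Finset.sum_congr rfl fun i _ => ?_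
  rw [localExpansion_mul (smoothNear_coord _) (smoothNear_coord _), localExpansion_coord,
    localExpansion_coord, Pi.single_eq_of_ne (middle_ne_last i),
    Pi.single_eq_of_ne (middle_rev_ne_last i), map_zero, add_zero, add_zero]

theorem coeff_localExpansion_cubicPart (c : 𝕜) {m : Fin (n + 2) →₀ ℕ} (hm : 3 ≤ m.degree) :
    coeff m (localExpansion (cubicPart : (Fin (n + 2) → 𝕜) → 𝕜)
      (Pi.single (Fin.last (n + 1)) c)) = coeff m (unitCubic 𝕜 n) := by
  have h1 : localExpansion (cubicPart : (Fin (n + 2) → 𝕜) → 𝕜)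
      (Pi.single (Fin.last (n + 1)) c) = unitCubic 𝕜 n + C (1 / 2 * c) * (X 0 * X 0) := by
    have hc : ∀ j, SmoothNear (fun t : Fin (n + 2) → 𝕜 => t j)
      (Pi.single (Fin.last (n + 1)) c) := fun j => smoothNear_coord j
    have e : localExpansion (cubicPart : (Fin (n + 2) → 𝕜) → 𝕜)
        (Pi.single (Fin.last (n + 1)) c) = _ :=
      localExpansion_const_mul (1 / 2) ((((hc 0).mul (hc 0)).mul (hc (Fin.last (n + 1)))).add
        ((hc 0).mul smoothNear_middleSq))
    rw [e, localExpansion_add (((hc 0).mul (hc 0)).mul (hc (Fin.last (n + 1))))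
        ((hc 0).mul smoothNear_middleSq), localExpansion_mul ((hc 0).mul (hc 0)) (hc _),
      localExpansion_mul (hc 0) (hc 0), localExpansion_mul (hc 0) smoothNear_middleSq,
      localExpansion_middleSq, localExpansion_coord, localExpansion_coord,
      Pi.single_eq_of_ne (Ne.symm last_ne_zero), Pi.single_eq_same, map_zero, unitCubic,
      Algebra.smul_def]
    have ha : algebraMap ℚ (MvPowerSeries (Fin (n + 2)) 𝕜) (1 / 2) = C (1 / 2) := by
      have h2 := two_mul_algebraMap_half (MvPowerSeries (Fin (n + 2)) 𝕜)
      have h3 : (2 : MvPowerSeries (Fin (n + 2)) 𝕜) * C (1 / 2) = 1 := by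
        rw [← map_ofNat (C : 𝕜 →+* MvPowerSeries (Fin (n + 2)) 𝕜) 2, ← map_mul]
        norm_num
      linear_combination (C (1 / 2 : 𝕜)) * h2 -
        algebraMap ℚ (MvPowerSeries (Fin (n + 2)) 𝕜) (1 / 2) * h3
    rw [ha, map_mul]
    ring
  rw [h1, map_add, coeff_C_mul,
    ((isHomogeneousOfDegree_X 0).mul (isHomogeneousOfDegree_X 0)) m (by omega), mul_zero, add_zero]

theorem coeff_localExpansion_eq (hs : SmoothNear F (Pi.single (Fin.last (n + 1)) 1))
    {m : Fin (n + 2) →₀ ℕ} (hm : 3 ≤ m.degree) :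
    coeff m (localExpansion F (Pi.single (Fin.last (n + 1)) 1)) =
      coeff m (unitCubic 𝕜 n + localExpansion (fun t => F t - cubicPart t)
        (Pi.single (Fin.last (n + 1)) 1)) := by
  rw [localExpansion_sub hs smoothNear_cubicPart, map_add, map_sub,
    coeff_localExpansion_cubicPart 1 hm]
  ring

theorem invertedPotential_eq (F : (Fin (n + 2) → 𝕜) → 𝕜) {s : Fin (n + 2) → 𝕜}
    (hs : s (Fin.last (n + 1)) ≠ 0) :
    invertedPotential F s = cubicPart s + pullback 2 (fun t => F t - cubicPart t) s -
      1 / 8 * pullback 3 (fun t => middleSq t * middleSq t) s := by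
  have hq : middleSq (inversionInv s) = middleSq s / (s (Fin.last (n + 1))) ^ 2 := by
    rw [middleSq, middleSq, Finset.sum_div]
    refine Finset.sum_congr rfl fun i _ => ?_
    rw [inversionInv_apply_of_ne s (middle_ne_zero i) (middle_ne_last i),
      inversionInv_apply_of_ne s (middle_rev_ne_zero i) (middle_rev_ne_last i)]
    field_simp
  have h0 : inversionInv s 0 =
      1 / 2 * ((2 * s 0 * s (Fin.last (n + 1)) + middleSq s) / s (Fin.last (n + 1))) := by
    rw [inversionInv, if_pos rfl, etaSq_eq, middleSq]
  have h2 : (-s (Fin.last (n + 1))) ^ (2 : ℤ) = s (Fin.last (n + 1)) ^ 2 := by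
    rw [show (2 : ℤ) = ((2 : ℕ) : ℤ) by rfl, zpow_natCast]
    ring
  have h3 : (-s (Fin.last (n + 1))) ^ (3 : ℤ) = -s (Fin.last (n + 1)) ^ 3 := by
    rw [show (3 : ℤ) = ((3 : ℕ) : ℤ) by rfl, zpow_natCast]
    ring
  rw [invertedPotential, pullback, pullback, hq, h2, h3, cubicPart, cubicPart, hq, h0,
    inversionInv_apply_last, etaSq_eq]
  change _ * F _ + 1 / 2 * s 0 * (2 * s 0 * s (Fin.last (n + 1)) + middleSq s) = _
  generalize middleSq s = q
  generalize F (inversionInv s) = f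
  field_simp
  ring

/-- The Taylor expansion of the inverted potential, up to terms of degree at most two. -/
theorem coeff_localExpansion_invertedPotential
    (hs : SmoothNear F (Pi.single (Fin.last (n + 1)) 1))
    (h1 : ∀ᶠ t in 𝓝 (Pi.single (Fin.last (n + 1)) 1), partialD 0 F t = 1 / 2 * etaSq t)
    {m : Fin (n + 2) →₀ ℕ} (hm : 3 ≤ m.degree) :
    coeff m (localExpansion (invertedPotential F) (Pi.single (Fin.last (n + 1)) (-1))) =
      coeff m (invertedSeries 1 (localExpansion (fun t => F t - cubicPart t)
        (Pi.single (Fin.last (n + 1)) 1))) := by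
  have hp' : (Pi.single (Fin.last (n + 1)) (-1) : Fin (n + 2) → 𝕜) (Fin.last (n + 1)) ≠ 0 := by
    rw [Pi.single_eq_same]
    norm_num
  have e : invertedPotential F =ᶠ[𝓝 (Pi.single (Fin.last (n + 1)) (-1))] fun s =>
      cubicPart s + pullback 2 (fun t => F t - cubicPart t) s -
        1 / 8 * pullback 3 (fun t => middleSq t * middleSq t) s := by
    filter_upwards [eventually_last_ne_zero hp'] with s hs using invertedPotential_eq F hs
  have s1 : SmoothNear (fun t => F t - cubicPart t) (Pi.single (Fin.last (n + 1)) 1) :=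
    hs.sub smoothNear_cubicPart
  have s2 : SmoothNear (fun t : Fin (n + 2) → 𝕜 => middleSq t * middleSq t)
    (Pi.single (Fin.last (n + 1)) 1) := smoothNear_middleSq.mul smoothNear_middleSq
  have z1 : partialD 0 (fun t => F t - cubicPart t)
      =ᶠ[𝓝 (Pi.single (Fin.last (n + 1)) 1)] fun _ => 0 := by
    filter_upwards [h1, hs.eventually_differentiableAt,
      smoothNear_cubicPart.eventually_differentiableAt] with t e1 d1 d2
    rw [partialD_sub_apply d1 d2, e1, partialD_zero_cubicPart, sub_self]
  have z2 : partialD 0 (fun t : Fin (n + 2) → 𝕜 => middleSq t * middleSq t)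
      =ᶠ[𝓝 (Pi.single (Fin.last (n + 1)) 1)] fun _ => 0 := by
    filter_upwards [smoothNear_middleSq.eventually_differentiableAt] with t d
    rw [partialD_mul_apply d d, partialD_zero_middleSq, zero_mul, mul_zero, add_zero]
  have p1 := SmoothNear.pullback hp' (inversionInv_single (𝕜 := 𝕜) (n := n) ▸ s1) 2
  have p2 := SmoothNear.pullback hp' (inversionInv_single (𝕜 := 𝕜) (n := n) ▸ s2) 3
  rw [localExpansion_congr e,
    localExpansion_sub (smoothNear_cubicPart.add p1) ((smoothNear_const _).mul p2),
    localExpansion_add smoothNear_cubicPart p1, localExpansion_const_mul _ p2,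
    localExpansion_pullback s1 z1, localExpansion_pullback s2 z2,
    localExpansion_mul smoothNear_middleSq smoothNear_middleSq, localExpansion_middleSq,
    invertedSeries, map_sub, map_sub, map_add, map_add, coeff_localExpansion_cubicPart _ hm,
    map_one, one_mul, coeff_C_mul, map_rat_smul (coeff m), Rat.smul_def]
  norm_num

theorem pderiv_zero_localExpansion (hs : SmoothNear F (Pi.single (Fin.last (n + 1)) 1))
    (h1 : ∀ᶠ t in 𝓝 (Pi.single (Fin.last (n + 1)) 1), partialD 0 F t = 1 / 2 * etaSq t) :
    pderiv 𝕜 0 (localExpansion (fun t => F t - cubicPart t)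
      (Pi.single (Fin.last (n + 1)) 1)) = 0 := by
  have z1 : partialD 0 (fun t => F t - cubicPart t)
      =ᶠ[𝓝 (Pi.single (Fin.last (n + 1)) 1)] fun _ => 0 := by
    filter_upwards [h1, hs.eventually_differentiableAt,
      smoothNear_cubicPart.eventually_differentiableAt] with t e1 d1 d2
    rw [partialD_sub_apply d1 d2, e1, partialD_zero_cubicPart, sub_self]
  rw [← localExpansion_partialD (hs.sub smoothNear_cubicPart), localExpansion_congr z1,
    localExpansion_const, map_zero]

end FrobeniusPotential

/-! ### The Givental transform of a total potential -/

section Transform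

open MvPowerSeries

variable {𝕜 : Type*} [RCLike 𝕜] {n : ℕ} {Fg : ℕ → MvPowerSeries (Label n) 𝕜}

theorem coeff_regraded_of_lt (hF : IsStable Fg) {w : ℕ} {m : Label n →₀ ℕ}
    (h : 3 * w < m.degree) : coeff m (PowerSeries.coeff w (regraded Fg)) = 0 := by
  by_cases hg : ∃ g, w + 2 = m.degree + 2 * g
  · obtain ⟨g, hg⟩ := hg
    rw [coeff_regraded Fg hg, hF g m (by omega)]
  · exact coeff_regraded_eq_zero Fg fun g h => hg ⟨g, h⟩

/-- The transform `exp(s (r_1 z)^)` of a total potential, with the time `s` as a parameter. -/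
theorem exists_potentialFlow (hF : IsStable Fg) :
    ∃ W : PowerSeries (MvPowerSeries (Label n) (Polynomial 𝕜)),
      PowerSeries.constantCoeff W = 0 ∧ IsPotentialFlow W ∧
      (∀ (w : ℕ) (m : Label n →₀ ℕ), (∀ g, w + 2 ≠ m.degree + 2 * g) →
        coeff m (PowerSeries.coeff w W) = 0) ∧
      PowerSeries.map (evalTime n (0 : 𝕜)) W = regraded Fg ∧
      IsGiventalTransform (inversionR 𝕜 n) (toFamily (expSeries (regraded Fg)))
        (toFamily (expSeries (PowerSeries.map (evalTime n (1 : 𝕜)) W))) := by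
  obtain ⟨W, hW0, hWT, hW, hexp⟩ := exists_potential_flow (constantCoeff_regraded hF)
    fun w m h => coeff_regraded_of_lt hF h
  refine ⟨W, hW0, hW, coeff_eq_zero_of_flow hW fun w m h => ?_, hWT, fun m j => ?_⟩
  · rw [← coeff_evalTime, ← PowerSeries.coeff_map, hWT, coeff_regraded_eq_zero Fg h]
  · simp only [quantizeSeries_iterate_toFamily]
    by_cases hj : 0 ≤ 2 * j + m.degree
    · obtain ⟨w, hw⟩ := Int.eq_ofNat_of_zero_le hj
      filter_upwards [eventually_ge_atTop (3 * w + 2 * lastCount m + 1)] with N hN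
      rw [sum_inv_factorial_mul_toFamily fun k =>
          PowerSeries.mk fun w => generator^[k] (PowerSeries.coeff w (expSeries (regraded Fg))),
        toFamily_natCast _ hw, toFamily_natCast _ hw, ← hexp w m N hN, map_sum, map_sum]
      refine Finset.sum_congr rfl fun k _ => ?_
      rw [map_rat_smul (PowerSeries.coeff w), map_rat_smul (coeff m), PowerSeries.coeff_mk]
    · refine Eventually.of_forall fun N => ?_
      rw [toFamily_of_neg _ (by omega), Finset.sum_eq_zero]
      intro k _
      rw [toFamily_of_neg _ (by omega), mul_zero]

/-- The genus zero part without descendants of the transformed potential is the formal inversion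
of the original one. -/
theorem coeff_primary_potentialAtOne {f h : MvPowerSeries (Fin (n + 2)) 𝕜} (hu : FormalUnit f)
    (hfh : ∀ m : Fin (n + 2) →₀ ℕ, 3 ≤ m.degree → coeff m f = coeff m (unitCubic 𝕜 n + h))
    (h0 : pderiv 𝕜 0 h = 0) (hF0 : IsDescendantPotential f (Fg 0))
    {W : PowerSeries (MvPowerSeries (Label n) (Polynomial 𝕜))} (hW : IsPotentialFlow W)
    (hg : ∀ (w : ℕ) (m : Label n →₀ ℕ), (∀ g, w + 2 ≠ m.degree + 2 * g) →
        coeff m (PowerSeries.coeff w W) = 0)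
    (hWT : PowerSeries.map (evalTime n (0 : 𝕜)) W = regraded Fg)
    {m : Fin (n + 2) →₀ ℕ} (hm : 3 ≤ m.degree) :
    coeff (primary m) (potentialAtOne W 0) = coeff m (invertedSeries 1 h) := by
  -- the terms of `h` of degree less than three do not matter
  let h' : MvPowerSeries (Fin (n + 2)) 𝕜 := ofCoeff fun m => if 3 ≤ m.degree then coeff m h else 0
  have hh' : ∀ m : Fin (n + 2) →₀ ℕ, 3 ≤ m.degree → coeff m h' = coeff m h := fun m hm => by
    rw [coeff_ofCoeff, if_pos hm]
  have h0' : pderiv 𝕜 0 h' = 0 := by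
    ext m
    rw [coeff_pderiv, coeff_ofCoeff, map_zero (coeff m)]
    split_ifs
    · rw [← coeff_pderiv, h0, map_zero (coeff m)]
    · rw [zero_mul]
  have hinit : ∀ m : Label n →₀ ℕ, (coeff m (genusZero W)).eval 0 = coeff m (Fg 0) := by
    intro m
    by_cases hm2 : m.degree < 2
    · rw [coeff_genusZero_of_lt hm2, Polynomial.eval_zero, hF0.stable m (by omega)]
    · obtain ⟨w, hw⟩ : ∃ w, w + 2 = m.degree := ⟨m.degree - 2, by omega⟩
      rw [coeff_genusZero hw, ← coeff_evalTime, ← PowerSeries.coeff_map, hWT,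
        coeff_regraded Fg (g := 0) (by omega)]
  have hdil : dilatonDerivation (Polynomial 𝕜) n (genusZero W) + (2 : ℕ) • genusZero W = 0 := by
    refine dilaton_of_flow (timeDerivation_genusZero hW hg) fun m => ?_
    have h1 := congrArg (coeff m) (dilaton_of_isPotential hu (isDescendantPotential_iff.1 hF0))
    rw [map_add, coeff_dilatonDerivation, map_nsmul, map_zero] at h1
    rw [map_add, coeff_dilatonDerivation, map_nsmul, Polynomial.eval_add, Polynomial.eval_sub,
      Polynomial.eval_mul, Polynomial.eval_mul, hinit, hinit, nsmul_eq_mul, Polynomial.eval_mul,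
      hinit]
    simpa [nsmul_eq_mul] using h1
  have hflow := isSmallFlow_restrictPrimary (timeDerivation_genusZero hW hg) hdil
  have hsol : restrictPrimary (Polynomial 𝕜) n (genusZero W) =
      invertedSeries Polynomial.X (MvPowerSeries.map Polynomial.C h') := by
    refine hflow.eq (isSmallFlow_invertedSeries h0') fun m => ?_
    have e : MvPowerSeries.map (Polynomial.evalRingHom (0 : 𝕜))
        (invertedSeries Polynomial.X (MvPowerSeries.map Polynomial.C h')) =
        unitCubic 𝕜 n + h' := by
      have e1 : MvPowerSeries.map (Polynomial.evalRingHom (0 : 𝕜))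
          (MvPowerSeries.map Polynomial.C h') = h' := by
        ext m
        simp
      rw [map_invertedSeries, e1, Polynomial.coe_evalRingHom, Polynomial.eval_X, invertedSeries,
        stretch_at_zero, map_zero, zero_mul, smul_zero, sub_zero]
    have e2 := congrArg (coeff m) e
    rw [coeff_map] at e2
    rw [coeff_restrictPrimary, hinit]
    refine Eq.trans ?_ e2.symm
    by_cases hm3 : 3 ≤ m.degree
    · rw [hF0.restrict m hm3, hfh m hm3, map_add, map_add, hh' m hm3]
    · rw [hF0.stable _ (by rw [degree_primary]; omega), map_add, coeff_ofCoeff, if_neg hm3,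
        isHomogeneousOfDegree_unitCubic 𝕜 n m (by omega), add_zero]
  have e1 : MvPowerSeries.map (Polynomial.evalRingHom (1 : 𝕜))
      (MvPowerSeries.map Polynomial.C h') = h' := by
    ext m
    simp
  have e : MvPowerSeries.map (Polynomial.evalRingHom (1 : 𝕜))
      (invertedSeries Polynomial.X (MvPowerSeries.map Polynomial.C h')) =
      invertedSeries 1 h' := by
    rw [map_invertedSeries, e1, Polynomial.coe_evalRingHom, Polynomial.eval_X]
  have hdeg := degree_primary m
  rw [potentialAtOne, coeff_ofCoeff, if_neg (by omega), mul_zero, zero_add,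
    ← coeff_genusZero (W := W) (m := primary m) (by omega), ← coeff_restrictPrimary, hsol]
  refine (congrArg (coeff m) e).trans ?_
  rw [invertedSeries, invertedSeries, map_sub, map_sub, map_add, map_add]
  rw [show coeff m (stretch 2 1 h') = coeff m (stretch 2 1 h) from
    coeff_stretch_congr (k := 2) 1 (fun m hm => hh' m hm) hm]

end Transform

end Givental

end

theorem theorem3p1 {𝕜 : Type*} [RCLike 𝕜] (n : ℕ)
    (U : Set (Fin (n + 2) → 𝕜)) (hU : IsOpen U)
    (hp : Pi.single (Fin.last (n + 1)) 1 ∈ U)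
    (F : (Fin (n + 2) → 𝕜) → 𝕜) (hF : Givental.IsFrobeniusPotential U F)
    (hF₁ : ∀ t ∈ U, Givental.partialD 0 F t = 1 / 2 * Givental.etaSq t) :
    -- the local expansion of `F` at `(0,…,0,1)` determines a genus zero descendant potential
    (∃! F₀ : MvPowerSeries (Givental.Label n) 𝕜, Givental.IsDescendantPotential
      (Givental.localExpansion F (Pi.single (Fin.last (n + 1)) 1)) F₀) ∧
    -- for every total potential with this genus zero part
    ∀ Fg : ℕ → MvPowerSeries (Givental.Label n) 𝕜, Givental.IsStable Fg →
      Givental.IsDescendantPotential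
        (Givental.localExpansion F (Pi.single (Fin.last (n + 1)) 1)) (Fg 0) →
      ∃ (Z Z' : Givental.CoeffFamily 𝕜 n) (G : ℕ → MvPowerSeries (Givental.Label n) 𝕜),
        Givental.IsPartitionFunction Fg Z ∧
        Givental.IsGiventalTransform (Givental.inversionR 𝕜 n) Z Z' ∧
        -- `G` is the `R̂`-transformed potential, uniquely determined by `Z' = R̂ Z`
        Givental.IsStable G ∧ Givental.IsPartitionFunction G Z' ∧
        (∀ G' : ℕ → MvPowerSeries (Givental.Label n) 𝕜, Givental.IsStable G' →
          Givental.IsPartitionFunction G' Z' → G' = G) ∧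
        -- its genus zero part without descendants, up to terms of order at most two
        ∀ m : Fin (n + 2) →₀ ℕ, 3 ≤ m.degree →
          MvPowerSeries.coeff (Givental.primary m) (G 0) =
            MvPowerSeries.coeff m (Givental.localExpansion (Givental.invertedPotential F)
              (Pi.single (Fin.last (n + 1)) (-1))) := by
  obtain ⟨hs, hu, hw⟩ : Givental.SmoothNear F (Pi.single (Fin.last (n + 1)) 1) ∧
      Givental.FormalUnit (Givental.localExpansion F (Pi.single (Fin.last (n + 1)) 1)) ∧
      Givental.FormalWDVV (Givental.localExpansion F (Pi.single (Fin.last (n + 1)) 1)) :=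
    ⟨hF.smoothNear hU hp, hF.formalUnit hU hp, hF.formalWDVV hU hp⟩
  have h1 : ∀ᶠ t in nhds (Pi.single (Fin.last (n + 1)) 1),
      Givental.partialD 0 F t = 1 / 2 * Givental.etaSq t :=
    Filter.mem_of_superset (hU.mem_nhds hp) hF₁
  refine ⟨Givental.existsUnique_isDescendantPotential hw, fun Fg hFg hF0 => ?_⟩
  obtain ⟨W, hW0, hW, hg, hWT, hgiv⟩ := Givental.exists_potentialFlow hFg
  have hG := Givental.isStable_potentialAtOne W
  have hZ' : Givental.IsPartitionFunction (Givental.potentialAtOne W)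
      (Givental.toFamily (Givental.expSeries
        (PowerSeries.map (Givental.evalTime n (1 : 𝕜)) W))) := by
    rw [Givental.isPartitionFunction_iff hG, Givental.regraded_potentialAtOne hW0 hg]
  refine ⟨_, _, Givental.potentialAtOne W, (Givental.isPartitionFunction_iff hFg _).2 rfl, hgiv,
    hG, hZ', fun G' hG' h => Givental.eq_of_isPartitionFunction hG' hG h hZ', fun m hm => ?_⟩
  rw [Givental.coeff_localExpansion_invertedPotential hs h1 hm]
  exact Givental.coeff_primary_potentialAtOne hu
    (fun m hm => Givental.coeff_localExpansion_eq hs hm)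
    (Givental.pderiv_zero_localExpansion hs h1) hF0 hW hg hWT hm
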